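/- Let $\Omega\subset\mathbb R^2$ be bounded and convex. Let $\mathcal N\subset\Omega$ be a network with finitely many links, each a rectifiable curve joining two nodes, and let $s,t$ be two of its nodes. A route is a sequence of links leading from $s$ to $t$ without a repeated node. Suppose that $\mathcal N$ has two different outer routes $\mathcal O_1,\mathcal O_2$: both are simple arcs, each of them meets every other route at most in $s$ and $t$, and all routes lie in the area enclosed by $\mathcal O_1\cup\mathcal O_2$. Suppose that $\mathcal N$ is almost convex, i.e. $s,t\in\partial\,\mathrm{conv}(\mathcal O_1\cup\mathcal O_2)$. Write $l(s,t)$ for the segment from $s$ to $t$, and $L(C)$ for the perimeter length of a convex set $C$ (for a segment: twice its length). The set $I_i(\mathcal N)$ of inner parts of $\mathcal O_i$ consists of the points of $\mathcal O_i$ not on $l(s,t)$ that are between the other outer route $\mathcal O_j$ and $l(s,t)$, i.e. around which the closed curve formed by $\mathcal O_j$ and $l(s,t)$ has nonzero winding number. A disaster destroys all unprotected points of links in the right half-plane $R_G$ of a random directional line $G$, distributed according to the motion-invariant measure $d\rho\,d\theta$ on lines (with both directions equally likely), conditioned on $G\cap\Omega\ne\emptyset$. A link of which some point is destroyed is disconnected,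 and $s\leftrightarrow t$ means that some route has no disconnected link. An arrangement is a choice of the protected points of every link. Let $0<r<1$. The weakest arrangement is the limit $\varepsilon\to0$ of the arrangements in which every link consists alternately of protected parts of length $r\varepsilon$ and unprotected parts of length $(1-r)\varepsilon$. Put $$p=\frac{L(\Omega)+L(l(s,t))-\sum_{i=1}^2 L\big(\mathrm{conv}(I_i(\mathcal N)\cup l(s,t))\big)}{2L(\Omega)} .$$ Then $\Pr(s\leftrightarrow t)=p$ under the weakest arrangement, that is, $\Pr(s\leftrightarrow t)\to p$ for these arrangements as $\varepsilon\to0$. Moreover, $\Pr(s\leftrightarrow t)\ge p$ under every arrangement, and $p$ is the greatest lower bound of $\Pr(s\leftrightarrow t)$ over all arrangements that protect exactly the fraction $r$ of the total length of the network. -/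

import Mathlib

open MeasureTheory Set Filter Topology
open scoped ENNReal unitInterval

noncomputable section

namespace CableNet

/-! The Euclidean plane is `ℂ`. -/

/-! ### Random directional lines -/

/-- A directional line, given by `((ρ, θ), b)`: `ρ ≥ 0` is its distance from the origin, `θ` is the
angle between its normal and the positive real axis, and `b` is one of its two directions:
`(-sin θ, cos θ)` if `b = true` and `(sin θ, -cos θ)` if `b = false`. -/
abbrev DirLine : Type := (ℝ × ℝ) × Bool

/-- The points of the line `G`. -/
def DirLine.points (G : DirLine) : Set ℂ :=
  {z | z.re * Real.cos G.1.2 + z.im * Real.sin G.1.2 = G.1.1}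

/-- The half-plane `R_G` to the right of the directional line `G`. -/
def DirLine.rightHalfPlane (G : DirLine) : Set ℂ :=
  {z | if G.2 = true then G.1.1 ≤ z.re * Real.cos G.1.2 + z.im * Real.sin G.1.2
    else z.re * Real.cos G.1.2 + z.im * Real.sin G.1.2 ≤ G.1.1}

/-- The motion-invariant measure `dρ dθ` on lines (`0 ≤ ρ`, `-π ≤ θ ≤ π`), where each of the two
directions of a line carries the weight `1/2`. -/
def lineMeasure : Measure DirLine :=
  ((volume : Measure (ℝ × ℝ)).restrict (Ici (0 : ℝ) ×ˢ Icc (-Real.pi) Real.pi)).prod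
    ((2⁻¹ : ℝ≥0∞) • Measure.count)

/-- The directional lines that meet `Ω`. -/
def linesMeeting (Ω : Set ℂ) : Set DirLine := {G | (G.points ∩ Ω).Nonempty}

/-- The geometric probability that a random directional line that meets `Ω` lies in `X`. -/
def linePr (Ω : Set ℂ) (X : Set DirLine) : ℝ :=
  (lineMeasure (X ∩ linesMeeting Ω)).toReal / (lineMeasure (linesMeeting Ω)).toReal

open Classical in
/-- The perimeter length of a convex set `C` of the plane: the length of its boundary curve. If `C`
has no interior, it lies on a line, and its boundary curve runs along it to and fro, so that
the perimeter length of a segment is twice its length. -/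
def perimeter (C : Set ℂ) : ℝ :=
  if (interior C).Nonempty then (μH[1] (frontier C)).toReal else 2 * (μH[1] C).toReal

/-! ### Networks -/

/-- A cable network in the plane: nodes `V` at the points `pos v`, and links `E`, where the link `e`
joins the nodes `src e` and `tgt e` along a rectifiable curve of length `len e`, parametrized by
arc length. -/
structure Network (V E : Type*) where
  pos : V → ℂ
  src : E → V
  tgt : E → V
  len : E → ℝ
  curve : E → ℝ → ℂ
  len_pos : ∀ e, 0 < len e
  unitSpeed : ∀ e, HasUnitSpeedOn (curve e) (Icc 0 (len e))
  curve_zero : ∀ e, curve e 0 = pos (src e)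
  curve_len : ∀ e, curve e (len e) = pos (tgt e)

variable {V E : Type*}

/-- The set of points of the link `e`. -/
def Network.linkSet (N : Network V E) (e : E) : Set ℂ := N.curve e '' Icc 0 (N.len e)

/-- The set of points of the network. -/
def Network.carrier (N : Network V E) : Set ℂ := ⋃ e, N.linkSet e

/-- The (undirected) link `e` joins the nodes `u` and `v`. -/
def Network.Joins (N : Network V E) (e : E) (u v : V) : Prop :=
  (N.src e = u ∧ N.tgt e = v) ∨ (N.src e = v ∧ N.tgt e = u)

/-- A route between `s` and `t`: a sequence of links, each starting at the node where the one
before it ends, from `s` to `t` and without a repeated node. -/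
structure Network.Route (N : Network V E) (s t : V) where
  size : ℕ
  node : Fin (size + 1) → V
  link : Fin size → E
  node_zero : node 0 = s
  node_last : node (Fin.last size) = t
  node_injective : Function.Injective node
  joins : ∀ k, N.Joins (link k) (node k.castSucc) (node k.succ)

/-- The set of points of a route. -/
def Network.Route.trace {N : Network V E} {s t : V} (R : N.Route s t) : Set ℂ :=
  ⋃ k, N.linkSet (R.link k)

/-- The route `R` is the simple arc that is parametrized by `γ`. -/
def Network.Route.IsArc {N : Network V E} {s t : V} (R : N.Route s t)
    (γ : Path (N.pos s) (N.pos t)) : Prop :=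
  Function.Injective γ ∧ range γ = R.trace

/-! ### Disasters and arrangements -/

/-- An arrangement (for a fixed disaster level): for every link `e`, the set of those `u` for which
the point of the link at arc length `u ∈ [0, len e]` is not protected, that is, is destroyed
when it is in the disaster area. -/
abbrev Arrangement (E : Type*) : Type _ := E → Set ℝ

/-- The link `e` is not disconnected by the disaster `R_G`: no unprotected point of the link is in
the right half-plane of `G`. -/
def Network.LinkSurvives (N : Network V E) (W : Arrangement E) (G : DirLine) (e : E) : Prop :=
  ∀ u ∈ Icc 0 (N.len e) ∩ W e, N.curve e u ∉ G.rightHalfPlane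

/-- The disasters under which `s` and `t` stay connected: some route has no disconnected link. -/
def Network.connectedEvent (N : Network V E) (s t : V) (W : Arrangement E) : Set DirLine :=
  {G | ∃ R : N.Route s t, ∀ k, N.LinkSurvives W G (R.link k)}

/-- `Pr(s ↔ t)` under the arrangement `W`, for a random disaster `R_G` with `G` meeting `Ω`. -/
def Network.connectionPr (N : Network V E) (Ω : Set ℂ) (s t : V) (W : Arrangement E) : ℝ :=
  linePr Ω (N.connectedEvent s t W)

/-- The alternating arrangement with period `ε`: every link is cut into a protected part of length
`r ε`, an unprotected part of length `(1 - r) ε`, a protected part of length `r ε`, and so on.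
The weakest arrangement is its limit for `ε → 0`. -/
def alternating (E : Type*) (r ε : ℝ) : Arrangement E := fun _ => {u | r ≤ Int.fract (u / ε)}

/-- The arrangement `W` protects exactly the fraction `r` of the total length of the network. -/
def Network.Protects [Fintype E] (N : Network V E) (W : Arrangement E) (r : ℝ) : Prop :=
  (∀ e, MeasurableSet (W e)) ∧
    ∑ e, (volume (Icc 0 (N.len e) \ W e)).toReal = r * ∑ e, N.len e

/-! ### Outer routes -/

/-- The area enclosed by a closed curve `J` (with `J` itself). -/
def enclosedArea (J : Set ℂ) : Set ℂ :=
  J ∪ {z | z ∉ J ∧ Bornology.IsBounded (connectedComponentIn Jᶜ z)}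

/-- `O 0` and `O 1` are two outer routes: each meets every other route at most in `s` and `t`, and
all routes are in the area that they enclose. -/
def Network.IsOuterPair (N : Network V E) {s t : V} (O : Fin 2 → N.Route s t) : Prop :=
  O 0 ≠ O 1 ∧
  (∀ i, ∀ R : N.Route s t, R ≠ O i → R.trace ∩ (O i).trace ⊆ {N.pos s, N.pos t}) ∧
  (∀ R : N.Route s t, R.trace ⊆ enclosedArea ((O 0).trace ∪ (O 1).trace))

/-- The network is almost convex: `s` and `t` are on the boundary of the convex hull of the two outer
routes. -/
def Network.AlmostConvex (N : Network V E) {s t : V} (O : Fin 2 → N.Route s t) : Prop :=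
  N.pos s ∈ frontier (convexHull ℝ ((O 0).trace ∪ (O 1).trace)) ∧
  N.pos t ∈ frontier (convexHull ℝ ((O 0).trace ∪ (O 1).trace))

/-- The direction from `x` to the moving point `f u`, `0 ≤ u ≤ 1`, turns by the total angle `φ`. -/
def SweepsAngle (f : I → ℂ) (x : ℂ) (φ : ℝ) : Prop :=
  ∃ α : I → ℝ, Continuous α ∧
    (∀ u, f u - x = (‖f u - x‖ : ℂ) * Complex.exp ((α u : ℂ) * Complex.I)) ∧ α 1 - α 0 = φ

/-- The point `x` is between the curve `γ` and the segment with the same end points: the closed curve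
that runs along `γ` and back along the segment has a nonzero winding number around `x`, that is,
`γ` and the segment sweep different angles as seen from `x`. -/
def IsBetween {a b : ℂ} (γ : Path a b) (x : ℂ) : Prop :=
  ∃ φ ψ : ℝ, SweepsAngle γ x φ ∧
    SweepsAngle (fun u : I => AffineMap.lineMap a b (u : ℝ)) x ψ ∧ φ ≠ ψ

/-- The inner parts of the outer route `γ`: its points off the segment `l(a,b)` that are between the
other outer route `δ` and `l(a,b)`. -/
def innerPart {a b : ℂ} (γ δ : Path a b) : Set ℂ :=
  {x | x ∈ range γ ∧ x ∉ segment ℝ a b ∧ IsBetween δ x}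

end CableNet

end

/-! ### Continuous angles along curves, and winding seen from a point. -/

namespace CableNet

/-! ### Continuous logarithms and angles -/

/-! The right half-plane of a directional line is `{z | c ≤ proj θ z}`, so everything is expressed
by the support functions `h_C(θ) = sup proj θ` over `C`. Whatever is protected, `s` and `t` stay
connected if the half-plane misses an outer route, that is, if `c > min (h_{O₁}(θ), h_{O₂}(θ))`.
This gives the lower bound (`le_connectionPr`). If unprotected points are `ε`-dense on the links, a
surviving route stays out of the half-plane up to an error `ε`. If a route avoids a half-plane, so
does one of the outer routes (`exists_outer_avoids`), and the lower bound is sharp as `ε → 0`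
(`connectionPr_le`). The limit is `½ ∫ (h_Ω - min (h_{O₁}, h_{O₂})) / ∫ h_Ω`.

Two identities turn this quotient into `p`. Cauchy's formula `L(C) = ∫ h_C`
(`perimeter_eq_integral`) follows by averaging the projections of inscribed polygons. Pointwise in
`θ`, `min (h_{O₁}, h_{O₂}) = h_{I₁ ∪ l} + h_{I₂ ∪ l} - h_l` (`supportFn_innerParts`): beyond the
chord in a given direction, one outer route has only inner points and the other has none.

Both this dichotomy and the avoidance statement come from one winding argument. Almost convexity
puts everything into two half-planes with `s` and `t` on their boundary lines, where the directions
from `s` and to `t` have continuous angles. For arcs `α`, `β` meeting only at their ends, `α u - β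
v` has a continuous angle on the parameter square without two corners. Comparing its edges gives one
odd integer `m` that determines the angle each arc sweeps as seen from every inner point of the
other (`exists_sweepIndex`). The chord sweeps the same turning angle up to `± π`, the sign being the
side of the chord. Hence `m` and the side alone decide which points are inner, and an extreme point
shows `m = ± 1`. If a route avoided a half-plane hit by both outer arcs, both would have the same
index relative to it and sweep equal angles around one of its points. That point would then lie in
the unbounded component, not in the enclosed area. -/

theorem exists_continuousOn_log_of_convex {X : Type*} [NormedAddCommGroup X] [NormedSpace ℝ X]
    {S : Set X} (hS : Convex ℝ S) {f : X → ℂ} (hf : ContinuousOn f S) (h0 : ∀ x ∈ S, f x ≠ 0) :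
    ∃ g : X → ℂ, ContinuousOn g S ∧ ∀ x ∈ S, Complex.exp (g x) = f x := by
  classical
  rcases S.eq_empty_or_nonempty with rfl | ⟨c, hc⟩
  · exact ⟨0, by simp, by simp⟩
  have hmem : ∀ (u : I) (x : S), AffineMap.lineMap c (x : X) (u : ℝ) ∈ S := fun u x =>
    hS.lineMap_mem hc x.2 u.2
  have hfc : Continuous (fun p : I × S => f (AffineMap.lineMap c (p.2 : X) (p.1 : ℝ))) := by
    refine hf.comp_continuous ?_ fun p => hmem p.1 p.2
    simp only [AffineMap.lineMap_apply]
    fun_prop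
  -- Contracting `S` to `c` makes `f` the end of a homotopy that starts at a constant. A constant
  -- logarithm lifts the start, and the covering `exp` of the punctured plane lifts the rest.
  let H : C(I × S, {z : ℂ // z ≠ 0}) :=
    ⟨fun p => ⟨f (AffineMap.lineMap c (p.2 : X) (p.1 : ℝ)), h0 _ (hmem _ _)⟩,
      hfc.subtype_mk _⟩
  let f0 : C(S, ℂ) := ContinuousMap.const _ (Complex.log (f c))
  have H0 : ∀ a, H (0, a) = ⟨Complex.exp (f0 a), Complex.exp_ne_zero _⟩ := by
    intro a
    apply Subtype.ext
    simp [H, f0, Complex.exp_log (h0 c hc)]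
  let L := Complex.isCoveringMap_exp.liftHomotopy H f0 H0
  have hL : ∀ p, Complex.exp (L p) = H p := fun p => by
    have := congr_fun (Complex.isCoveringMap_exp.liftHomotopy_lifts H f0 H0) p
    exact congr_arg Subtype.val this
  refine ⟨fun x => if hx : x ∈ S then L (1, ⟨x, hx⟩) else 0, ?_, ?_⟩
  · rw [continuousOn_iff_continuous_domRestrict]
    have : S.domRestrict (fun x => if hx : x ∈ S then L (1, ⟨x, hx⟩) else 0)
        = fun x : S => L (1, x) := by
      ext x; simp
    rw [this]
    exact L.continuous.comp (by fun_prop)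
  · intro x hx
    simp only [hx, dif_pos]
    rw [hL]
    simp [H]

theorem eq_of_exp_eq_one_of_isPreconnected {X : Type*} [TopologicalSpace X] {S : Set X}
    (hS : IsPreconnected S) {g : X → ℝ} (hg : ContinuousOn g S)
    (h1 : ∀ x ∈ S, Complex.exp ((g x : ℂ) * Complex.I) = 1) {x y : X} (hx : x ∈ S) (hy : y ∈ S) :
    g x = g y := by
  have key : ∀ x ∈ S, ∀ y ∈ S, ¬ g x < g y := by
    intro x hx y hy hlt
    have hpi := Real.pi_pos
    -- The increment is positive and at most `π`, so it cannot be a multiple of `2π`.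
    obtain ⟨z, hz, hzc⟩ := hS.intermediate_value hx hy hg
      (show g x + min Real.pi (g y - g x) ∈ Icc (g x) (g y) from
        ⟨by linarith [le_min hpi.le (sub_pos.2 hlt).le], by linarith [min_le_right Real.pi (g y - g x)]⟩)
    have e1 := h1 x hx
    have e2 := h1 z hz
    rw [hzc] at e2
    push_cast at e2
    rw [add_mul, Complex.exp_add, e1, one_mul] at e2
    obtain ⟨n, hn⟩ := Complex.exp_eq_one_iff.1 e2
    have h3 : ((min Real.pi (g y - g x) : ℝ) : ℂ) * Complex.I
        = ((n * (2 * Real.pi) : ℝ) : ℂ) * Complex.I := by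
      push_cast; rw [hn]; ring
    have h4 : min Real.pi (g y - g x) = n * (2 * Real.pi) := by
      exact_mod_cast mul_right_cancel₀ Complex.I_ne_zero h3
    have h5 : 0 < min Real.pi (g y - g x) := lt_min hpi (sub_pos.2 hlt)
    have h6 : min Real.pi (g y - g x) ≤ Real.pi := min_le_left _ _
    rw [h4] at h5 h6
    have h7 : (0 : ℝ) < n := by
      by_contra h; push Not at h
      nlinarith
    have h8 : (1 : ℝ) ≤ n := by exact_mod_cast (Int.cast_pos.1 h7)
    nlinarith
  exact le_antisymm (not_lt.1 (key y hy x hx)) (not_lt.1 (key x hx y hy))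

theorem exp_sub_eq_one_of_polar {z : ℂ} (hz : z ≠ 0) {α β : ℝ}
    (hα : z = (‖z‖ : ℂ) * Complex.exp ((α : ℂ) * Complex.I))
    (hβ : z = (‖z‖ : ℂ) * Complex.exp ((β : ℂ) * Complex.I)) :
    Complex.exp (((α - β : ℝ) : ℂ) * Complex.I) = 1 := by
  have hn : (‖z‖ : ℂ) ≠ 0 := by simpa using hz
  have : Complex.exp ((α : ℂ) * Complex.I) = Complex.exp ((β : ℂ) * Complex.I) :=
    mul_left_cancel₀ hn (hα.symm.trans hβ)
  push_cast
  rw [sub_mul, Complex.exp_sub, this, div_self (Complex.exp_ne_zero _)]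

/-- Two angle functions differ by a continuous function with values in `2πℤ`, hence by a constant.
Where `f u = x` the polar equation says nothing, so `hx` is needed. -/
theorem SweepsAngle.unique {f : I → ℂ} {x : ℂ} {φ ψ : ℝ} (hx : ∀ u, f u ≠ x)
    (h1 : SweepsAngle f x φ) (h2 : SweepsAngle f x ψ) : φ = ψ := by
  obtain ⟨α, hα, hα', rfl⟩ := h1
  obtain ⟨β, hβ, hβ', rfl⟩ := h2
  have := eq_of_exp_eq_one_of_isPreconnected (S := (univ : Set I)) isPreconnected_univ
    (g := fun u => α u - β u) (hα.sub hβ).continuousOn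
    (fun u _ => exp_sub_eq_one_of_polar (sub_ne_zero.2 (hx u)) (hα' u) (hβ' u))
    (mem_univ 1) (mem_univ 0)
  linarith

theorem polar_mul {z w : ℂ} {α β : ℝ}
    (hz : z = (‖z‖ : ℂ) * Complex.exp ((α : ℂ) * Complex.I))
    (hw : w = (‖w‖ : ℂ) * Complex.exp ((β : ℂ) * Complex.I)) :
    z * w = (‖z * w‖ : ℂ) * Complex.exp (((α + β : ℝ) : ℂ) * Complex.I) := by
  conv_lhs => rw [hz, hw]
  rw [norm_mul]; push_cast
  rw [add_mul, Complex.exp_add]; ring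

theorem polar_arg (z : ℂ) : z = (‖z‖ : ℂ) * Complex.exp ((z.arg : ℂ) * Complex.I) :=
  (Complex.norm_mul_exp_arg_mul_I z).symm

theorem polar_exp (z : ℂ) :
    Complex.exp z = (‖Complex.exp z‖ : ℂ) * Complex.exp ((z.im : ℂ) * Complex.I) := by
  rw [Complex.norm_exp]; push_cast
  rw [← Complex.exp_add, Complex.re_add_im]

/-- A curve whose quotient by a constant direction avoids the negative real axis sweeps the
difference of the principal arguments. -/
theorem SweepsAngle.of_slitPlane {f : I → ℂ} (hf : Continuous f) {x c : ℂ} (hc : c ≠ 0)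
    (h : ∀ u, (f u - x) / c ∈ Complex.slitPlane) :
    SweepsAngle f x (((f 1 - x) / c).arg - ((f 0 - x) / c).arg) := by
  refine ⟨fun u => ((f u - x) / c).arg + c.arg, ?_, fun u => ?_, by ring⟩
  · refine Continuous.add (continuous_iff_continuousAt.2 fun u => ?_) continuous_const
    exact (Complex.continuousAt_arg (h u)).comp
      (f := fun u => (f u - x) / c) (((hf.sub continuous_const).div_const c).continuousAt)
  · have := polar_mul (polar_arg ((f u - x) / c)) (polar_arg c)
    rwa [div_mul_cancel₀ _ hc] at this

theorem mem_slitPlane_of_re_nonneg {z : ℂ} (h : 0 ≤ z.re) (hz : z ≠ 0) : z ∈ Complex.slitPlane := by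
  rw [Complex.mem_slitPlane_iff]
  by_contra hcon
  push Not at hcon
  exact hz (Complex.ext (le_antisymm hcon.1 h) hcon.2)

/-- If `x` is strictly separated from the curve `γ`, then it is not between `γ` and its chord. -/
theorem not_isBetween_of_separated {a b : ℂ} {γ : Path a b} {x w : ℂ}
    (h : ∀ u, 0 < ((γ u - x) * w).re) : ¬ IsBetween γ x := by
  rintro ⟨φ, ψ, hφ, hψ, hne⟩
  have hw : w ≠ 0 := by
    rintro rfl
    simpa using h 0
  have hseg : ∀ u : I, 0 < ((AffineMap.lineMap a b (u : ℝ) - x) * w).re := by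
    intro u
    have h0 := h 0
    have h1 := h 1
    rw [γ.source] at h0
    rw [γ.target] at h1
    have : ((AffineMap.lineMap a b (u : ℝ) - x) * w)
        = ((1 - u : ℝ) : ℂ) * ((a - x) * w) + ((u : ℝ) : ℂ) * ((b - x) * w) := by
      simp only [AffineMap.lineMap_apply, vsub_eq_sub, vadd_eq_add, Complex.real_smul]
      push_cast; ring
    rw [this, Complex.add_re, Complex.re_ofReal_mul, Complex.re_ofReal_mul]
    rcases eq_or_lt_of_le u.2.1 with h' | h'
    · rw [← h']; simpa using h0
    · have := u.2.2
      have h3 : 0 ≤ (1 - (u : ℝ)) * ((a - x) * w).re := mul_nonneg (by linarith) h0.le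
      have h4 := mul_pos h' h1
      linarith
  -- Curve and chord stay in the same open half-plane as seen from `x`, where the principal argument
  -- works. Both therefore sweep the difference of the arguments at their common ends.
  have s1 := SweepsAngle.of_slitPlane (f := γ) γ.continuous (x := x) (inv_ne_zero hw)
    (fun u => by rw [div_inv_eq_mul]; exact Or.inl (h u))
  have s2 := SweepsAngle.of_slitPlane (f := fun u : I => AffineMap.lineMap a b (u : ℝ))
    (by simp only [AffineMap.lineMap_apply]; fun_prop) (x := x) (inv_ne_zero hw)
    (fun u => by rw [div_inv_eq_mul]; exact Or.inl (hseg u))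
  have e1 := SweepsAngle.unique (fun u hu => by have := h u; rw [hu] at this; simp at this) hφ s1
  have e2 := SweepsAngle.unique (fun u hu => by have := hseg u; rw [hu] at this; simp at this) hψ s2
  apply hne
  rw [e1, e2]
  simp

/-! ### Angles seen from the end points -/

/-- The angle of the direction `w`, in the range `[c - π, c + π]`. -/
noncomputable def dirAngle (c : ℝ) (w : ℂ) : ℝ :=
  c + (w * Complex.exp (-(c : ℂ) * Complex.I)).arg

theorem polar_dirAngle (c : ℝ) (w : ℂ) :
    w = (‖w‖ : ℂ) * Complex.exp ((dirAngle c w : ℂ) * Complex.I) := by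
  have h := polar_mul (polar_arg (w * Complex.exp (-(c : ℂ) * Complex.I)))
    (polar_exp ((c : ℂ) * Complex.I))
  have e : w * Complex.exp (-(c : ℂ) * Complex.I) * Complex.exp ((c : ℂ) * Complex.I) = w := by
    rw [mul_assoc, ← Complex.exp_add]; simp
  rw [e] at h
  convert h using 4
  simp [dirAngle, add_comm]

/-- This fixes the multiple of `2π`: the chord direction has angle exactly `0` from both ends,
whichever supporting lines are chosen. -/
theorem dirAngle_one {c : ℝ} (hc : |c| ≤ Real.pi / 2) : dirAngle c 1 = 0 := by
  have hpi := Real.pi_pos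
  rw [abs_le] at hc
  have : (1 : ℂ) * Complex.exp (-(c : ℂ) * Complex.I) = Complex.exp (((-c : ℝ) : ℂ) * Complex.I) := by
    push_cast; ring
  rw [dirAngle, this, Complex.arg_exp_mul_I, toIocMod_eq_self _ |>.2]
  · ring
  · constructor <;> linarith [hc.1, hc.2]

/-- After rotation by `-c` the closed half-plane becomes the right one, which without `0` avoids the
branch cut of the argument. -/
theorem continuousAt_dirAngle {c : ℝ} {w : ℂ} (h : 0 ≤ (w * Complex.exp (-(c : ℂ) * Complex.I)).re)
    (hw : w ≠ 0) : ContinuousAt (dirAngle c) w := by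
  refine continuousAt_const.add ?_
  exact (Complex.continuousAt_arg (mem_slitPlane_of_re_nonneg h
    (mul_ne_zero hw (Complex.exp_ne_zero _)))).comp
    (f := fun w => w * Complex.exp (-(c : ℂ) * Complex.I)) (by fun_prop)

theorem abs_dirAngle_le {c : ℝ} {w : ℂ} (hc : |c| ≤ Real.pi / 2)
    (h : 0 ≤ (w * Complex.exp (-(c : ℂ) * Complex.I)).re) : |dirAngle c w| ≤ Real.pi := by
  have := Complex.abs_arg_le_pi_div_two_iff.2 h
  exact (abs_add_le _ _).trans (by linarith)

end CableNet

/-! ### The winding index of two arcs, and the side of the chord. -/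

namespace CableNet

/-! ### Pairs of arcs with common end points -/

/-- The intersection of two half-planes with `s` and `t` on their boundary lines, whose inner normals
have the angles `a` and `b + π` with respect to the direction from `s` to `t`. -/
def supportSet (s t : ℂ) (a b : ℝ) : Set ℂ :=
  {z | 0 ≤ ((z - s) / (t - s) * Complex.exp (-(a : ℂ) * Complex.I)).re ∧
    0 ≤ ((t - z) / (t - s) * Complex.exp (-(b : ℂ) * Complex.I)).re}

/-- The angle from the direction of `z - s` to the direction of `t - z`, normalized in `supportSet`. -/
noncomputable def turnAngle (s t : ℂ) (a b : ℝ) (z : ℂ) : ℝ :=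
  dirAngle b ((t - z) / (t - s)) - dirAngle a ((z - s) / (t - s))

variable {s t : ℂ} {a b : ℝ}

theorem continuousAt_dirAngle_source {z : ℂ} (hst : s ≠ t) (hz : z ∈ supportSet s t a b)
    (hzs : z ≠ s) : ContinuousAt (fun z => dirAngle a ((z - s) / (t - s))) z :=
  (continuousAt_dirAngle hz.1 (div_ne_zero (sub_ne_zero.2 hzs) (sub_ne_zero.2 hst.symm))).comp
    (f := fun z => (z - s) / (t - s)) (by fun_prop)

theorem continuousAt_dirAngle_target {z : ℂ} (hst : s ≠ t) (hz : z ∈ supportSet s t a b)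
    (hzt : z ≠ t) : ContinuousAt (fun z => dirAngle b ((t - z) / (t - s))) z :=
  (continuousAt_dirAngle hz.2
    (div_ne_zero (sub_ne_zero.2 hzt.symm) (sub_ne_zero.2 hst.symm))).comp
    (f := fun z => (t - z) / (t - s)) (by fun_prop)

/-- A normalized swept angle of two arcs from `s` to `t`: as seen from the points of one of them, the
other one sweeps the turning angle up to `± m π`. -/
def SweepIndex (a b : ℝ) (α β : Path s t) (m : ℤ) : Prop :=
  Odd m ∧ (∀ u : I, 0 < (u : ℝ) → (u : ℝ) < 1 →
      SweepsAngle β (α u) (turnAngle s t a b (α u) + m * Real.pi)) ∧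
    (∀ v : I, 0 < (v : ℝ) → (v : ℝ) < 1 →
      SweepsAngle α (β v) (turnAngle s t a b (β v) - m * Real.pi))

theorem SweepIndex.symm {α β : Path s t} {m : ℤ} (h : SweepIndex a b α β m) :
    SweepIndex a b β α (-m) := by
  refine ⟨h.1.neg, fun u h0 h1 => ?_, fun u h0 h1 => ?_⟩
  · have := h.2.2 u h0 h1
    push_cast
    rwa [neg_mul, ← sub_eq_add_neg]
  · have := h.2.1 u h0 h1
    push_cast
    rwa [neg_mul, sub_neg_eq_add]

/-- The arcs `α` and `β` from `s` to `t` meet only in their common end points. -/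
def MeetOnlyAtEnds (α β : Path s t) : Prop :=
  ∀ u v : I, α u = β v → ((u : ℝ) = 0 ∧ (v : ℝ) = 0) ∨ ((u : ℝ) = 1 ∧ (v : ℝ) = 1)

/-- The parameter square without two opposite corners, a convex set. -/
def cutSquare : Set (ℝ × ℝ) :=
  {p | (0 ≤ p.1 ∧ p.1 ≤ 1) ∧ (0 ≤ p.2 ∧ p.2 ≤ 1) ∧ 0 < p.1 + p.2 ∧ p.1 + p.2 < 2}

theorem convex_cutSquare : Convex ℝ cutSquare := by
  rintro ⟨x1, x2⟩ ⟨⟨h1, h2⟩, ⟨h3, h4⟩, h5, h6⟩ ⟨y1, y2⟩ ⟨⟨g1, g2⟩, ⟨g3, g4⟩, g5, g6⟩ p q hp hq hpq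
  simp only [cutSquare, mem_ofPred_eq, Prod.smul_mk, Prod.mk_add_mk, smul_eq_mul] at *
  refine ⟨⟨by positivity, by nlinarith⟩, ⟨by positivity, by nlinarith⟩, ?_, ?_⟩
  · rcases hp.eq_or_lt with h | h
    · subst h; have : q = 1 := by linarith
      subst this; linarith
    · nlinarith [mul_pos h h5, mul_nonneg hq g5.le]
  · rcases hp.eq_or_lt with h | h
    · subst h; have : q = 1 := by linarith
      subst this; linarith
    · nlinarith [mul_pos h (sub_pos.2 h6), mul_nonneg hq (sub_pos.2 g6).le]

/-- Uniqueness of lifts, used to identify the angle on each edge of the parameter square from its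
value at one corner. -/
theorem eq_of_polar_of_isPreconnected {X : Type*} [TopologicalSpace X] {S : Set X}
    (hS : IsPreconnected S) {w : X → ℂ} {A B : X → ℝ} (hA : ContinuousOn A S)
    (hB : ContinuousOn B S) (hw : ∀ x ∈ S, w x ≠ 0)
    (hwA : ∀ x ∈ S, w x = (‖w x‖ : ℂ) * Complex.exp ((A x : ℂ) * Complex.I))
    (hwB : ∀ x ∈ S, w x = (‖w x‖ : ℂ) * Complex.exp ((B x : ℂ) * Complex.I))
    {x y : X} (hx : x ∈ S) (hy : y ∈ S) (h : A y = B y) : A x = B x := by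
  have := eq_of_exp_eq_one_of_isPreconnected hS (hA.sub hB)
    (fun x hx => exp_sub_eq_one_of_polar (hw x hx) (hwA x hx) (hwB x hx)) hx hy
  simp only [Pi.sub_apply] at this
  linarith

theorem exp_int_mul_pi_of_odd {m : ℤ} (hm : Odd m) :
    Complex.exp (((m * Real.pi : ℝ) : ℂ) * Complex.I) = -1 := by
  obtain ⟨k, rfl⟩ := hm
  have : (((((2 * k + 1 : ℤ) : ℝ) * Real.pi : ℝ) : ℂ) * Complex.I)
      = k * (2 * Real.pi * Complex.I) + Real.pi * Complex.I := by push_cast; ring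
  rw [this, Complex.exp_add, Complex.exp_int_mul_two_pi_mul_I, Complex.exp_pi_mul_I, one_mul]

theorem exists_odd_of_exp_eq_neg_one {x : ℝ} (h : Complex.exp ((x : ℂ) * Complex.I) = -1) :
    ∃ m : ℤ, Odd m ∧ x = m * Real.pi := by
  have h2 : Complex.exp ((x : ℂ) * Complex.I - Real.pi * Complex.I) = 1 := by
    rw [Complex.exp_sub, h, Complex.exp_pi_mul_I, div_self (by norm_num)]
  obtain ⟨n, hn⟩ := Complex.exp_eq_one_iff.1 h2
  refine ⟨2 * n + 1, ⟨n, rfl⟩, ?_⟩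
  have : (x : ℂ) * Complex.I = (((2 * n + 1 : ℤ) : ℝ) * Real.pi : ℝ) * Complex.I := by
    push_cast
    linear_combination hn
  exact_mod_cast mul_right_cancel₀ Complex.I_ne_zero this

theorem polar_neg_of_odd {w : ℂ} {θ : ℝ} {m : ℤ} (hm : Odd m)
    (h : w = (‖w‖ : ℂ) * Complex.exp ((θ : ℂ) * Complex.I)) :
    -w = (‖-w‖ : ℂ) * Complex.exp (((θ + m * Real.pi : ℝ) : ℂ) * Complex.I) := by
  have := polar_mul h (w := -1) (β := m * Real.pi) (by rw [exp_int_mul_pi_of_odd hm]; simp)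
  simpa using this

/-- The quotient `(α u - β v) / (t - s)` vanishes only at the two removed corners, so it has a
continuous angle `A` on the convex set `cutSquare`. Differences of `A` across the square are the
swept angles, and the edge values are angles normalized by the half-planes at `s` and `t`. The same
`m` serves both arcs because it is read off from a single function `A`. -/
theorem exists_sweepIndex (hst : s ≠ t) (ha : |a| ≤ Real.pi / 2) (hb : |b| ≤ Real.pi / 2)
    {α β : Path s t} (hα : range α ⊆ supportSet s t a b) (hβ : range β ⊆ supportSet s t a b)
    (hαβ : MeetOnlyAtEnds α β) : ∃ m : ℤ, SweepIndex a b α β m := by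
  have hd : t - s ≠ 0 := sub_ne_zero.2 hst.symm
  have hF : ContinuousOn (fun p : ℝ × ℝ => (α.extend p.1 - β.extend p.2) / (t - s)) cutSquare := by
    apply Continuous.continuousOn
    fun_prop
  have hF0 : ∀ p ∈ cutSquare, (α.extend p.1 - β.extend p.2) / (t - s) ≠ 0 := by
    rintro ⟨x, y⟩ ⟨h1, h2, h3, h4⟩ h
    rw [div_eq_zero_iff, or_iff_left hd, sub_eq_zero] at h
    simp only at h h1 h2 h3 h4
    rw [Path.extend_apply _ h1, Path.extend_apply _ h2] at h
    rcases hαβ _ _ h with h | h <;> simp only at h <;> linarith [h.1, h.2]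
  obtain ⟨g, hg, hgF⟩ := exists_continuousOn_log_of_convex convex_cutSquare hF hF0
  have m10 : ((1 : ℝ), (0 : ℝ)) ∈ cutSquare := by simp [cutSquare]
  have m01 : ((0 : ℝ), (1 : ℝ)) ∈ cutSquare := by simp [cutSquare]
  -- The quotient is `1` at the corner `(1, 0)`, so the angle may be normalized to `0` there. At
  -- `(0, 1)` it is `-1`, which makes `m` odd.
  set A : ℝ × ℝ → ℝ := fun p => (g p).im - (g (1, 0)).im with hAdef
  have hA : ContinuousOn A cutSquare := (Complex.continuous_im.comp_continuousOn hg).sub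
    continuousOn_const
  have g10 : Complex.exp (((-(g (1, 0)).im : ℝ) : ℂ) * Complex.I) = 1 := by
    have h := polar_exp (g (1, 0))
    rw [hgF _ m10] at h
    simp only [Path.extend_one, Path.extend_zero] at h
    rw [div_self hd] at h
    simp only [norm_one, Complex.ofReal_one, one_mul] at h
    push_cast
    rw [neg_mul, Complex.exp_neg, ← h, inv_one]
  have hAF : ∀ p ∈ cutSquare, (α.extend p.1 - β.extend p.2) / (t - s)
      = (‖(α.extend p.1 - β.extend p.2) / (t - s)‖ : ℂ) * Complex.exp ((A p : ℂ) * Complex.I) := by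
    intro p hp
    have h1 := polar_exp (g p)
    rw [hgF p hp] at h1
    have h2 := polar_mul h1 (w := 1) (β := -(g (1, 0)).im) (by rw [g10]; simp)
    simpa only [mul_one, ← sub_eq_add_neg] using h2
  have hA10 : A (1, 0) = 0 := by simp [hAdef]
  obtain ⟨m, hm, hA01⟩ : ∃ m : ℤ, Odd m ∧ A (0, 1) = m * Real.pi := by
    apply exists_odd_of_exp_eq_neg_one
    have h := hAF _ m01
    simp only [Path.extend_one, Path.extend_zero] at h
    have e : (s - t) / (t - s) = -1 := by rw [← neg_sub, neg_div, div_self hd]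
    rw [e] at h
    simpa using h.symm
  have hαm : ∀ x : ℝ, α.extend x ∈ supportSet s t a b := fun x => hα (by
    rw [← Path.extend_range]; exact mem_range_self x)
  have hβm : ∀ x : ℝ, β.extend x ∈ supportSet s t a b := fun x => hβ (by
    rw [← Path.extend_range]; exact mem_range_self x)
  have ne0 : ∀ {x y : ℝ}, (x, y) ∈ cutSquare → α.extend x ≠ β.extend y := fun h h' =>
    hF0 _ h (by simp [h'])
  have sq_bot : ∀ {x : ℝ}, x ∈ Ioc (0 : ℝ) 1 → (x, (0 : ℝ)) ∈ cutSquare := fun h => by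
    simp only [cutSquare, mem_ofPred_eq]; refine ⟨⟨?_, ?_⟩, ⟨?_, ?_⟩, ?_, ?_⟩ <;> linarith [h.1, h.2]
  have sq_left : ∀ {x : ℝ}, x ∈ Ioc (0 : ℝ) 1 → ((0 : ℝ), x) ∈ cutSquare := fun h => by
    simp only [cutSquare, mem_ofPred_eq]; refine ⟨⟨?_, ?_⟩, ⟨?_, ?_⟩, ?_, ?_⟩ <;> linarith [h.1, h.2]
  have sq_top : ∀ {x : ℝ}, x ∈ Ico (0 : ℝ) 1 → (x, (1 : ℝ)) ∈ cutSquare := fun h => by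
    simp only [cutSquare, mem_ofPred_eq]; refine ⟨⟨?_, ?_⟩, ⟨?_, ?_⟩, ?_, ?_⟩ <;> linarith [h.1, h.2]
  have sq_right : ∀ {x : ℝ}, x ∈ Ico (0 : ℝ) 1 → ((1 : ℝ), x) ∈ cutSquare := fun h => by
    simp only [cutSquare, mem_ofPred_eq]; refine ⟨⟨?_, ?_⟩, ⟨?_, ?_⟩, ?_, ?_⟩ <;> linarith [h.1, h.2]
  have d0 : (t - s) / (t - s) = 1 := div_self hd
  -- On each edge one of the two points is `s` or `t`, so `dirAngle` is a second continuous angle.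
  -- The bottom and right edges are anchored at `(1, 0)`, the top and left edges at `(0, 1)`.
  have edge_bot : ∀ u ∈ Ioc (0 : ℝ) 1, A (u, 0) = dirAngle a ((α.extend u - s) / (t - s)) := by
    intro u hu
    refine eq_of_polar_of_isPreconnected (w := fun u => (α.extend u - s) / (t - s))
      (A := fun u => A (u, 0)) (B := fun u => dirAngle a ((α.extend u - s) / (t - s)))
      isPreconnected_Ioc (hA.comp (by fun_prop) fun x hx => sq_bot hx) ?_ ?_ ?_
      (fun _ _ => polar_dirAngle _ _) hu (right_mem_Ioc.2 one_pos) ?_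
    · intro x hx
      have := ne0 (sq_bot hx)
      rw [Path.extend_zero] at this
      exact ((continuousAt_dirAngle_source hst (hαm x) this).comp
        (α.continuous_extend.continuousAt)).continuousWithinAt
    · intro x hx
      have := hF0 _ (sq_bot hx)
      simpa using this
    · intro x hx
      have := hAF _ (sq_bot hx)
      simpa using this
    · simp only [Path.extend_one, d0, dirAngle_one ha, hA10]
  have edge_right : ∀ v ∈ Ico (0 : ℝ) 1, A (1, v) = dirAngle b ((t - β.extend v) / (t - s)) := by
    intro u hu
    refine eq_of_polar_of_isPreconnected (w := fun u => (t - β.extend u) / (t - s))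
      (A := fun u => A (1, u)) (B := fun u => dirAngle b ((t - β.extend u) / (t - s)))
      isPreconnected_Ico (hA.comp (by fun_prop) fun x hx => sq_right hx) ?_ ?_ ?_
      (fun _ _ => polar_dirAngle _ _) hu (left_mem_Ico.2 one_pos) ?_
    · intro x hx
      have := ne0 (sq_right hx)
      rw [Path.extend_one] at this
      exact ((continuousAt_dirAngle_target hst (hβm x) this.symm).comp
        (β.continuous_extend.continuousAt)).continuousWithinAt
    · intro x hx
      have := hF0 _ (sq_right hx)
      simpa using this
    · intro x hx
      have := hAF _ (sq_right hx)
      simpa using this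
    · simp only [Path.extend_zero, d0, dirAngle_one hb, hA10]
  have edge_top : ∀ u ∈ Ico (0 : ℝ) 1,
      A (u, 1) = dirAngle b ((t - α.extend u) / (t - s)) + m * Real.pi := by
    intro u hu
    refine eq_of_polar_of_isPreconnected (w := fun u => (α.extend u - t) / (t - s))
      (A := fun u => A (u, 1))
      (B := fun u => dirAngle b ((t - α.extend u) / (t - s)) + m * Real.pi)
      isPreconnected_Ico (hA.comp (by fun_prop) fun x hx => sq_top hx) ?_ ?_ ?_
      ?_ hu (left_mem_Ico.2 one_pos) ?_
    · intro x hx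
      have := ne0 (sq_top hx)
      rw [Path.extend_one] at this
      exact (((continuousAt_dirAngle_target hst (hαm x) this).comp
        (α.continuous_extend.continuousAt)).add continuousAt_const).continuousWithinAt
    · intro x hx
      have := hF0 _ (sq_top hx)
      simpa using this
    · intro x hx
      have := hAF _ (sq_top hx)
      simpa using this
    · intro x hx
      have := polar_neg_of_odd hm (polar_dirAngle b ((t - α.extend x) / (t - s)))
      rwa [← neg_div, neg_sub] at this
    · simp only [Path.extend_zero, d0, dirAngle_one hb, hA01, zero_add]
  have edge_left : ∀ v ∈ Ioc (0 : ℝ) 1,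
      A (0, v) = dirAngle a ((β.extend v - s) / (t - s)) + m * Real.pi := by
    intro u hu
    refine eq_of_polar_of_isPreconnected (w := fun u => (s - β.extend u) / (t - s))
      (A := fun u => A (0, u))
      (B := fun u => dirAngle a ((β.extend u - s) / (t - s)) + m * Real.pi)
      isPreconnected_Ioc (hA.comp (by fun_prop) fun x hx => sq_left hx) ?_ ?_ ?_
      ?_ hu (right_mem_Ioc.2 one_pos) ?_
    · intro x hx
      have := ne0 (sq_left hx)
      rw [Path.extend_zero] at this
      exact (((continuousAt_dirAngle_source hst (hβm x) this.symm).comp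
        (β.continuous_extend.continuousAt)).add continuousAt_const).continuousWithinAt
    · intro x hx
      have := hF0 _ (sq_left hx)
      simpa using this
    · intro x hx
      have := hAF _ (sq_left hx)
      simpa using this
    · intro x hx
      have := polar_neg_of_odd hm (polar_dirAngle a ((β.extend x - s) / (t - s)))
      rwa [← neg_div, neg_sub] at this
    · simp only [Path.extend_one, d0, dirAngle_one ha, hA01, zero_add]
  have hpd := polar_arg (t - s)
  refine ⟨m, hm, fun u h0 h1 => ?_, fun v h0 h1 => ?_⟩
  · have hsq : ∀ v : I, ((u : ℝ), (v : ℝ)) ∈ cutSquare := fun v =>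
      ⟨u.2, v.2, by simp only; linarith [v.2.1], by simp only; linarith [v.2.2]⟩
    -- `A` measures `α u - β v`; looking from `α u` reverses this direction, hence the additional
    -- `π`.
    refine ⟨fun v => (A (u, v) + (t - s).arg) + ((1 : ℤ) : ℝ) * Real.pi, ?_, fun v => ?_, ?_⟩
    · refine ((hA.comp_continuous (f := fun v : I => ((u : ℝ), (v : ℝ))) (by fun_prop) hsq).add
        continuous_const).add continuous_const
    · have h := polar_neg_of_odd (m := 1) odd_one (polar_mul (hAF _ (hsq v)) hpd)
      rwa [div_mul_cancel₀ _ hd, neg_sub, Path.extend_apply _ u.2, Path.extend_apply _ v.2] at h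
    · have e1 := edge_bot u ⟨h0, h1.le⟩
      have e2 := edge_top u ⟨h0.le, h1⟩
      rw [Path.extend_apply _ u.2] at e1 e2
      simp only [Icc.coe_one, Icc.coe_zero, turnAngle] at *
      rw [e1, e2]; ring
  · have hsq : ∀ u : I, ((u : ℝ), (v : ℝ)) ∈ cutSquare := fun u =>
      ⟨u.2, v.2, by simp only; linarith [u.2.1], by simp only; linarith [u.2.2]⟩
    refine ⟨fun u => A (u, v) + (t - s).arg, ?_, fun u => ?_, ?_⟩
    · refine (hA.comp_continuous (f := fun u : I => ((u : ℝ), (v : ℝ))) (by fun_prop) hsq).add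
        continuous_const
    · have h := polar_mul (hAF _ (hsq u)) hpd
      rwa [div_mul_cancel₀ _ hd, Path.extend_apply _ u.2, Path.extend_apply _ v.2] at h
    · have e1 := edge_left v ⟨h0, h1.le⟩
      have e2 := edge_right v ⟨h0.le, h1⟩
      rw [Path.extend_apply _ v.2] at e1 e2
      simp only [Icc.coe_one, Icc.coe_zero, turnAngle] at *
      rw [e1, e2]; ring

/-! ### The side of the chord -/

/-- The angle that the segment from `s` to `t` sweeps as seen from `x`. -/
noncomputable def chordAngle (s t x : ℂ) : ℝ := ((t - x) / (s - x)).arg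

/-- If the quotient were `-k` with `k ≥ 0`, then `x` would be the convex combination of `s` and the
chord point with weights `k / (1 + k)` and `1 / (1 + k)`, hence on the chord. -/
theorem lineMap_sub_div_mem_slitPlane {x : ℂ} (hx : x ∉ segment ℝ s t) (u : I) :
    (AffineMap.lineMap s t (u : ℝ) - x) / (s - x) ∈ Complex.slitPlane := by
  have hsx : s - x ≠ 0 := sub_ne_zero.2 fun h => hx (h ▸ left_mem_segment ℝ s t)
  by_contra hcon
  rw [Complex.mem_slitPlane_iff_not_le_zero, not_not] at hcon
  set q := (AffineMap.lineMap s t (u : ℝ) - x) / (s - x) with hq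
  obtain ⟨h1, h2⟩ := Complex.le_def.1 hcon
  have hqr : q = ((-(-q.re) : ℝ) : ℂ) := by
    apply Complex.ext <;> simp [h2]
  set k := -q.re with hk
  have hk0 : 0 ≤ k := by simp only [hk]; simpa using h1
  have hk1 : (0 : ℝ) < 1 + k := by linarith
  have e : (AffineMap.lineMap s t (u : ℝ) : ℂ) - x = -(k : ℂ) * (s - x) := by
    have := div_mul_cancel₀ (AffineMap.lineMap s t (u : ℝ) - x) hsx
    rw [← hq, hqr] at this
    rw [← this]; push_cast; ring
  apply hx
  have hseg : AffineMap.lineMap s t (u : ℝ) ∈ segment ℝ s t := by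
    rw [segment_eq_image_lineMap]; exact ⟨u, u.2, rfl⟩
  have hx' : x = (k / (1 + k)) • s + (1 / (1 + k)) • (AffineMap.lineMap s t (u : ℝ) : ℂ) := by
    have hk2 : (1 + k : ℂ) ≠ 0 := by exact_mod_cast hk1.ne'
    simp only [Complex.real_smul]
    push_cast
    field_simp
    linear_combination -e
  rw [hx']
  exact convex_segment s t (left_mem_segment ℝ s t) hseg (by positivity) (by positivity)
    (by field_simp; ring)

theorem sweepsAngle_lineMap {x : ℂ} (hx : x ∉ segment ℝ s t) :
    SweepsAngle (fun u : I => AffineMap.lineMap s t (u : ℝ)) x (chordAngle s t x) := by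
  have hsx : s - x ≠ 0 := sub_ne_zero.2 fun h => hx (h ▸ left_mem_segment ℝ s t)
  have := SweepsAngle.of_slitPlane (f := fun u : I => AffineMap.lineMap s t (u : ℝ))
    (by simp only [AffineMap.lineMap_apply]; fun_prop) hsx (lineMap_sub_div_mem_slitPlane hx)
  simpa [chordAngle, div_self hsx] using this

theorem div_mem_slitPlane {x : ℂ} (hx : x ∉ segment ℝ s t) :
    (t - x) / (s - x) ∈ Complex.slitPlane := by
  simpa using lineMap_sub_div_mem_slitPlane hx 1

theorem continuousAt_chordAngle {x : ℂ} (hx : x ∉ segment ℝ s t) :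
    ContinuousAt (chordAngle s t) x := by
  have hsx : s - x ≠ 0 := sub_ne_zero.2 fun h => hx (h ▸ left_mem_segment ℝ s t)
  exact (Complex.continuousAt_arg (div_mem_slitPlane hx)).comp
    (f := fun x => (t - x) / (s - x)) (by fun_prop (disch := assumption))

/-- The side of the chord on which a point of `supportSet` lies, `1` or `-1`. -/
noncomputable def chordSide (s t : ℂ) (a b : ℝ) (x : ℂ) : ℝ :=
  (chordAngle s t x - turnAngle s t a b x) / Real.pi

/-- Multiplying directions shows that chord angle and turning angle differ by an odd multiple of
`π`. The chord angle is less than `π` in absolute value and the two direction angles at most `π`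
each, so the multiple is below `3` in absolute value. -/
theorem exists_chordSide (hst : s ≠ t) (ha : |a| ≤ Real.pi / 2) (hb : |b| ≤ Real.pi / 2) {x : ℂ}
    (hx : x ∈ supportSet s t a b) (hxl : x ∉ segment ℝ s t) :
    ∃ k : ℤ, (k = 1 ∨ k = -1) ∧ chordSide s t a b x = k := by
  have hpi := Real.pi_pos
  have hd : t - s ≠ 0 := sub_ne_zero.2 hst.symm
  have hsx : s - x ≠ 0 := sub_ne_zero.2 fun h => hxl (h ▸ left_mem_segment ℝ s t)
  have htx : t - x ≠ 0 := sub_ne_zero.2 fun h => hxl (h ▸ right_mem_segment ℝ s t)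
  have hxs : x - s ≠ 0 := by rw [← neg_sub]; exact neg_ne_zero.2 hsx
  have h1 := polar_mul (polar_arg ((t - x) / (s - x))) (polar_dirAngle a ((x - s) / (t - s)))
  have h2 := polar_neg_of_odd odd_one (polar_dirAngle b ((t - x) / (t - s)))
  have e : (t - x) / (s - x) * ((x - s) / (t - s)) = -((t - x) / (t - s)) := by
    field_simp
    ring
  rw [e] at h1
  have h3 := exp_sub_eq_one_of_polar (neg_ne_zero.2 (div_ne_zero htx hd)) h1 h2
  have h4 : Complex.exp (((chordAngle s t x - turnAngle s t a b x : ℝ) : ℂ) * Complex.I) = -1 := by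
    have : (chordAngle s t x - turnAngle s t a b x : ℝ)
        = (((t - x) / (s - x)).arg + dirAngle a ((x - s) / (t - s)) -
          (dirAngle b ((t - x) / (t - s)) + (1 : ℤ) * Real.pi)) + ((1 : ℤ) : ℝ) * Real.pi := by
      simp only [chordAngle, turnAngle]; ring
    rw [this, Complex.ofReal_add, add_mul, Complex.exp_add, h3, exp_int_mul_pi_of_odd odd_one,
      one_mul]
  obtain ⟨m, hm, hmx⟩ := exists_odd_of_exp_eq_neg_one h4
  have hside : chordSide s t a b x = m := by
    rw [chordSide, hmx, mul_div_assoc, div_self hpi.ne', mul_one]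
  refine ⟨m, ?_, hside⟩
  have b1 := abs_dirAngle_le ha hx.1
  have b2 := abs_dirAngle_le hb hx.2
  have b3 : |chordAngle s t x| < Real.pi := by
    have h5 := div_mem_slitPlane hxl
    have h6 := Complex.mem_slitPlane_iff_arg.1 h5
    rw [chordAngle, abs_lt]
    exact ⟨Complex.neg_pi_lt_arg _, lt_of_le_of_ne (Complex.arg_le_pi _) h6.1⟩
  have b4 : |(m : ℝ) * Real.pi| < 3 * Real.pi := by
    rw [← hmx, turnAngle]
    rw [abs_lt] at *
    rw [abs_le] at b1 b2
    constructor <;> linarith [b1.1, b1.2, b2.1, b2.2, b3.1, b3.2]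
  rw [abs_mul, abs_of_pos hpi] at b4
  have b5 : |(m : ℝ)| < 3 := lt_of_mul_lt_mul_right b4 hpi.le
  have b6 : |m| < 3 := by exact_mod_cast b5
  rw [abs_lt] at b6
  obtain ⟨k, hk⟩ := hm
  omega

theorem continuousAt_chordSide (hst : s ≠ t) {x : ℂ} (hx : x ∈ supportSet s t a b)
    (hxl : x ∉ segment ℝ s t) : ContinuousAt (chordSide s t a b) x := by
  have hxs : x ≠ s := fun h => hxl (h ▸ left_mem_segment ℝ s t)
  have hxt : x ≠ t := fun h => hxl (h ▸ right_mem_segment ℝ s t)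
  exact ((continuousAt_chordAngle hxl).sub ((continuousAt_dirAngle_target hst hx hxt).sub
    (continuousAt_dirAngle_source hst hx hxs))).div_const _

/-- A continuous function with values `± 1` cannot change sign, since it would take the value `0`.
-/
theorem chordSide_eq_of_isPreconnected (hst : s ≠ t) (ha : |a| ≤ Real.pi / 2)
    (hb : |b| ≤ Real.pi / 2) {C : Set ℂ} (hC : IsPreconnected C)
    (hCK : C ⊆ supportSet s t a b) (hCl : ∀ x ∈ C, x ∉ segment ℝ s t) {x y : ℂ} (hx : x ∈ C)
    (hy : y ∈ C) : chordSide s t a b x = chordSide s t a b y := by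
  have hc : ContinuousOn (chordSide s t a b) C := fun z hz =>
    (continuousAt_chordSide hst (hCK hz) (hCl z hz)).continuousWithinAt
  have key : ∀ x ∈ C, ∀ y ∈ C, ¬ chordSide s t a b x < chordSide s t a b y := by
    intro x hx y hy hlt
    obtain ⟨k, hk, hkx⟩ := exists_chordSide hst ha hb (hCK hx) (hCl x hx)
    obtain ⟨l, hl, hly⟩ := exists_chordSide hst ha hb (hCK hy) (hCl y hy)
    rw [hkx, hly] at hlt
    have hlt' : k < l := by exact_mod_cast hlt
    have hk' : k = -1 := by omega
    have hl' : l = 1 := by omega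
    subst hk' hl'
    obtain ⟨z, hz, hz0⟩ := hC.intermediate_value hx hy hc
      (show (0 : ℝ) ∈ Icc _ _ by rw [hkx, hly]; norm_num)
    obtain ⟨j, hj, hjz⟩ := exists_chordSide hst ha hb (hCK hz) (hCl z hz)
    rw [hz0] at hjz
    have : j = 0 := by exact_mod_cast hjz.symm
    omega
  exact le_antisymm (not_lt.1 (key y hy x hx)) (not_lt.1 (key x hx y hy))

theorem ne_of_meetOnlyAtEnds {α β : Path s t} (h : MeetOnlyAtEnds α β) {u : I}
    (h0 : 0 < (u : ℝ)) (h1 : (u : ℝ) < 1) (v : I) : β v ≠ α u := fun e => by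
  rcases h u v e.symm with h | h <;> linarith [h.1]

/-- From `x` on `α`, the arc `β` sweeps the turning angle plus `m π`, and the chord sweeps the
turning angle plus `chordSide` times `π`. The turning angle cancels. -/
theorem SweepIndex.isBetween_iff {α β : Path s t} {m : ℤ} (h : SweepIndex a b α β m)
    (hαβ : MeetOnlyAtEnds α β) {x : ℂ} (hx : x ∈ range α) (hxl : x ∉ segment ℝ s t) :
    IsBetween β x ↔ (m : ℝ) ≠ chordSide s t a b x := by
  have hpi := Real.pi_pos
  obtain ⟨u, rfl⟩ := hx
  have h0 : 0 < (u : ℝ) := by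
    refine lt_of_le_of_ne u.2.1 fun h => hxl ?_
    rw [show u = 0 from Subtype.ext h.symm, α.source]; exact left_mem_segment ℝ s t
  have h1 : (u : ℝ) < 1 := by
    refine lt_of_le_of_ne u.2.2 fun h => hxl ?_
    rw [show u = 1 from Subtype.ext h, α.target]; exact right_mem_segment ℝ s t
  have hs := h.2.1 u h0 h1
  have hl := sweepsAngle_lineMap hxl
  have key : turnAngle s t a b (α u) + m * Real.pi = chordAngle s t (α u) ↔
      (m : ℝ) = chordSide s t a b (α u) := by
    rw [chordSide, eq_div_iff hpi.ne']
    constructor <;> intro h <;> linarith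
  rw [Ne, ← key]
  constructor
  · rintro ⟨φ, ψ, hφ, hψ, hne⟩ heq
    apply hne
    rw [SweepsAngle.unique (ne_of_meetOnlyAtEnds hαβ h0 h1) hφ hs, SweepsAngle.unique (fun v hv => hxl ?_) hψ hl, heq]
    rw [← hv, segment_eq_image_lineMap]; exact ⟨v, v.2, rfl⟩
  · intro hne
    exact ⟨_, _, hs, hl, hne⟩

theorem MeetOnlyAtEnds.symm {α β : Path s t} (h : MeetOnlyAtEnds α β) : MeetOnlyAtEnds β α :=
  fun u v e => by
    rcases h v u e.symm with h | h
    · exact Or.inl ⟨h.2, h.1⟩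
    · exact Or.inr ⟨h.2, h.1⟩

theorem SweepIndex.isBetween_iff' {α β : Path s t} {m : ℤ} (h : SweepIndex a b α β m)
    (hαβ : MeetOnlyAtEnds α β) {x : ℂ} (hx : x ∈ range β) (hxl : x ∉ segment ℝ s t) :
    IsBetween α x ↔ -(m : ℝ) ≠ chordSide s t a b x := by
  simpa using h.symm.isBetween_iff hαβ.symm hx hxl

end CableNet

/-! ### Extreme points, supporting lines, enclosed area, and half-planes meeting outer arcs. -/

namespace CableNet

variable {s t : ℂ} {a b : ℝ}

/-! ### The index of two disjoint arcs that meet a supporting line -/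

/-- Two paths inside the chord would both pass through its midpoint, by the intermediate value
theorem. -/
theorem MeetOnlyAtEnds.exists_notMem_segment {α β : Path s t} (hst : s ≠ t)
    (h : MeetOnlyAtEnds α β) : ∃ z ∈ range α ∪ range β, z ∉ segment ℝ s t := by
  by_contra hcon
  push Not at hcon
  have hd : t - s ≠ 0 := sub_ne_zero.2 hst.symm
  have mid : ∀ γ : Path s t, (∀ u, γ u ∈ segment ℝ s t) →
      ∃ u, γ u = AffineMap.lineMap s t (1 / 2 : ℝ) := by
    intro γ hγ
    have hc : Continuous fun u => ((γ u - s) / (t - s)).re :=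
      Complex.continuous_re.comp ((γ.continuous.sub continuous_const).div_const _)
    obtain ⟨u, -, hu⟩ := isPreconnected_univ.intermediate_value (mem_univ (0 : I))
      (mem_univ (1 : I)) hc.continuousOn (show (1 / 2 : ℝ) ∈ Icc _ _ by
        simp only [γ.source, γ.target, sub_self, zero_div, div_self hd]; norm_num)
    refine ⟨u, ?_⟩
    have := hγ u
    rw [segment_eq_image_lineMap] at this
    obtain ⟨c, -, hc⟩ := this
    simp only at hu
    rw [← hc] at hu ⊢
    simp only [AffineMap.lineMap_apply, vsub_eq_sub, vadd_eq_add, Complex.real_smul,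
      add_sub_cancel_right, mul_div_assoc, div_self hd, mul_one, Complex.ofReal_re] at hu
    rw [hu]
  obtain ⟨u, hu⟩ := mid α fun u => hcon _ (Or.inl (mem_range_self u))
  obtain ⟨v, hv⟩ := mid β fun u => hcon _ (Or.inr (mem_range_self u))
  have e : ∀ r : ℝ, AffineMap.lineMap s t (1 / 2 : ℝ) = AffineMap.lineMap s t r → r = 1 / 2 :=
    fun r hr => (AffineMap.lineMap_injective ℝ hst hr).symm
  rcases h u v (hu.trans hv.symm) with h' | h'
  · rw [show u = 0 from Subtype.ext h'.1, α.source] at hu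
    have := e 0 (by rw [← hu]; simp)
    norm_num at this
  · rw [show u = 1 from Subtype.ext h'.1, α.target] at hu
    have := e 1 (by rw [← hu]; simp)
    norm_num at this

theorem clm_apply_eq_re_mul (f : ℂ →L[ℝ] ℝ) (z : ℂ) :
    f z = (z * ((f 1 : ℂ) - f Complex.I * Complex.I)).re := by
  have : z = z.re • (1 : ℂ) + z.im • Complex.I := by
    simp [Complex.re_add_im]
  conv_lhs => rw [this, map_add, map_smul, map_smul]
  simp

/-- A point that is strictly farther from `c` than all points of a set in the closed disc is
separated from the set. -/
theorem re_pos_of_norm_le {c x p : ℂ} (hp : ‖p - c‖ ≤ ‖x - c‖) (hne : p ≠ x) :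
    0 < ((p - x) * (starRingEnd ℂ) (c - x)).re := by
  have h1 : 0 < ‖p - x‖ ^ 2 := by
    have := norm_pos_iff.2 (sub_ne_zero.2 hne); positivity
  have h2 : ‖p - c‖ ^ 2 ≤ ‖x - c‖ ^ 2 := by gcongr
  rw [← Complex.normSq_eq_norm_sq, Complex.normSq_apply] at h1
  rw [← Complex.normSq_eq_norm_sq, ← Complex.normSq_eq_norm_sq, Complex.normSq_apply,
    Complex.normSq_apply] at h2
  simp only [Complex.mul_re, Complex.sub_re, Complex.sub_im, Complex.conj_re, Complex.conj_im] at *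
  nlinarith

/-- Let `z` be a point of the arcs off the chord. A disc with a remote center `q` opposite to `z`
approximates a half-plane, so `z` is farther from `q` than `s` and `t`. The point `x` farthest from
`q` is then not an end point, and the tangent to the circle at `x` separates `x` strictly from the
arc that does not contain it. -/
theorem MeetOnlyAtEnds.exists_separated {α β : Path s t} (hst : s ≠ t)
    (h : MeetOnlyAtEnds α β) :
    ∃ x w : ℂ, x ∉ segment ℝ s t ∧ ((x ∈ range α ∧ ∀ v, 0 < ((β v - x) * w).re) ∨
      (x ∈ range β ∧ ∀ v, 0 < ((α v - x) * w).re)) := by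
  obtain ⟨z, hz, hzl⟩ := h.exists_notMem_segment hst
  have hsegc : IsClosed (segment ℝ s t) := by
    rw [segment_eq_image_lineMap]
    exact (isCompact_Icc.image AffineMap.lineMap_continuous).isClosed
  obtain ⟨f, c, hf1, hf2⟩ := geometric_hahn_banach_closed_point (convex_segment s t)
    hsegc hzl
  set W : ℂ := (f 1 : ℂ) - f Complex.I * Complex.I with hW
  have hfs : f s < f z := (hf1 s (left_mem_segment ℝ s t)).trans hf2
  have hft : f t < f z := (hf1 t (right_mem_segment ℝ s t)).trans hf2
  obtain ⟨M, hM1, hM2⟩ : ∃ M : ℝ, ‖s‖ ^ 2 - ‖z‖ ^ 2 < 2 * M * (f z - f s) ∧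
      ‖t‖ ^ 2 - ‖z‖ ^ 2 < 2 * M * (f z - f t) := by
    have l1 : Tendsto (fun M : ℝ => 2 * M * (f z - f s)) atTop atTop :=
      ((tendsto_id.const_mul_atTop two_pos)).atTop_mul_const (sub_pos.2 hfs)
    have l2 : Tendsto (fun M : ℝ => 2 * M * (f z - f t)) atTop atTop :=
      ((tendsto_id.const_mul_atTop two_pos)).atTop_mul_const (sub_pos.2 hft)
    exact ((l1.eventually_gt_atTop _).and (l2.eventually_gt_atTop _)).exists
  -- With this center, `‖y - q‖²` is `‖y‖² + 2 M f y` up to a constant, so for large `M` the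
  -- separating functional `f` decides which point is farther.
  set q : ℂ := -(M : ℂ) * (starRingEnd ℂ) W with hq
  have hQ : ∀ y : ℂ, ‖y - q‖ ^ 2 = ‖y‖ ^ 2 + 2 * M * f y + ‖q‖ ^ 2 := by
    intro y
    rw [clm_apply_eq_re_mul, ← hW]
    simp only [← Complex.normSq_eq_norm_sq, Complex.normSq_apply, hq]
    simp
    ring
  have hcomp : IsCompact (range α ∪ range β) :=
    (isCompact_range α.continuous).union (isCompact_range β.continuous)
  obtain ⟨x, hx, hmax⟩ := hcomp.exists_isMaxOn ⟨z, hz⟩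
    (f := fun y => ‖y - q‖) (by fun_prop)
  have hsx : s ≠ x := by
    rintro rfl
    have h1 : ‖z - q‖ ≤ ‖s - q‖ := hmax hz
    have h2 : ‖z - q‖ ^ 2 ≤ ‖s - q‖ ^ 2 := by gcongr
    rw [hQ, hQ] at h2
    linarith
  have htx : t ≠ x := by
    rintro rfl
    have h1 : ‖z - q‖ ≤ ‖t - q‖ := hmax hz
    have h2 : ‖z - q‖ ^ 2 ≤ ‖t - q‖ ^ 2 := by gcongr
    rw [hQ, hQ] at h2
    linarith
  refine ⟨x, (starRingEnd ℂ) (q - x), fun hxl => ?_, ?_⟩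
  · have hs' := re_pos_of_norm_le (hmax (Or.inl ⟨0, α.source⟩)) hsx
    have ht' := re_pos_of_norm_le (hmax (Or.inl ⟨1, α.target⟩)) htx
    have hconv : Convex ℝ {p : ℂ | 0 < ((p - x) * (starRingEnd ℂ) (q - x)).re} := by
      intro p hp p' hp' k l hk hl hkl
      simp only [mem_ofPred_eq] at *
      have e : (k • p + l • p' - x) * (starRingEnd ℂ) (q - x)
          = (k : ℂ) * ((p - x) * (starRingEnd ℂ) (q - x))
            + (l : ℂ) * ((p' - x) * (starRingEnd ℂ) (q - x)) := by
        have : (k : ℂ) + l = 1 := by exact_mod_cast hkl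
        simp only [Complex.real_smul]
        linear_combination (-x * (starRingEnd ℂ) (q - x)) * (-this)
      rw [e, Complex.add_re, Complex.re_ofReal_mul, Complex.re_ofReal_mul]
      rcases hk.eq_or_lt with hk0 | hk0
      · have : l = 1 := by linarith
        rw [← hk0, this]; simpa using hp'
      · have := mul_pos hk0 hp
        have := mul_nonneg hl hp'.le
        linarith
    have := hconv.segment_subset hs' ht' hxl
    simp at this
  · rcases hx with hx | hx
    · refine Or.inl ⟨hx, fun v => re_pos_of_norm_le (hmax (Or.inr ⟨v, rfl⟩)) fun e => ?_⟩
      obtain ⟨u, rfl⟩ := hx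
      rcases h u v e.symm with h' | h'
      · rw [show u = 0 from Subtype.ext h'.1, α.source] at hsx; exact hsx rfl
      · rw [show u = 1 from Subtype.ext h'.1, α.target] at htx; exact htx rfl
    · refine Or.inr ⟨hx, fun v => re_pos_of_norm_le (hmax (Or.inl ⟨v, rfl⟩)) fun e => ?_⟩
      obtain ⟨u, rfl⟩ := hx
      rcases h v u e with h' | h'
      · rw [show u = 0 from Subtype.ext h'.2, β.source] at hsx; exact hsx rfl
      · rw [show u = 1 from Subtype.ext h'.2, β.target] at htx; exact htx rfl

/-- A separated point is not between the other arc and the chord, so there `m` or `-m` equals the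
side of the chord. -/
theorem SweepIndex.eq_one_or {α β : Path s t} {m : ℤ} (hst : s ≠ t) (ha : |a| ≤ Real.pi / 2)
    (hb : |b| ≤ Real.pi / 2) (hα : range α ⊆ supportSet s t a b)
    (hβ : range β ⊆ supportSet s t a b) (hαβ : MeetOnlyAtEnds α β)
    (hm : SweepIndex a b α β m) : m = 1 ∨ m = -1 := by
  obtain ⟨x, w, hxl, h | h⟩ := hαβ.exists_separated hst
  · have h1 := mt (hm.isBetween_iff hαβ h.1 hxl).2 (not_isBetween_of_separated h.2)
    obtain ⟨k, hk, hkx⟩ := exists_chordSide hst ha hb (hα h.1) hxl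
    rw [not_not, hkx] at h1
    have : m = k := by exact_mod_cast h1
    omega
  · have h1 := mt (hm.isBetween_iff' hαβ h.1 hxl).2 (not_isBetween_of_separated h.2)
    obtain ⟨k, hk, hkx⟩ := exists_chordSide hst ha hb (hβ h.1) hxl
    rw [not_not, hkx] at h1
    have : -m = k := by exact_mod_cast h1
    omega

/-! ### Supporting lines -/

theorem exists_const_of_interior_eq_empty {K : Set ℂ} (hK : Convex ℝ K) (hne : K.Nonempty)
    (hi : interior K = ∅) :
    ∃ f : ℂ →L[ℝ] ℝ, f ≠ 0 ∧ ∀ z ∈ K, ∀ p ∈ closure K, f p = f z := by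
  have hspan : affineSpan ℝ K ≠ ⊤ := by
    intro h
    rw [← hK.interior_nonempty_iff_affineSpan_eq_top, hi] at h
    exact not_nonempty_empty h
  have hdir : (affineSpan ℝ K).direction < ⊤ := by
    rw [lt_top_iff_ne_top]
    intro h
    exact hspan ((AffineSubspace.direction_eq_top_iff_of_nonempty
      ((affineSpan_nonempty ℝ).2 hne)).1 h)
  obtain ⟨f, hf0, hf⟩ := Submodule.exists_le_ker_of_lt_top _ hdir
  refine ⟨LinearMap.toContinuousLinearMap f, by simpa using hf0, fun z hz p hp => ?_⟩
  have hp' : p ∈ affineSpan ℝ K :=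
    closure_minimal (subset_affineSpan ℝ K) (AffineSubspace.closed_of_finiteDimensional _) hp
  have h1 := hf (AffineSubspace.vsub_mem_direction (subset_affineSpan ℝ K hz) hp')
  rw [LinearMap.mem_ker, vsub_eq_sub, map_sub] at h1
  simp only [LinearMap.coe_toContinuousLinearMap']
  linarith

theorem re_mul_ne_zero {f : ℂ →L[ℝ] ℝ} (hf : f ≠ 0) : (f 1 : ℂ) - f Complex.I * Complex.I ≠ 0 := by
  intro h
  apply hf
  ext
  rw [clm_apply_eq_re_mul, h]
  simp

/-- Hahn–Banach applies if `K` has interior. A flat `K` lies on a line, and that line is itself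
supporting. -/
theorem exists_supporting_of_mem_frontier {K : Set ℂ} (hK : Convex ℝ K) {p : ℂ}
    (hp : p ∈ frontier K) : ∃ w : ℂ, w ≠ 0 ∧ ∀ z ∈ K, 0 ≤ ((z - p) * w).re := by
  rsuffices ⟨f, hf0, hf⟩ : ∃ f : ℂ →L[ℝ] ℝ, f ≠ 0 ∧ ∀ z ∈ K, f p ≤ f z
  · refine ⟨(f 1 : ℂ) - f Complex.I * Complex.I, re_mul_ne_zero hf0, fun z hz => ?_⟩
    rw [← clm_apply_eq_re_mul, map_sub]
    linarith [hf z hz]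
  rcases (interior K).eq_empty_or_nonempty with hi | hi
  · have hne : K.Nonempty := closure_nonempty_iff.1 ⟨p, hp.1⟩
    obtain ⟨f, hf0, hf⟩ := exists_const_of_interior_eq_empty hK hne hi
    exact ⟨f, hf0, fun z hz => (hf z hz p hp.1).le⟩
  · obtain ⟨f, hf⟩ := geometric_hahn_banach_open_point hK.interior isOpen_interior hp.2
    have hle : ∀ z ∈ K, f z ≤ f p := by
      intro z hz
      have hz' : z ∈ closure (interior K) := by
        rw [hK.closure_interior_eq_closure_of_nonempty_interior hi]
        exact subset_closure hz
      exact closure_minimal (fun y hy => (hf y hy).le)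
        (isClosed_le f.continuous continuous_const) hz'
    refine ⟨-f, fun h => ?_, fun z hz => by simpa using hle z hz⟩
    obtain ⟨y, hy⟩ := hi
    have := hf y hy
    rw [neg_eq_zero.1 h] at this
    simp at this

theorem exists_subset_supportSet {K : Set ℂ} (hK : Convex ℝ K) (hst : s ≠ t) (hsK : s ∈ K)
    (htK : t ∈ K) (hs : s ∈ frontier K) (ht : t ∈ frontier K) :
    ∃ a b : ℝ, |a| ≤ Real.pi / 2 ∧ |b| ≤ Real.pi / 2 ∧ K ⊆ supportSet s t a b := by
  have hd : t - s ≠ 0 := sub_ne_zero.2 hst.symm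
  have key : ∀ w : ℂ, w ≠ 0 → 0 ≤ ((t - s) * w).re → ∃ a : ℝ, |a| ≤ Real.pi / 2 ∧
      ∀ y : ℂ, 0 ≤ (y * w).re → 0 ≤ (y / (t - s) * Complex.exp (-(a : ℂ) * Complex.I)).re := by
    intro w hw h
    -- This is the angle of the inner normal relative to the chord. It is at most `π / 2` because
    -- the half-plane contains the other end of the chord.
    refine ⟨-((t - s) * w).arg, by rw [abs_neg]; exact Complex.abs_arg_le_pi_div_two_iff.2 h,
      fun y hy => ?_⟩
    have h1 := polar_arg ((t - s) * w)
    have hn : (‖(t - s) * w‖ : ℂ) ≠ 0 := by simpa using ⟨hd, hw⟩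
    have h2 : y / (t - s) * Complex.exp (-((-((t - s) * w).arg : ℝ) : ℂ) * Complex.I)
        = ((‖(t - s) * w‖⁻¹ : ℝ) : ℂ) * (y * w) := by
      have h3 : Complex.exp (-((-((t - s) * w).arg : ℝ) : ℂ) * Complex.I)
          = (t - s) * w / ‖(t - s) * w‖ := by
        rw [eq_div_iff hn, mul_comm]
        conv_rhs => rw [h1]
        push_cast; rw [neg_neg]
      rw [h3]; push_cast
      generalize (‖(t - s) * w‖ : ℂ) = n at hn
      field_simp
    rw [h2, Complex.re_ofReal_mul]
    positivity
  obtain ⟨w1, hw1, h1⟩ := exists_supporting_of_mem_frontier hK hs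
  obtain ⟨w2, hw2, h2⟩ := exists_supporting_of_mem_frontier hK ht
  have h2' : ∀ z ∈ K, 0 ≤ ((t - z) * -w2).re := fun z hz => by
    rw [mul_neg, ← neg_mul, neg_sub]; exact h2 z hz
  obtain ⟨a, ha, ha'⟩ := key w1 hw1 (h1 t htK)
  obtain ⟨b, hb, hb'⟩ := key (-w2) (neg_ne_zero.2 hw2) (h2' s hsK)
  exact ⟨a, b, ha, hb, fun z hz => ⟨ha' _ (h1 z hz), hb' _ (h2' z hz)⟩⟩

theorem convex_re_mul_ge (w : ℂ) (c : ℝ) : Convex ℝ {z : ℂ | c ≤ (z * w).re} :=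
  convex_halfSpace_ge (f := fun z : ℂ => (z * w).re)
    ⟨fun x y => by simp [add_mul], fun r x => by simp; ring⟩ c

theorem convex_re_mul_le (w : ℂ) (c : ℝ) : Convex ℝ {z : ℂ | (z * w).re ≤ c} :=
  convex_halfSpace_le (f := fun z : ℂ => (z * w).re)
    ⟨fun x y => by simp [add_mul], fun r x => by simp; ring⟩ c

theorem convex_re_mul_lt (w : ℂ) (c : ℝ) : Convex ℝ {z : ℂ | (z * w).re < c} :=
  convex_halfSpace_lt (f := fun z : ℂ => (z * w).re)
    ⟨fun x y => by simp [add_mul], fun r x => by simp; ring⟩ c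

theorem convex_re_mul_gt (w : ℂ) (c : ℝ) : Convex ℝ {z : ℂ | c < (z * w).re} :=
  convex_halfSpace_gt (f := fun z : ℂ => (z * w).re)
    ⟨fun x y => by simp [add_mul], fun r x => by simp; ring⟩ c

theorem supportSet_eq : supportSet s t a b =
    {z | (s * (Complex.exp (-(a : ℂ) * Complex.I) / (t - s))).re
      ≤ (z * (Complex.exp (-(a : ℂ) * Complex.I) / (t - s))).re} ∩
    {z | (t * -(Complex.exp (-(b : ℂ) * Complex.I) / (t - s))).re
      ≤ (z * -(Complex.exp (-(b : ℂ) * Complex.I) / (t - s))).re} := by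
  ext z
  refine and_congr ?_ ?_ <;> rw [mem_ofPred_eq, ← sub_nonneg (b := Complex.re _),
    ← Complex.sub_re, ← sub_mul, ← sub_nonneg]
  · rw [sub_zero, div_mul_eq_mul_div, mul_div_assoc]
  · rw [sub_zero, div_mul_eq_mul_div, mul_div_assoc, mul_neg, ← neg_mul, neg_sub]

theorem convex_supportSet : Convex ℝ (supportSet s t a b) := by
  rw [supportSet_eq]
  exact (convex_re_mul_ge _ _).inter (convex_re_mul_ge _ _)

/-! ### Bounded complementary components -/

/-- Around a frontier point outside `J`, the open component of that point would meet the component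
of `z` and so coincide with it, but an open set contains none of its frontier points. -/
theorem frontier_connectedComponentIn_compl_subset {J : Set ℂ} (hJ : IsClosed J) (z : ℂ) :
    frontier (connectedComponentIn Jᶜ z) ⊆ J := by
  intro x hx
  by_contra hxJ
  have ho : IsOpen (connectedComponentIn Jᶜ z) := hJ.isOpen_compl.connectedComponentIn
  rw [ho.frontier_eq] at hx
  have hxo : IsOpen (connectedComponentIn Jᶜ x) := hJ.isOpen_compl.connectedComponentIn
  obtain ⟨y, hy1, hy2⟩ := mem_closure_iff.1 hx.1 _ hxo (mem_connectedComponentIn hxJ)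
  have h1 := connectedComponentIn_eq hy1
  have h2 := connectedComponentIn_eq hy2
  apply hx.2
  rw [h2, ← h1]
  exact mem_connectedComponentIn hxJ

/-- If a continuous angle of `x - z` exists along a compact set `J`, then the component of `z` in the
complement of `J` is unbounded. -/
theorem not_isBounded_connectedComponentIn_of_angle {J : Set ℂ} (hJ : IsClosed J) {z : ℂ}
    (hz : z ∉ J) {G : ℂ → ℝ} (hG : ContinuousOn G J)
    (hGz : ∀ x ∈ J, x - z = (‖x - z‖ : ℂ) * Complex.exp ((G x : ℂ) * Complex.I)) :
    ¬ Bornology.IsBounded (connectedComponentIn Jᶜ z) := by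
  classical
  intro hbd
  set B := connectedComponentIn Jᶜ z with hB
  have hzB : z ∈ B := mem_connectedComponentIn hz
  have ho : IsOpen B := hJ.isOpen_compl.connectedComponentIn
  obtain ⟨G', hG'⟩ := ContinuousMap.exists_restrict_eq hJ
    (⟨J.domRestrict G, continuousOn_iff_continuous_domRestrict.1 hG⟩ : C(J, ℝ))
  have hG'G : ∀ x ∈ J, G' x = G x := fun x hx => congr_fun (congr_arg DFunLike.coe hG') ⟨x, hx⟩
  -- The direction map `(x - z) / ‖x - z‖` is refilled inside `B` by the extended angle; the two
  -- agree on the frontier, which lies in `J`. The result is continuous and nonzero on the whole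
  -- plane, so it has a logarithm, although it winds once along a circle around `B`.
  set F : ℂ → ℂ := B.piecewise (fun x => Complex.exp ((G' x : ℂ) * Complex.I))
    (fun x => (x - z) / ‖x - z‖) with hF
  have hFc : Continuous F := by
    refine continuous_piecewise (fun x hx => ?_) ?_ ?_
    · have hxJ := frontier_connectedComponentIn_compl_subset hJ z hx
      have hxz : (‖x - z‖ : ℂ) ≠ 0 := by
        simpa [sub_eq_zero] using fun h : x = z => hz (h ▸ hxJ)
      rw [hG'G x hxJ, eq_div_iff hxz, mul_comm]
      exact (hGz x hxJ).symm
    · apply Continuous.continuousOn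
      fun_prop
    · rw [ho.isClosed_compl.closure_eq]
      refine ContinuousOn.div (by fun_prop) (by fun_prop) fun x hx => ?_
      simpa [sub_eq_zero] using fun h : x = z => hx (h ▸ hzB)
  have hF0 : ∀ x ∈ (univ : Set ℂ), F x ≠ 0 := by
    intro x _
    by_cases hx : x ∈ B
    · rw [hF, piecewise_eq_of_mem _ _ _ hx]; exact Complex.exp_ne_zero _
    · have : x - z ≠ 0 := sub_ne_zero.2 fun h : x = z => hx (h ▸ hzB)
      rw [hF, piecewise_eq_of_notMem _ _ _ hx]
      simpa using this
  obtain ⟨g, hg, hgF⟩ := exists_continuousOn_log_of_convex convex_univ hFc.continuousOn hF0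
  obtain ⟨R, hR⟩ := hbd.subset_ball z
  have hR0 : 0 < R := by
    simpa using hR hzB
  let c : ℝ → ℂ := fun τ => z + R * Complex.exp ((τ : ℂ) * Complex.I)
  have hcF : ∀ τ, F (c τ) = Complex.exp ((τ : ℂ) * Complex.I) := by
    intro τ
    have hn : ‖c τ - z‖ = R := by
      simp [c, Complex.norm_exp_ofReal_mul_I, abs_of_pos hR0]
    have hnB : c τ ∉ B := fun h => by
      have := hR h
      rw [Metric.mem_ball, dist_eq_norm, hn] at this
      exact lt_irrefl _ this
    rw [hF, piecewise_eq_of_notMem _ _ _ hnB, hn]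
    simp only [c, add_sub_cancel_left]
    rw [mul_div_cancel_left₀]
    exact_mod_cast hR0.ne'
  have hcc : Continuous c := by fun_prop
  have hgc : Continuous g := continuousOn_univ.1 hg
  have := eq_of_exp_eq_one_of_isPreconnected (S := (univ : Set ℝ)) isPreconnected_univ
    (g := fun τ => (g (c τ)).im - τ)
    ((Complex.continuous_im.comp (hgc.comp hcc)).sub continuous_id).continuousOn
    (fun τ _ => by
      have h := polar_exp (g (c τ))
      rw [hgF _ (mem_univ _), hcF, Complex.norm_exp_ofReal_mul_I, Complex.ofReal_one, one_mul] at h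
      push_cast
      rw [sub_mul, Complex.exp_sub, ← h, div_self (Complex.exp_ne_zero _)])
    (mem_univ 0) (mem_univ (2 * Real.pi))
  have hper : c (2 * Real.pi) = c 0 := by
    simp [c]
  simp only [hper] at this
  linarith [Real.pi_pos]

/-- The open half-plane around `z` is connected, misses `J` and is unbounded. -/
theorem notMem_enclosedArea_of_separated {J : Set ℂ} {z w : ℂ} {c : ℝ} (hw : w ≠ 0)
    (hJ : ∀ x ∈ J, c ≤ (x * w).re) (hz : (z * w).re < c) : z ∉ enclosedArea J := by
  have hzJ : z ∉ J := fun h => (hJ z h).not_gt hz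
  rintro (h | ⟨-, hbd⟩)
  · exact hzJ h
  have hsub : {x : ℂ | (x * w).re < c} ⊆ connectedComponentIn Jᶜ z :=
    (convex_re_mul_lt w c).isPreconnected.subset_connectedComponentIn hz
      fun x hx hxJ => (hJ x hxJ).not_gt hx
  obtain ⟨R, hR⟩ := (hbd.subset hsub).subset_ball z
  have hR0 : 0 < R := by simpa using hR hz
  have hw' : 0 < ‖w‖ := norm_pos_iff.2 hw
  have hmem : z - ((R / ‖w‖ : ℝ) : ℂ) * (starRingEnd ℂ) w ∈ {x : ℂ | (x * w).re < c} := by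
    have e : (z - ((R / ‖w‖ : ℝ) : ℂ) * (starRingEnd ℂ) w) * w
        = z * w - ((R / ‖w‖ * ‖w‖ ^ 2 : ℝ) : ℂ) := by
      rw [sub_mul, mul_assoc, mul_comm ((starRingEnd ℂ) w), Complex.mul_conj,
        Complex.normSq_eq_norm_sq]
      push_cast; ring
    rw [mem_ofPred_eq, e, Complex.sub_re, Complex.ofReal_re]
    have : 0 < R / ‖w‖ * ‖w‖ ^ 2 := by positivity
    linarith
  have := hR hmem
  rw [Metric.mem_ball, dist_eq_norm, sub_sub_cancel_left, norm_neg, norm_mul, Complex.norm_real,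
    RCLike.norm_conj, Real.norm_of_nonneg (by positivity), div_mul_cancel₀ _ hw'.ne'] at this
  exact lt_irrefl _ this

theorem enclosedArea_subset_supportSet (hst : s ≠ t) {J : Set ℂ} (hJ : J ⊆ supportSet s t a b) :
    enclosedArea J ⊆ supportSet s t a b := by
  have hd : t - s ≠ 0 := sub_ne_zero.2 hst.symm
  intro z hz
  rw [supportSet_eq] at *
  constructor
  · by_contra h
    exact notMem_enclosedArea_of_separated (div_ne_zero (Complex.exp_ne_zero _) hd)
      (fun x hx => (hJ hx).1) (not_le.1 h) hz
  · by_contra h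
    exact notMem_enclosedArea_of_separated (neg_ne_zero.2 (div_ne_zero (Complex.exp_ne_zero _) hd))
      (fun x hx => (hJ hx).2) (not_le.1 h) hz

/-- A point from which two disjoint arcs with common end points sweep the same angle is not enclosed
by them. -/
theorem not_isBounded_of_sweepsAngle {α β : Path s t} (hαi : Function.Injective α)
    (hβi : Function.Injective β) (hαβ : MeetOnlyAtEnds α β) {z : ℂ} {φ : ℝ}
    (hz : z ∉ range α ∪ range β) (hα : SweepsAngle α z φ) (hβ : SweepsAngle β z φ) :
    ¬ Bornology.IsBounded (connectedComponentIn (range α ∪ range β)ᶜ z) := by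
  classical
  obtain ⟨A, hA, hAz, hA1⟩ := hα
  obtain ⟨B, hB, hBz, hB1⟩ := hβ
  have hzs : s - z ≠ 0 := sub_ne_zero.2 fun h => hz (Or.inl ⟨0, by rw [α.source, h]⟩)
  -- Shifting `B` by this multiple of `2π` makes the two angles agree at `s`; since the swept angles
  -- are equal, they also agree at `t` and glue to one angle on both arcs.
  have hAB : Complex.exp (((A 0 - B 0 : ℝ) : ℂ) * Complex.I) = 1 := by
    have h1 := hAz 0
    have h2 := hBz 0
    rw [α.source] at h1
    rw [β.source] at h2
    exact exp_sub_eq_one_of_polar hzs h1 h2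
  have cα := α.continuous.isClosedEmbedding hαi
  have cβ := β.continuous.isClosedEmbedding hβi
  obtain ⟨F, hF⟩ := ContinuousMap.exists_extension' cα ⟨A, hA⟩
  obtain ⟨G, hG⟩ := ContinuousMap.exists_extension' cβ
    ⟨fun u => B u + (A 0 - B 0), hB.add continuous_const⟩
  have hF' : ∀ u, F (α u) = A u := fun u => congr_fun hF u
  have hG' : ∀ u, G (β u) = B u + (A 0 - B 0) := fun u => congr_fun hG u
  have hGH : ∀ u, (range α).piecewise F G (β u) = B u + (A 0 - B 0) := by
    intro u
    by_cases hu : β u ∈ range α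
    · rw [piecewise_eq_of_mem _ _ _ hu]
      obtain ⟨v, hv⟩ := hu
      rw [← hv, hF']
      rcases hαβ v u hv with h | h
      · rw [show v = 0 from Subtype.ext h.1, show u = 0 from Subtype.ext h.2]; ring
      · rw [show v = 1 from Subtype.ext h.1, show u = 1 from Subtype.ext h.2]; linarith
    · rw [piecewise_eq_of_notMem _ _ _ hu, hG']
  have clα : IsClosed (range α) := cα.isClosed_range
  have clβ : IsClosed (range β) := cβ.isClosed_range
  refine not_isBounded_connectedComponentIn_of_angle (clα.union clβ) hz
    (G := (range α).piecewise F G) (ContinuousOn.union_of_isClosed ?_ ?_ clα clβ) ?_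
  · exact F.continuous.continuousOn.congr fun x hx => piecewise_eq_of_mem _ _ _ hx
  · refine G.continuous.continuousOn.congr ?_
    rintro _ ⟨u, rfl⟩
    rw [hGH, hG']
  · rintro x (⟨u, rfl⟩ | ⟨u, rfl⟩)
    · rw [piecewise_eq_of_mem _ _ _ (mem_range_self u), hF']
      exact hAz u
    · rw [hGH]
      have := polar_mul (hBz u) (w := 1) (β := A 0 - B 0) (by rw [hAB]; simp)
      simpa only [mul_one] using this

/-! ### Half-planes and outer arcs -/

/-- If two arcs both meet a half-plane that does not contain their end points, then the half-plane
meets each path in the area that they enclose. -/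
theorem exists_mem_halfPlane_of_enclosed (hst : s ≠ t) (ha : |a| ≤ Real.pi / 2)
    (hb : |b| ≤ Real.pi / 2) {α β ρ : Path s t} (hαi : Function.Injective α)
    (hβi : Function.Injective β) (hα : range α ⊆ supportSet s t a b)
    (hβ : range β ⊆ supportSet s t a b) (hαβ : MeetOnlyAtEnds α β)
    (hρα : MeetOnlyAtEnds ρ α) (hρβ : MeetOnlyAtEnds ρ β)
    (hρ : range ρ ⊆ enclosedArea (range α ∪ range β)) {w : ℂ} {c : ℝ}
    (h1 : ∃ u, c ≤ (α u * w).re) (h2 : ∃ u, c ≤ (β u * w).re) : ∃ u, c ≤ (ρ u * w).re := by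
  by_contra hcon
  push Not at hcon
  obtain ⟨u, hu⟩ := h1
  obtain ⟨v, hv⟩ := h2
  have hρK : range ρ ⊆ supportSet s t a b :=
    hρ.trans (enclosedArea_subset_supportSet hst (union_subset hα hβ))
  obtain ⟨m, hm⟩ := exists_sweepIndex hst ha hb hρK hα hρα
  obtain ⟨n, hn⟩ := exists_sweepIndex hst ha hb hρK hβ hρβ
  have hs : (s * w).re < c := by simpa using hcon 0
  have ht : (t * w).re < c := by simpa using hcon 1
  have hl : ∀ x : ℂ, c ≤ (x * w).re → x ∉ segment ℝ s t := fun x hx hxl =>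
    (not_lt.2 hx) ((convex_re_mul_lt w c).segment_subset hs ht hxl)
  have nb : ∀ x : ℂ, c ≤ (x * w).re → ¬ IsBetween ρ x := fun x hx =>
    not_isBetween_of_separated (w := -w) fun u => by
      rw [mul_neg, Complex.neg_re, sub_mul, Complex.sub_re]
      linarith [hcon u]
  -- The points of `α` and `β` in the half-plane are separated from `ρ`, so `-m` and `-n` equal
  -- their chord sides. The two sides coincide because the half-plane misses the chord.
  have e1 := mt (hm.isBetween_iff' hρα (mem_range_self u) (hl _ hu)).2 (nb _ hu)
  have e2 := mt (hn.isBetween_iff' hρβ (mem_range_self v) (hl _ hv)).2 (nb _ hv)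
  have e3 := chordSide_eq_of_isPreconnected hst ha hb
    ((convex_supportSet (s := s) (t := t) (a := a) (b := b)).inter
      (convex_re_mul_ge w c)).isPreconnected inter_subset_left (fun x hx => hl x hx.2)
    ⟨hα (mem_range_self u), hu⟩ ⟨hβ (mem_range_self v), hv⟩
  rw [not_not] at e1 e2
  have hmn : m = n := by
    have : (m : ℝ) = n := by linarith
    exact_mod_cast this
  subst hmn
  -- Any inner parameter would do: from `ρ h`, both `α` and `β` sweep the turning angle plus `m π`.
  let h : I := ⟨1 / 2, by norm_num, by norm_num⟩
  have h0 : 0 < (h : ℝ) := by norm_num [h]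
  have h1 : (h : ℝ) < 1 := by norm_num [h]
  have hz : ρ h ∉ range α ∪ range β := by
    rintro (⟨v, hv⟩ | ⟨v, hv⟩)
    · exact ne_of_meetOnlyAtEnds hρα h0 h1 v hv
    · exact ne_of_meetOnlyAtEnds hρβ h0 h1 v hv
  have hub := not_isBounded_of_sweepsAngle hαi hβi hαβ hz (hm.2.1 h h0 h1) (hn.2.1 h h0 h1)
  rcases hρ (mem_range_self h) with h' | h'
  · exact hz h'
  · exact hub h'.2

theorem exists_le_of_mem_innerPart {α β : Path s t} {x : ℂ} (hx : x ∈ innerPart α β) (w : ℂ) :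
    ∃ v, (x * w).re ≤ (β v * w).re := by
  by_contra hcon
  push Not at hcon
  refine not_isBetween_of_separated (w := -w) (fun u => ?_) hx.2.2
  rw [mul_neg, Complex.neg_re, sub_mul, Complex.sub_re]
  linarith [hcon u]

/-- Beyond the chord in a given direction, one of two outer arcs has no inner points, and the other
one only inner points. -/
theorem innerPart_dichotomy (hst : s ≠ t) (ha : |a| ≤ Real.pi / 2)
    (hb : |b| ≤ Real.pi / 2) {α β : Path s t} (hα : range α ⊆ supportSet s t a b)
    (hβ : range β ⊆ supportSet s t a b) (hαβ : MeetOnlyAtEnds α β) (w : ℂ) :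
    ((∀ x ∈ innerPart α β, (x * w).re ≤ max (s * w).re (t * w).re) ∧
      ∀ y ∈ range β, max (s * w).re (t * w).re < (y * w).re → y ∈ innerPart β α) ∨
    ((∀ x ∈ innerPart β α, (x * w).re ≤ max (s * w).re (t * w).re) ∧
      ∀ y ∈ range α, max (s * w).re (t * w).re < (y * w).re → y ∈ innerPart α β) := by
  set c := max (s * w).re (t * w).re with hc
  obtain ⟨m, hm⟩ := exists_sweepIndex hst ha hb hα hβ hαβ
  have hm1 := hm.eq_one_or hst ha hb hα hβ hαβ
  have hl : ∀ x : ℂ, c < (x * w).re → x ∉ segment ℝ s t := fun x hx hxl =>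
    hx.not_ge ((convex_re_mul_le w c).segment_subset (le_max_left (s * w).re (t * w).re)
      (le_max_right (s * w).re (t * w).re) hxl)
  by_cases hne : ∃ z ∈ supportSet s t a b, c < (z * w).re
  swap
  · push Not at hne
    exact Or.inl ⟨fun x hx => hne x (hα hx.1), fun y hy h => absurd (hne y (hβ hy)) (not_le.2 h)⟩
  -- Beyond the chord, the part of the convex set `supportSet` is connected and misses the chord, so
  -- one side `k` applies to all its points. Then `k = m` leaves `α` without inner points there, and
  -- `k = -m` does so for `β`.
  obtain ⟨z, hz, hzc⟩ := hne
  obtain ⟨k, hk, hkz⟩ := exists_chordSide hst ha hb hz (hl z hzc)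
  have hside : ∀ x ∈ supportSet s t a b, c < (x * w).re → chordSide s t a b x = k := by
    intro x hx hxc
    rw [← hkz]
    exact chordSide_eq_of_isPreconnected hst ha hb
      (convex_supportSet.inter (convex_re_mul_gt w c)).isPreconnected inter_subset_left
      (fun x hx => hl x hx.2) ⟨hx, hxc⟩ ⟨hz, hzc⟩
  by_cases hkm : k = m
  · refine Or.inl ⟨fun x hx => ?_, fun y hy h => ⟨hy, hl y h, ?_⟩⟩
    · by_contra h
      rw [not_le] at h
      have := (hm.isBetween_iff hαβ hx.1 hx.2.1).1 hx.2.2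
      rw [hside x (hα hx.1) h, hkm] at this
      exact this rfl
    · rw [hm.isBetween_iff' hαβ hy (hl y h), hside y (hβ hy) h]
      intro e
      have : -m = k := by exact_mod_cast e
      omega
  · refine Or.inr ⟨fun x hx => ?_, fun y hy h => ⟨hy, hl y h, ?_⟩⟩
    · by_contra h
      rw [not_le] at h
      have := (hm.isBetween_iff' hαβ hx.1 hx.2.1).1 hx.2.2
      rw [hside x (hβ hx.1) h] at this
      apply this
      have : -m = k := by omega
      exact_mod_cast this
    · rw [hm.isBetween_iff hαβ hy (hl y h), hside y (hα hy) h]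
      intro e
      exact hkm (by exact_mod_cast e.symm)

end CableNet

/-! ### Support functions, and lengths of curves through their projections. -/

namespace CableNet

/-! ### Support functions -/

/-- The signed length of the projection of `z` to the direction `θ`. -/
noncomputable def proj (θ : ℝ) (z : ℂ) : ℝ := z.re * Real.cos θ + z.im * Real.sin θ

/-- The support function of a plane set. -/
noncomputable def supportFn (C : Set ℂ) (θ : ℝ) : ℝ := sSup (proj θ '' C)

theorem proj_eq_re_mul (θ : ℝ) (z : ℂ) :
    proj θ z = (z * Complex.exp (-(θ : ℂ) * Complex.I)).re := by
  have : Complex.exp (-(θ : ℂ) * Complex.I) = Real.cos θ - Real.sin θ * Complex.I := by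
    rw [Complex.exp_mul_I]; simp; ring
  rw [this]
  simp [proj, Complex.cos_ofReal_re, Complex.sin_ofReal_re]

theorem proj_add (θ : ℝ) (z w : ℂ) : proj θ (z + w) = proj θ z + proj θ w := by
  simp [proj]; ring

theorem proj_sub (θ : ℝ) (z w : ℂ) : proj θ (z - w) = proj θ z - proj θ w := by
  simp [proj]; ring

theorem proj_real_mul (θ r : ℝ) (z : ℂ) : proj θ ((r : ℂ) * z) = r * proj θ z := by
  simp [proj]; ring

theorem proj_exp (θ τ : ℝ) : proj θ (Complex.exp ((τ : ℂ) * Complex.I)) = Real.cos (τ - θ) := by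
  rw [proj, Complex.exp_ofReal_mul_I_re, Complex.exp_ofReal_mul_I_im, Real.cos_sub]

theorem proj_add_pi (θ : ℝ) (z : ℂ) : proj (θ + Real.pi) z = -proj θ z := by
  simp [proj, Real.cos_add_pi, Real.sin_add_pi]; ring

theorem proj_add_two_pi (θ : ℝ) (z : ℂ) : proj (θ + 2 * Real.pi) z = proj θ z := by
  simp [proj]

theorem abs_proj_le (θ : ℝ) (z : ℂ) : |proj θ z| ≤ ‖z‖ := by
  rw [proj_eq_re_mul]
  refine (Complex.abs_re_le_norm _).trans ?_
  rw [norm_mul, ← Complex.ofReal_neg, Complex.norm_exp_ofReal_mul_I, mul_one]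

theorem continuous_proj (θ : ℝ) : Continuous (proj θ) := by
  unfold proj; fun_prop

theorem continuous_proj_angle (z : ℂ) : Continuous fun θ => proj θ z := by
  unfold proj; fun_prop

theorem abs_proj_sub_proj_le (θ θ' : ℝ) (z : ℂ) : |proj θ z - proj θ' z| ≤ 2 * ‖z‖ * |θ - θ'| := by
  have h1 := Real.abs_cos_sub_cos_le θ θ'
  have h2 := Real.abs_sin_sub_sin_le θ θ'
  have e : proj θ z - proj θ' z = z.re * (Real.cos θ - Real.cos θ')
    + z.im * (Real.sin θ - Real.sin θ') := by simp only [proj]; ring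
  rw [e]
  refine (abs_add_le _ _).trans ?_
  rw [abs_mul, abs_mul]
  have h3 := mul_le_mul (Complex.abs_re_le_norm z) h1 (abs_nonneg _) (norm_nonneg _)
  have h4 := mul_le_mul (Complex.abs_im_le_norm z) h2 (abs_nonneg _) (norm_nonneg _)
  linarith

variable {C D : Set ℂ}

theorem bddAbove_proj_image (hC : Bornology.IsBounded C) (θ : ℝ) : BddAbove (proj θ '' C) := by
  obtain ⟨R, hR⟩ := hC.exists_norm_le
  refine ⟨R, ?_⟩
  rintro _ ⟨z, hz, rfl⟩
  exact (le_abs_self _).trans ((abs_proj_le θ z).trans (hR z hz))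

theorem proj_le_supportFn (hC : Bornology.IsBounded C) {z : ℂ} (hz : z ∈ C) (θ : ℝ) :
    proj θ z ≤ supportFn C θ :=
  le_csSup (bddAbove_proj_image hC θ) (mem_image_of_mem _ hz)

theorem supportFn_le (hC : C.Nonempty) {θ c : ℝ} (h : ∀ z ∈ C, proj θ z ≤ c) :
    supportFn C θ ≤ c :=
  csSup_le (hC.image _) (by rintro _ ⟨z, hz, rfl⟩; exact h z hz)

theorem exists_lt_proj (hC : C.Nonempty) {θ c : ℝ} (h : c < supportFn C θ) :
    ∃ z ∈ C, c < proj θ z := by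
  by_contra hcon
  push Not at hcon
  exact (supportFn_le hC hcon).not_gt h

theorem supportFn_mono (hC : C.Nonempty) (hD : Bornology.IsBounded D) (h : C ⊆ D) (θ : ℝ) :
    supportFn C θ ≤ supportFn D θ :=
  supportFn_le hC fun _ hz => proj_le_supportFn hD (h hz) θ

theorem supportFn_convexHull (hC : C.Nonempty) (hCb : Bornology.IsBounded C) (θ : ℝ) :
    supportFn (convexHull ℝ C) θ = supportFn C θ := by
  refine le_antisymm (supportFn_le hC.convexHull fun z hz => ?_)
    (supportFn_mono hC (isBounded_convexHull.2 hCb) (subset_convexHull ℝ C) θ)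
  have : convexHull ℝ C ⊆ {z | (z * Complex.exp (-(θ : ℂ) * Complex.I)).re ≤ supportFn C θ} :=
    convexHull_min (fun z hz => by
      rw [mem_ofPred_eq, ← proj_eq_re_mul]; exact proj_le_supportFn hCb hz θ)
      (convex_re_mul_le _ _)
  rw [proj_eq_re_mul]
  exact this hz

theorem supportFn_add_two_pi (C : Set ℂ) (θ : ℝ) :
    supportFn C (θ + 2 * Real.pi) = supportFn C θ := by
  rw [supportFn, supportFn, funext fun z => proj_add_two_pi θ z]

theorem continuous_supportFn (hC : C.Nonempty) (hCb : Bornology.IsBounded C) :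
    Continuous (supportFn C) := by
  obtain ⟨R, hR⟩ := hCb.exists_norm_le
  have hR0 : 0 ≤ R := by
    obtain ⟨z, hz⟩ := hC
    exact (norm_nonneg z).trans (hR z hz)
  have key : ∀ θ θ', supportFn C θ ≤ supportFn C θ' + 2 * R * |θ - θ'| := fun θ θ' =>
    supportFn_le hC fun z hz => by
      have h1 := le_of_abs_le (abs_proj_sub_proj_le θ θ' z)
      have h2 := proj_le_supportFn hCb hz θ'
      have h3 : 2 * ‖z‖ * |θ - θ'| ≤ 2 * R * |θ - θ'| := by
        gcongr
        exact hR z hz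
      linarith
  refine (LipschitzWith.of_dist_le_mul (K := (2 * R).toNNReal) fun θ θ' => ?_).continuous
  rw [Real.dist_eq, Real.dist_eq, abs_le]
  have h1 := key θ θ'
  have h2 := key θ' θ
  rw [abs_sub_comm] at h2
  rw [Real.coe_toNNReal _ (by positivity)]
  constructor <;> linarith

theorem neg_supportFn_add_pi_le (hCb : Bornology.IsBounded C) {z : ℂ} (hz : z ∈ C) (θ : ℝ) :
    -supportFn C (θ + Real.pi) ≤ proj θ z := by
  have := proj_le_supportFn hCb hz (θ + Real.pi)
  rw [proj_add_pi] at this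
  linarith

/-! ### Integrals over all directions -/

theorem integral_add_pi_eq {f : ℝ → ℝ} (hf : ∀ θ, f (θ + 2 * Real.pi) = f θ) :
    ∫ θ in (-Real.pi)..Real.pi, f (θ + Real.pi) = ∫ θ in (-Real.pi)..Real.pi, f θ := by
  rw [intervalIntegral.integral_comp_add_right]
  have hp : Function.Periodic f (2 * Real.pi) := hf
  have := hp.intervalIntegral_add_eq (-Real.pi + Real.pi) (-Real.pi)
  convert this using 2 <;> ring

theorem integral_proj (z : ℂ) : ∫ θ in (-Real.pi)..Real.pi, proj θ z = 0 := by
  have h := integral_add_pi_eq (f := fun θ => proj θ z) fun θ => proj_add_two_pi θ z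
  simp only [proj_add_pi, intervalIntegral.integral_neg] at h
  linarith

theorem integral_abs_cos : ∫ θ in (-Real.pi)..Real.pi, |Real.cos θ| = 4 := by
  have hpi := Real.pi_pos
  have hper : Function.Periodic (fun θ => |Real.cos θ|) Real.pi := fun θ => by
    simp [Real.cos_add_pi]
  have hint : ∀ a b, IntervalIntegrable (fun θ => |Real.cos θ|) volume a b := fun a b =>
    (Real.continuous_cos.abs).intervalIntegrable a b
  have h2 : ∫ θ in (-(Real.pi / 2))..(Real.pi / 2), |Real.cos θ| = 2 := by
    rw [intervalIntegral.integral_congr (g := Real.cos), integral_cos]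
    · simp; norm_num
    · intro θ hθ
      rw [uIcc_of_le (by linarith)] at hθ
      exact abs_of_nonneg (Real.cos_nonneg_of_mem_Icc hθ)
  have e0 : ∫ θ in (-(Real.pi / 2))..(-(Real.pi / 2) + Real.pi), |Real.cos θ| = 2 := by
    rw [show -(Real.pi / 2) + Real.pi = Real.pi / 2 by ring, h2]
  have e1 := hper.intervalIntegral_add_eq (-Real.pi) (-(Real.pi / 2))
  have e2 := hper.intervalIntegral_add_eq 0 (-(Real.pi / 2))
  rw [e0, neg_add_cancel] at e1
  rw [e0, zero_add] at e2
  rw [← intervalIntegral.integral_add_adjacent_intervals (hint _ 0) (hint 0 _), e1, e2]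
  norm_num

/-- The integral-geometric source of Cauchy's formula: lengths of segments are averages of the
lengths of their projections. -/
theorem integral_abs_proj (z : ℂ) : ∫ θ in (-Real.pi)..Real.pi, |proj θ z| = 4 * ‖z‖ := by
  have e : ∀ θ, |proj θ z| = ‖z‖ * |Real.cos (θ - z.arg)| := by
    intro θ
    conv_lhs => rw [← Complex.norm_mul_exp_arg_mul_I z]
    rw [proj_real_mul, proj_exp, abs_mul, abs_norm, ← Real.cos_neg, neg_sub]
  simp only [e, intervalIntegral.integral_const_mul]
  rw [intervalIntegral.integral_comp_sub_right (fun θ => |Real.cos θ|)]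
  have hp : Function.Periodic (fun θ => |Real.cos θ|) (2 * Real.pi) := fun θ => by simp
  have := hp.intervalIntegral_add_eq (-Real.pi - z.arg) (-Real.pi)
  have h4 := integral_abs_cos
  rw [show -Real.pi - z.arg + 2 * Real.pi = Real.pi - z.arg by ring,
    show -Real.pi + 2 * Real.pi = Real.pi by ring] at this
  rw [this, h4, mul_comm]

/-! ### Lengths of curves -/

theorem hasUnitSpeedOn_lipschitzOnWith {X : Type*} [PseudoEMetricSpace X] {f : ℝ → X} {S : Set ℝ}
    (h : HasUnitSpeedOn f S) : LipschitzOnWith 1 f S := by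
  have key : ∀ x ∈ S, ∀ y ∈ S, x ≤ y → edist (f x) (f y) ≤ edist x y := by
    intro x hx y hy hxy
    refine (eVariationOn.edist_le f (s := S ∩ Icc x y) ⟨hx, left_mem_Icc.2 hxy⟩
      ⟨hy, right_mem_Icc.2 hxy⟩).trans ?_
    rw [h hx hy, NNReal.coe_one, one_mul, edist_comm, edist_dist, Real.dist_eq,
      abs_of_nonneg (sub_nonneg.2 hxy)]
  intro x hx y hy
  rw [ENNReal.coe_one, one_mul]
  rcases le_total x y with hxy | hxy
  · exact key x hx y hy hxy
  · rw [edist_comm, edist_comm x]; exact key y hy x hx hxy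

/-- The arc length parametrization is 1-Lipschitz on a subset of an interval as long as the
variation. -/
theorem hausdorffMeasure_image_Icc_le_eVariationOn {X : Type*} [MetricSpace X] [MeasurableSpace X]
    [BorelSpace X] (f : ℝ → X) {a b : ℝ} (hab : a ≤ b) :
    μH[1] (f '' Icc a b) ≤ eVariationOn f (Icc a b) := by
  rcases eq_or_ne (eVariationOn f (Icc a b)) ⊤ with htop | htop
  · rw [htop]; exact le_top
  have hbv : LocallyBoundedVariationOn f (Icc a b) :=
    BoundedVariationOn.locallyBoundedVariationOn htop
  have ha : a ∈ Icc a b := left_mem_Icc.2 hab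
  have hb : b ∈ Icc a b := right_mem_Icc.2 hab
  set φ := variationOnFromTo f (Icc a b) a with hφ
  set g := naturalParameterization f (Icc a b) a with hg
  have hlip : LipschitzOnWith 1 g (φ '' Icc a b) :=
    hasUnitSpeedOn_lipschitzOnWith (has_unit_speed_naturalParameterization f hbv ha)
  have himg : f '' Icc a b = g '' (φ '' Icc a b) := by
    rw [image_image]
    refine image_congr fun x hx => ?_
    have := edist_naturalParameterization_eq_zero hbv ha hx
    exact (edist_eq_zero.1 this).symm
  have hmono := variationOnFromTo.monotoneOn hbv ha
  have hsub : φ '' Icc a b ⊆ Icc 0 (eVariationOn f (Icc a b)).toReal := by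
    rintro _ ⟨x, hx, rfl⟩
    have h1 := hmono ha hx hx.1
    have h2 := hmono hx hb hx.2
    rw [variationOnFromTo.self] at h1
    rw [variationOnFromTo.eq_of_le f _ hab, inter_self] at h2
    exact ⟨h1, h2⟩
  rw [himg]
  refine (hlip.hausdorffMeasure_image_le zero_le_one).trans ?_
  rw [hausdorffMeasure_real]
  simp only [ENNReal.coe_one, ENNReal.one_rpow, one_mul]
  refine (measure_mono hsub).trans ?_
  rw [Real.volume_Icc, sub_zero, ENNReal.ofReal_toReal htop]

/-- Projection to the direction of the chord does not increase the measure and covers an interval as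
long as the chord. Half-open intervals make consecutive pieces disjoint. -/
theorem dist_le_hausdorffMeasure_image_Ico {f : ℝ → ℂ} {a b : ℝ} (hab : a ≤ b)
    (hf : ContinuousOn f (Icc a b)) : ENNReal.ofReal ‖f b - f a‖ ≤ μH[1] (f '' Ico a b) := by
  set φ := (f b - f a).arg with hφ
  have hlip : LipschitzWith 1 (proj φ) := LipschitzWith.of_dist_le_mul fun x y => by
    rw [Real.dist_eq, ← proj_sub, NNReal.coe_one, one_mul, dist_eq_norm]
    exact abs_proj_le _ _
  have hnorm : proj φ (f b) - proj φ (f a) = ‖f b - f a‖ := by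
    rw [← proj_sub]
    conv_lhs => rw [← Complex.norm_mul_exp_arg_mul_I (f b - f a)]
    rw [proj_real_mul, proj_exp, ← hφ, sub_self, Real.cos_zero, mul_one]
  have hsub : Ico (proj φ (f a)) (proj φ (f b)) ⊆ proj φ '' (f '' Ico a b) := by
    rw [image_image]
    exact intermediate_value_Ico hab ((continuous_proj φ).comp_continuousOn hf)
  calc ENNReal.ofReal ‖f b - f a‖ = volume (Ico (proj φ (f a)) (proj φ (f b))) := by
        rw [Real.volume_Ico, hnorm]
    _ ≤ μH[1] (proj φ '' (f '' Ico a b)) := by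
        rw [hausdorffMeasure_real]; exact measure_mono hsub
    _ ≤ μH[1] (f '' Ico a b) := by
        simpa using (hlip.lipschitzOnWith (s := f '' Ico a b)).hausdorffMeasure_image_le zero_le_one

theorem sum_norm_sub_le_hausdorffMeasure {f : ℝ → ℂ} {u : ℕ → ℝ} (hu : Monotone u) (n : ℕ)
    (hf : ContinuousOn f (Icc (u 0) (u n))) (hinj : InjOn f (Ico (u 0) (u n))) :
    ENNReal.ofReal (∑ i ∈ Finset.range n, ‖f (u (i + 1)) - f (u i)‖)
      ≤ μH[1] (f '' Ico (u 0) (u n)) := by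
  have hsub : ∀ i < n, Ico (u i) (u (i + 1)) ⊆ Ico (u 0) (u n) := fun i hi =>
    Ico_subset_Ico (hu (Nat.zero_le _)) (hu hi)
  have hsub' : ∀ i < n, Icc (u i) (u (i + 1)) ⊆ Icc (u 0) (u n) := fun i hi =>
    Icc_subset_Icc (hu (Nat.zero_le _)) (hu hi)
  rw [ENNReal.ofReal_sum_of_nonneg fun _ _ => norm_nonneg _]
  calc _ ≤ ∑ i ∈ Finset.range n, μH[1] (f '' Ico (u i) (u (i + 1))) :=
        Finset.sum_le_sum fun i hi => dist_le_hausdorffMeasure_image_Ico (hu (Nat.le_succ i))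
          (hf.mono (hsub' i (Finset.mem_range.1 hi)))
    _ = μH[1] (⋃ i ∈ Finset.range n, f '' Ico (u i) (u (i + 1))) := by
        refine (measure_biUnion_finset ?_ ?_).symm
        · intro i hi j hj hij
          have hd : Disjoint (Ico (u i) (u (i + 1))) (Ico (u j) (u (j + 1))) :=
            hu.pairwise_disjoint_on_Ico_succ hij
          change Disjoint (f '' _) (f '' _)
          rw [disjoint_iff_inter_eq_empty, ← hinj.image_inter (hsub i (by simpa using hi))
              (hsub j (by simpa using hj)), hd.inter_eq, image_empty]
        · intro i hi
          have h1 := hsub i (Finset.mem_range.1 hi)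
          exact measurableSet_Ico.image_of_continuousOn_injOn
            (hf.mono (h1.trans Ico_subset_Icc_self)) (hinj.mono h1)
    _ ≤ _ := by
        refine measure_mono (iUnion₂_subset fun i hi => image_mono (hsub i (Finset.mem_range.1 hi)))

/-- A closed sequence covers the distance between any two of its values once on the way out and once
on the way back. -/
theorem sum_abs_sub_closed_ge {x : ℕ → ℝ} {n j k : ℕ} (hj : j ≤ n) (hk : k ≤ n) (hx : x n = x 0) :
    2 * (x j - x k) ≤ ∑ i ∈ Finset.range n, |x (i + 1) - x i| := by
  have key : ∀ p q, p ≤ q → |x q - x p| ≤ ∑ i ∈ Finset.Ico p q, |x (i + 1) - x i| := by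
    intro p q hpq
    rw [← Finset.sum_Ico_sub x hpq]
    exact Finset.abs_sum_le_sum_abs _ _
  have main : ∀ p q, p ≤ q → q ≤ n → 2 * |x q - x p| ≤ ∑ i ∈ Finset.range n, |x (i + 1) - x i| := by
    intro p q hpq hq
    rw [Finset.range_eq_Ico, ← Finset.sum_Ico_consecutive _ (Nat.zero_le p) (hpq.trans hq),
      ← Finset.sum_Ico_consecutive _ hpq hq]
    have h1 := key 0 p (Nat.zero_le p)
    have h2 := key p q hpq
    have h3 := key q n hq
    have h4 : |x q - x p| ≤ |x p - x 0| + |x n - x q| := by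
      rw [hx]
      have := abs_add_le (x p - x 0) (x 0 - x q)
      rwa [sub_add_sub_cancel, abs_sub_comm] at this
    linarith
  rcases le_total j k with h | h
  · have := main j k h hk
    rw [abs_sub_comm] at this
    linarith [le_abs_self (x j - x k)]
  · have := main k j h hj
    linarith [le_abs_self (x j - x k)]

end CableNet

/-! ### Cauchy's formula for a convex neighbourhood of the origin, in polar coordinates. -/

namespace CableNet

/-! ### The boundary of a convex set in polar coordinates -/

/-- The boundary point of `D` in the direction `τ`, as seen from an inner point `0`. -/
noncomputable def radial (D : Set ℂ) (τ : ℝ) : ℂ :=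
  ((gauge D (Complex.exp ((τ : ℂ) * Complex.I)))⁻¹ : ℝ) * Complex.exp ((τ : ℂ) * Complex.I)

variable {D : Set ℂ}

theorem gauge_exp_pos (hD0 : D ∈ 𝓝 0) (hDb : Bornology.IsBounded D) (τ : ℝ) :
    0 < gauge D (Complex.exp ((τ : ℂ) * Complex.I)) :=
  (gauge_pos (absorbent_nhds_zero hD0) (NormedSpace.isVonNBounded_of_isBounded ℝ hDb)).2
    (Complex.exp_ne_zero _)

theorem gauge_real_mul {r : ℝ} (hr : 0 ≤ r) (z : ℂ) : gauge D ((r : ℂ) * z) = r * gauge D z := by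
  have := gauge_smul_of_nonneg (s := D) hr z
  rwa [Complex.real_smul, smul_eq_mul] at this

theorem gauge_radial (hD0 : D ∈ 𝓝 0) (hDb : Bornology.IsBounded D) (τ : ℝ) :
    gauge D (radial D τ) = 1 := by
  have h := gauge_exp_pos hD0 hDb τ
  rw [radial, gauge_real_mul (inv_nonneg.2 h.le), inv_mul_cancel₀ h.ne']

theorem continuous_radial (hDc : Convex ℝ D) (hD0 : D ∈ 𝓝 0) (hDb : Bornology.IsBounded D) :
    Continuous (radial D) := by
  have h1 : Continuous fun τ : ℝ => Complex.exp ((τ : ℂ) * Complex.I) := by fun_prop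
  have h2 : Continuous fun τ : ℝ => gauge D (Complex.exp ((τ : ℂ) * Complex.I)) :=
    (continuous_gauge hDc hD0).comp h1
  exact (Complex.continuous_ofReal.comp (h2.inv₀ fun τ => (gauge_exp_pos hD0 hDb τ).ne')).mul h1

theorem exp_add_two_pi_mul_I (τ : ℝ) :
    Complex.exp (((τ + 2 * Real.pi : ℝ) : ℂ) * Complex.I) = Complex.exp ((τ : ℂ) * Complex.I) := by
  push_cast
  rw [add_mul, Complex.exp_add, Complex.exp_two_pi_mul_I, mul_one]

theorem radial_add_two_pi (τ : ℝ) : radial D (τ + 2 * Real.pi) = radial D τ := by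
  rw [radial, radial, exp_add_two_pi_mul_I]

theorem exists_eq_gauge_mul_radial (hD0 : D ∈ 𝓝 0) (hDb : Bornology.IsBounded D) (z : ℂ) :
    ∃ τ ∈ Icc 0 (2 * Real.pi), z = gauge D z * radial D τ := by
  obtain ⟨τ, hτ, hz⟩ : ∃ τ ∈ Icc 0 (2 * Real.pi),
      z = (‖z‖ : ℂ) * Complex.exp ((τ : ℂ) * Complex.I) := by
    have hpi := Real.pi_pos
    rcases le_total 0 z.arg with h | h
    · exact ⟨z.arg, ⟨h, by linarith [Complex.arg_le_pi z]⟩, polar_arg z⟩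
    · exact ⟨z.arg + 2 * Real.pi, ⟨by linarith [Complex.neg_pi_lt_arg z], by linarith⟩, by
        rw [exp_add_two_pi_mul_I]; exact polar_arg z⟩
  refine ⟨τ, hτ, ?_⟩
  have hg := gauge_exp_pos hD0 hDb τ
  have h1 : gauge D z = ‖z‖ * gauge D (Complex.exp ((τ : ℂ) * Complex.I)) := by
    conv_lhs => rw [hz]
    exact gauge_real_mul (norm_nonneg _) _
  rw [h1, radial]
  conv_lhs => rw [hz]
  have : (gauge D (Complex.exp ((τ : ℂ) * Complex.I)) : ℂ) ≠ 0 := by exact_mod_cast hg.ne'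
  push_cast
  field_simp

theorem frontier_subset_image_radial (hDc : Convex ℝ D) (hD0 : D ∈ 𝓝 0)
    (hDb : Bornology.IsBounded D) : frontier D ⊆ radial D '' Icc 0 (2 * Real.pi) := by
  intro z hz
  obtain ⟨τ, hτ, h⟩ := exists_eq_gauge_mul_radial hD0 hDb z
  rw [(gauge_eq_one_iff_mem_frontier hDc hD0).2 hz, Complex.ofReal_one, one_mul] at h
  exact ⟨τ, hτ, h.symm⟩

theorem radial_mem_frontier (hDc : Convex ℝ D) (hD0 : D ∈ 𝓝 0)
    (hDb : Bornology.IsBounded D) (τ : ℝ) : radial D τ ∈ frontier D :=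
  (gauge_eq_one_iff_mem_frontier hDc hD0).1 (gauge_radial hD0 hDb τ)

theorem injOn_radial (hD0 : D ∈ 𝓝 0) (hDb : Bornology.IsBounded D) :
    InjOn (radial D) (Ico 0 (2 * Real.pi)) := by
  intro x hx y hy hxy
  have nx : ‖radial D x‖ = (gauge D (Complex.exp ((x : ℂ) * Complex.I)))⁻¹ := by
    rw [radial, norm_mul, Complex.norm_exp_ofReal_mul_I, mul_one, Complex.norm_real,
      Real.norm_of_nonneg (inv_nonneg.2 (gauge_exp_pos hD0 hDb x).le)]
  have ny : ‖radial D y‖ = (gauge D (Complex.exp ((y : ℂ) * Complex.I)))⁻¹ := by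
    rw [radial, norm_mul, Complex.norm_exp_ofReal_mul_I, mul_one, Complex.norm_real,
      Real.norm_of_nonneg (inv_nonneg.2 (gauge_exp_pos hD0 hDb y).le)]
  have h0 : radial D x ≠ 0 := norm_ne_zero_iff.1 (by
    rw [nx]; exact inv_ne_zero (gauge_exp_pos hD0 hDb x).ne')
  have px : radial D x = (‖radial D x‖ : ℂ) * Complex.exp ((x : ℂ) * Complex.I) := by
    rw [nx, radial]
  have py : radial D x = (‖radial D x‖ : ℂ) * Complex.exp ((y : ℂ) * Complex.I) := by
    rw [hxy, ny, radial]
  obtain ⟨n, hn⟩ := Complex.exp_eq_one_iff.1 (exp_sub_eq_one_of_polar h0 px py)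
  have h3 : ((x - y : ℝ) : ℂ) * Complex.I = ((n * (2 * Real.pi) : ℝ) : ℂ) * Complex.I := by
    rw [hn]; push_cast; ring
  have h4 : x - y = n * (2 * Real.pi) := by
    exact_mod_cast mul_right_cancel₀ Complex.I_ne_zero h3
  have hpi := Real.pi_pos
  have h5 : (n : ℝ) < 1 := by
    by_contra h; push Not at h
    nlinarith [hx.1, hx.2, hy.1, hy.2]
  have h6 : (-1 : ℝ) < n := by
    by_contra h; push Not at h
    nlinarith [hx.1, hx.2, hy.1, hy.2]
  have h7 : n < 1 := by exact_mod_cast h5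
  have h8 : -1 < n := by exact_mod_cast h6
  have h9 : n = 0 := by omega
  rw [h9] at h4
  simp at h4
  linarith

theorem proj_radial (θ τ : ℝ) : proj θ (radial D τ)
    = (gauge D (Complex.exp ((τ : ℂ) * Complex.I)))⁻¹ * Real.cos (τ - θ) := by
  rw [radial, proj_real_mul, proj_exp]

theorem proj_radial_le (hDc : Convex ℝ D) (hD0 : D ∈ 𝓝 0) (hDb : Bornology.IsBounded D)
    (θ τ : ℝ) : proj θ (radial D τ) ≤ supportFn D θ :=
  closure_minimal (t := {z | proj θ z ≤ supportFn D θ}) (fun _ hz => proj_le_supportFn hDb hz θ)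
    (isClosed_le (continuous_proj θ) continuous_const)
    (frontier_subset_closure (radial_mem_frontier hDc hD0 hDb τ))

theorem exists_le_proj_radial (hD0 : D ∈ 𝓝 0) (hDb : Bornology.IsBounded D)
    {z : ℂ} (hz : z ∈ D) (θ : ℝ) :
    ∃ τ ∈ Icc 0 (2 * Real.pi), proj θ z ≤ proj θ (radial D τ) := by
  have hle : gauge D z ≤ 1 := gauge_le_one_of_mem hz
  have h0 := gauge_nonneg (s := D) z
  -- Moving `z` radially to the boundary enlarges a positive projection. Otherwise the boundary
  -- point in the direction `θ` itself has a nonnegative one.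
  by_cases hpos : 0 < proj θ z
  · obtain ⟨τ, hτ, h⟩ := exists_eq_gauge_mul_radial hD0 hDb z
    refine ⟨τ, hτ, ?_⟩
    rw [h, proj_real_mul] at hpos ⊢
    have hp := pos_of_mul_pos_right hpos h0
    nlinarith
  · obtain ⟨τ, hτ, h⟩ := exists_eq_gauge_mul_radial hD0 hDb (Complex.exp ((θ : ℂ) * Complex.I))
    refine ⟨τ, hτ, (not_lt.1 hpos).trans ?_⟩
    have h1 : proj θ (Complex.exp ((θ : ℂ) * Complex.I)) = 1 := by rw [proj_exp]; simp
    rw [h, proj_real_mul] at h1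
    have := gauge_exp_pos hD0 hDb θ
    nlinarith

/-- The projection of the boundary curve is quasiconcave on a half turn. -/
theorem min_proj_radial_le (hDc : Convex ℝ D) (hD0 : D ∈ 𝓝 0) (hDb : Bornology.IsBounded D)
    {θ x y z : ℝ} (hx : θ - Real.pi / 2 ≤ x) (hxy : x ≤ y) (hyz : y ≤ z)
    (hz : z ≤ θ + Real.pi / 2) :
    min (proj θ (radial D x)) (proj θ (radial D z)) ≤ proj θ (radial D y) := by
  have gx := gauge_exp_pos hD0 hDb x
  have gy := gauge_exp_pos hD0 hDb y
  have gz := gauge_exp_pos hD0 hDb z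
  have cpos : ∀ u, x ≤ u → u ≤ z → 0 ≤ Real.cos (u - θ) := fun u h1 h2 =>
    Real.cos_nonneg_of_mem_Icc ⟨by linarith, by linarith⟩
  have cy := cpos y hxy hyz
  -- For a full half turn `sin (z - x)` vanishes, but then the projection at `x` is `0`.
  rcases eq_or_lt_of_le (show z - x ≤ Real.pi by linarith) with heq | hlt
  · have hx' : x - θ = -(Real.pi / 2) := by linarith
    refine (min_le_left _ _).trans ?_
    rw [proj_radial, proj_radial, hx', Real.cos_neg, Real.cos_pi_div_two, mul_zero]
    positivity
  rcases eq_or_lt_of_le (hxy.trans hyz) with hxz | hxz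
  · have : x = y := by linarith
    subst this
    exact min_le_left _ _
  have hp : 0 ≤ Real.sin (z - y) := Real.sin_nonneg_of_nonneg_of_le_pi (by linarith) (by linarith)
  have hq : 0 ≤ Real.sin (y - x) := Real.sin_nonneg_of_nonneg_of_le_pi (by linarith) (by linarith)
  have hS : 0 < Real.sin (z - x) := Real.sin_pos_of_pos_of_lt_pi (by linarith) hlt
  -- The middle direction is a nonnegative combination of the outer ones, so subadditivity of the
  -- gauge, which is convexity of `D`, bounds the gauge at `y`.
  have key : ((Real.sin (z - x) : ℝ) : ℂ) * Complex.exp ((y : ℂ) * Complex.I)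
      = ((Real.sin (z - y) : ℝ) : ℂ) * Complex.exp ((x : ℂ) * Complex.I)
        + ((Real.sin (y - x) : ℝ) : ℂ) * Complex.exp ((z : ℂ) * Complex.I) := by
    apply Complex.ext
    · simp only [Complex.add_re, Complex.re_ofReal_mul, Complex.exp_ofReal_mul_I_re, Real.sin_sub]
      have := Real.sin_sq_add_cos_sq
      ring_nf
    · simp only [Complex.add_im, Complex.im_ofReal_mul, Complex.exp_ofReal_mul_I_im, Real.sin_sub]
      ring_nf
  have hgauge : Real.sin (z - x) * gauge D (Complex.exp ((y : ℂ) * Complex.I))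
      ≤ Real.sin (z - y) * gauge D (Complex.exp ((x : ℂ) * Complex.I))
        + Real.sin (y - x) * gauge D (Complex.exp ((z : ℂ) * Complex.I)) := by
    rw [← gauge_real_mul hS.le, ← gauge_real_mul hp, ← gauge_real_mul hq, key]
    exact gauge_add_le hDc (absorbent_nhds_zero hD0) _ _
  have hproj := congr_arg (proj θ) key
  rw [proj_add, proj_real_mul, proj_real_mul, proj_real_mul, proj_exp, proj_exp, proj_exp] at hproj
  set m := min (proj θ (radial D x)) (proj θ (radial D z)) with hm
  have hm0 : 0 ≤ m := by
    have := cpos x le_rfl hxz.le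
    have := cpos z hxz.le le_rfl
    rw [hm, proj_radial, proj_radial]
    positivity
  have mx : m * gauge D (Complex.exp ((x : ℂ) * Complex.I)) ≤ Real.cos (x - θ) := by
    have h : m ≤ _ := min_le_left _ _
    rw [proj_radial, inv_mul_eq_div, le_div_iff₀ gx] at h
    exact h
  have mz : m * gauge D (Complex.exp ((z : ℂ) * Complex.I)) ≤ Real.cos (z - θ) := by
    have h : m ≤ _ := min_le_right _ _
    rw [proj_radial, inv_mul_eq_div, le_div_iff₀ gz] at h
    exact h
  rw [proj_radial, inv_mul_eq_div, le_div_iff₀ gy]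
  refine le_of_mul_le_mul_left ?_ hS
  rw [hproj]
  have h1 := mul_le_mul_of_nonneg_left hgauge hm0
  have h2 := mul_le_mul_of_nonneg_left mx hp
  have h3 := mul_le_mul_of_nonneg_left mz hq
  nlinarith

theorem eVariationOn_neg (f : ℝ → ℝ) (S : Set ℝ) :
    eVariationOn (fun x => -f x) S = eVariationOn f S := by
  simp only [eVariationOn, edist_neg_neg]

theorem eVariationOn_Icc_union (f : ℝ → ℝ) {a b c : ℝ} (hab : a ≤ b) (hbc : b ≤ c) :
    eVariationOn f (Icc a b) + eVariationOn f (Icc b c) = eVariationOn f (Icc a c) := by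
  simpa using eVariationOn.Icc_add_Icc f (s := univ) hab hbc (mem_univ b)

/-- Such a function increases up to a maximum point and decreases after it, so its variation is
twice the maximum. -/
theorem eVariationOn_le_of_quasiconcave {f : ℝ → ℝ} {a b M : ℝ} (hab : a ≤ b)
    (hf : ContinuousOn f (Icc a b)) (ha : f a = 0) (hb : f b = 0)
    (hq : ∀ x y z, a ≤ x → x ≤ y → y ≤ z → z ≤ b → min (f x) (f z) ≤ f y)
    (hM : ∀ x ∈ Icc a b, f x ≤ M) : eVariationOn f (Icc a b) ≤ ENNReal.ofReal (2 * M) := by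
  obtain ⟨c, hc, hmax⟩ := isCompact_Icc.exists_isMaxOn (nonempty_Icc.2 hab) hf
  have hM0 : 0 ≤ M := ha ▸ hM a (left_mem_Icc.2 hab)
  have h1 : MonotoneOn f (Icc a c) := fun x hx y hy hxy => by
    have := hq x y c hx.1 hxy hy.2 hc.2
    rwa [min_eq_left (hmax ⟨hx.1, hx.2.trans hc.2⟩)] at this
  have h2 : MonotoneOn (fun x => -f x) (Icc c b) := fun x hx y hy hxy => by
    have := hq c x y hc.1 hx.1 hxy hy.2
    rw [min_eq_right (hmax ⟨hc.1.trans hy.1, hy.2⟩)] at this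
    exact neg_le_neg this
  rw [← eVariationOn_Icc_union f hc.1 hc.2, ← eVariationOn_neg f (Icc c b), two_mul,
    ENNReal.ofReal_add hM0 hM0]
  refine add_le_add ?_ ?_
  · have := h1.eVariationOn_eq (left_mem_Icc.2 hc.1) (right_mem_Icc.2 hc.1)
    rw [inter_self] at this
    refine this.le.trans (ENNReal.ofReal_le_ofReal ?_)
    rw [ha, sub_zero]; exact hM c hc
  · have := h2.eVariationOn_eq (left_mem_Icc.2 hc.2) (right_mem_Icc.2 hc.2)
    rw [inter_self] at this
    refine this.le.trans (ENNReal.ofReal_le_ofReal ?_)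
    rw [hb]; simpa using hM c hc

theorem eVariationOn_proj_radial_half (hDc : Convex ℝ D) (hD0 : D ∈ 𝓝 0)
    (hDb : Bornology.IsBounded D) (θ : ℝ) :
    eVariationOn (fun τ => proj θ (radial D τ)) (Icc (θ - Real.pi / 2) (θ + Real.pi / 2))
      ≤ ENNReal.ofReal (2 * supportFn D θ) := by
  have hpi := Real.pi_pos
  refine eVariationOn_le_of_quasiconcave (by linarith)
    ((continuous_proj θ).comp (continuous_radial hDc hD0 hDb)).continuousOn ?_ ?_
    (fun x y z hx hxy hyz hz => min_proj_radial_le hDc hD0 hDb hx hxy hyz hz)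
    fun τ _ => proj_radial_le hDc hD0 hDb θ τ
  · rw [proj_radial]; simp
  · rw [proj_radial]; simp

theorem eVariationOn_Icc_of_periodic {f : ℝ → ℝ} {T α : ℝ} (hf : Function.Periodic f T)
    (hα : α ∈ Icc 0 T) : eVariationOn f (Icc α (α + T)) = eVariationOn f (Icc 0 T) := by
  have h0 : eVariationOn f (Icc T (α + T)) = eVariationOn f (Icc 0 α) := by
    have h1 := eVariationOn.comp_eq_of_monotoneOn f (t := Icc 0 α) (fun x => x + T)
      (fun x _ y _ h => by simpa using h)
    have h2 : (fun x => x + T) '' Icc 0 α = Icc T (α + T) := by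
      rw [image_add_const_Icc, zero_add]
    rw [h2] at h1
    rw [← h1]
    exact eVariationOn.congr fun x _ => hf x
  rw [← eVariationOn_Icc_union f (b := T) hα.2 (by linarith [hα.1]), h0, add_comm,
    eVariationOn_Icc_union f hα.1 hα.2]

theorem eVariationOn_proj_radial (hDc : Convex ℝ D) (hD0 : D ∈ 𝓝 0)
    (hDb : Bornology.IsBounded D) (θ : ℝ) :
    eVariationOn (fun τ => proj θ (radial D τ)) (Icc 0 (2 * Real.pi))
      ≤ ENNReal.ofReal (2 * (supportFn D θ + supportFn D (θ + Real.pi))) := by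
  have hpi := Real.pi_pos
  have h0D : (0 : ℂ) ∈ D := mem_of_mem_nhds hD0
  have hnn : ∀ θ, 0 ≤ supportFn D θ := fun θ => by
    simpa [proj] using proj_le_supportFn hDb h0D θ
  have main : ∀ θ, θ - Real.pi / 2 ∈ Icc 0 (2 * Real.pi) →
      eVariationOn (fun τ => proj θ (radial D τ)) (Icc 0 (2 * Real.pi))
      ≤ ENNReal.ofReal (2 * (supportFn D θ + supportFn D (θ + Real.pi))) := by
    intro θ hθ
    have hper : Function.Periodic (fun τ => proj θ (radial D τ)) (2 * Real.pi) := fun τ => by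
      simp only [radial_add_two_pi]
    rw [← eVariationOn_Icc_of_periodic hper hθ,
      ← eVariationOn_Icc_union _ (b := θ + Real.pi / 2) (by linarith) (by linarith), mul_add,
      ENNReal.ofReal_add (by linarith [hnn θ]) (by linarith [hnn (θ + Real.pi)])]
    refine add_le_add (eVariationOn_proj_radial_half hDc hD0 hDb θ) ?_
    have := eVariationOn_proj_radial_half hDc hD0 hDb (θ + Real.pi)
    simp only [proj_add_pi] at this
    rwa [eVariationOn_neg, show θ + Real.pi - Real.pi / 2 = θ + Real.pi / 2 by ring,
      show θ + Real.pi + Real.pi / 2 = θ - Real.pi / 2 + 2 * Real.pi by ring] at this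
  -- The case treated above needs `θ - π / 2` in one period; a shift by a multiple of `2π` reduces
  -- to it.
  have hT : 0 < 2 * Real.pi := by linarith
  have hmem := toIcoMod_mem_Ico hT 0 (θ - Real.pi / 2)
  rw [zero_add] at hmem
  set n := toIcoDiv hT 0 (θ - Real.pi / 2) with hn
  have he : toIcoMod hT 0 (θ - Real.pi / 2) = θ - Real.pi / 2 - n • (2 * Real.pi) := rfl
  have hp1 : ∀ z, proj (θ - n • (2 * Real.pi)) z = proj θ z := fun z =>
    (show Function.Periodic (fun θ => proj θ z) (2 * Real.pi) from
      fun θ => proj_add_two_pi θ z).sub_zsmul_eq n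
  have hsp : Function.Periodic (supportFn D) (2 * Real.pi) := supportFn_add_two_pi D
  have := main (θ - n • (2 * Real.pi)) (by
    rw [show θ - n • (2 * Real.pi) - Real.pi / 2 = θ - Real.pi / 2 - n • (2 * Real.pi)
      from sub_right_comm _ _ _, ← he]
    exact Ico_subset_Icc_self hmem)
  simp only [hp1] at this
  rwa [hsp.sub_zsmul_eq, sub_add_eq_add_sub, hsp.sub_zsmul_eq] at this

/-! ### The perimeter of a convex set is the integral of its support function -/

theorem integral_supportFn_add_pi (C : Set ℂ) :
    ∫ θ in (-Real.pi)..Real.pi, supportFn C (θ + Real.pi)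
      = ∫ θ in (-Real.pi)..Real.pi, supportFn C θ :=
  integral_add_pi_eq (supportFn_add_two_pi C)

theorem sum_norm_eq_integral (Δ : ℕ → ℂ) (n : ℕ) :
    ∑ i ∈ Finset.range n, ‖Δ i‖
      = 4⁻¹ * ∫ θ in (-Real.pi)..Real.pi, ∑ i ∈ Finset.range n, |proj θ (Δ i)| := by
  rw [intervalIntegral.integral_finsetSum fun i _ =>
    ((continuous_proj_angle (Δ i)).abs).intervalIntegrable _ _]
  simp only [integral_abs_proj]
  rw [← Finset.mul_sum]
  ring

/-- The measure is at most the length of the boundary curve, a supremum over inscribed polygons. The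
projections of a polygon's edges sum to at most twice the width of `D`, and averaging over `θ` with
the factor `1/4` leaves the integral of the support function. -/
theorem hausdorffMeasure_frontier_le (hDc : Convex ℝ D) (hD0 : D ∈ 𝓝 0)
    (hDb : Bornology.IsBounded D) :
    μH[1] (frontier D) ≤ ENNReal.ofReal (∫ θ in (-Real.pi)..Real.pi, supportFn D θ) := by
  have hpi := Real.pi_pos
  have hDn : D.Nonempty := ⟨0, mem_of_mem_nhds hD0⟩
  have hcs := continuous_supportFn hDn hDb
  refine (measure_mono (frontier_subset_image_radial hDc hD0 hDb)).trans
    ((hausdorffMeasure_image_Icc_le_eVariationOn _ (by linarith)).trans ?_)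
  refine iSup_le ?_
  rintro ⟨n, u, hu, hmem⟩
  simp only [edist_dist, dist_eq_norm]
  rw [← ENNReal.ofReal_sum_of_nonneg fun _ _ => norm_nonneg _]
  refine ENNReal.ofReal_le_ofReal ?_
  rw [sum_norm_eq_integral]
  have hle : ∫ θ in (-Real.pi)..Real.pi,
      ∑ i ∈ Finset.range n, |proj θ (radial D (u (i + 1)) - radial D (u i))|
      ≤ ∫ θ in (-Real.pi)..Real.pi, 2 * (supportFn D θ + supportFn D (θ + Real.pi)) := by
    refine intervalIntegral.integral_mono_on (by linarith) ?_ ?_ fun θ _ => ?_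
    · exact (continuous_finsetSum _ fun i _ => (continuous_proj_angle _).abs).intervalIntegrable _ _
    · exact Continuous.intervalIntegrable (by fun_prop) _ _
    · have h1 := eVariationOn.sum_le (f := fun τ => proj θ (radial D τ)) (n := n) hu hmem
      have h2 := h1.trans (eVariationOn_proj_radial hDc hD0 hDb θ)
      simp only [edist_dist, Real.dist_eq, ← proj_sub] at h2
      rw [← ENNReal.ofReal_sum_of_nonneg fun _ _ => abs_nonneg _] at h2
      have hnn : ∀ θ, 0 ≤ supportFn D θ := fun θ => by
        simpa [proj] using proj_le_supportFn hDb (mem_of_mem_nhds hD0) θ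
      exact (ENNReal.ofReal_le_ofReal_iff (by linarith [hnn θ, hnn (θ + Real.pi)])).1 h2
  have hII : IntervalIntegrable (fun θ => supportFn D (θ + Real.pi)) volume (-Real.pi) Real.pi :=
    (hcs.comp (continuous_add_const _)).intervalIntegrable _ _
  rw [intervalIntegral.integral_const_mul, intervalIntegral.integral_add
    (hcs.intervalIntegrable _ _) hII, integral_supportFn_add_pi] at hle
  linarith

/-- A fine inscribed polygon nearly attains the width in all directions at once, and its length is
at most the measure of the boundary because the polar curve is injective on a period. -/
theorem le_hausdorffMeasure_frontier (hDc : Convex ℝ D) (hD0 : D ∈ 𝓝 0)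
    (hDb : Bornology.IsBounded D) :
    ENNReal.ofReal (∫ θ in (-Real.pi)..Real.pi, supportFn D θ) ≤ μH[1] (frontier D) := by
  have hpi := Real.pi_pos
  have hDn : D.Nonempty := ⟨0, mem_of_mem_nhds hD0⟩
  have hcs := continuous_supportFn hDn hDb
  have hrc := continuous_radial hDc hD0 hDb
  rcases eq_or_ne (μH[1] (frontier D)) ⊤ with htop | htop
  · rw [htop]; exact le_top
  rw [ENNReal.ofReal_le_iff_le_toReal htop]
  refine le_of_forall_pos_le_add fun ε hε => ?_
  -- Each of the two support values is missed by at most `2 η`, so the doubled width by `8 η`.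
  -- Integration over `2π` and the factor `1/4` leave an error `4 π η`, below `ε`.
  set η := ε / (8 * Real.pi) with hη
  have hη0 : 0 < η := by positivity
  have huc := isCompact_Icc.uniformContinuousOn_of_continuous
    (hrc.continuousOn (s := Icc 0 (2 * Real.pi)))
  rw [Metric.uniformContinuousOn_iff] at huc
  obtain ⟨δ, hδ, hunif⟩ := huc η hη0
  obtain ⟨n, hn⟩ := exists_nat_gt (2 * Real.pi / δ)
  have hn0 : (0 : ℝ) < n := lt_of_le_of_lt (by positivity) hn
  have hstep : 2 * Real.pi / n < δ := by
    rw [div_lt_iff₀ hδ] at hn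
    rw [div_lt_iff₀ hn0]; linarith
  set u : ℕ → ℝ := fun i => 2 * Real.pi / n * i with hu
  have hum : Monotone u := fun i j hij => by
    simp only [hu]; gcongr
  have hu0 : u 0 = 0 := by simp [hu]
  have hun : u n = 2 * Real.pi := by simp only [hu]; field_simp
  have hclose : ∀ τ ∈ Icc 0 (2 * Real.pi), ∃ j ≤ n, ∀ θ,
      |proj θ (radial D τ) - proj θ (radial D (u j))| ≤ η := by
    intro τ hτ
    have hq : 0 ≤ τ / (2 * Real.pi / n) := by have := hτ.1; positivity
    have hj1 := Nat.floor_le hq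
    have hj2 := Nat.lt_floor_add_one (τ / (2 * Real.pi / n))
    set j := ⌊τ / (2 * Real.pi / n)⌋₊
    have hpn : 0 < 2 * Real.pi / n := by positivity
    rw [le_div_iff₀ hpn] at hj1
    rw [div_lt_iff₀ hpn] at hj2
    have hjn : j ≤ n := by
      have : (j : ℝ) * (2 * Real.pi / n) ≤ n * (2 * Real.pi / n) := by
        rw [mul_div_cancel₀ _ hn0.ne']; linarith [hτ.2]
      exact_mod_cast le_of_mul_le_mul_right this hpn
    have huj : u j ≤ τ := by simp only [hu]; linarith
    have huj' : τ - u j < δ := by simp only [hu]; linarith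
    have huj0 : u j ∈ Icc 0 (2 * Real.pi) := ⟨by rw [← hu0]; exact hum (Nat.zero_le _), by
      rw [← hun]; exact hum hjn⟩
    refine ⟨j, hjn, fun θ => ?_⟩
    rw [← proj_sub]
    refine (abs_proj_le _ _).trans ?_
    rw [← dist_eq_norm]
    refine (hunif τ hτ (u j) huj0 ?_).le
    rw [Real.dist_eq, abs_of_nonneg (by linarith)]
    exact huj'
  have hnear : ∀ θ, ∃ j ≤ n, supportFn D θ - 2 * η ≤ proj θ (radial D (u j)) := by
    intro θ
    obtain ⟨z, hz, hzθ⟩ := exists_lt_proj hDn (show supportFn D θ - η < supportFn D θ by linarith)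
    obtain ⟨τ, hτ, hle⟩ := exists_le_proj_radial hD0 hDb hz θ
    obtain ⟨j, hj, hjθ⟩ := hclose τ hτ
    exact ⟨j, hj, by linarith [le_of_abs_le (hjθ θ)]⟩
  have hsum : ∀ θ, 2 * (supportFn D θ + supportFn D (θ + Real.pi)) - 8 * η ≤
      ∑ i ∈ Finset.range n, |proj θ (radial D (u (i + 1)) - radial D (u i))| := by
    intro θ
    obtain ⟨j, hj, h1⟩ := hnear θ
    obtain ⟨k, hk, h2⟩ := hnear (θ + Real.pi)
    rw [proj_add_pi] at h2
    have h3 := sum_abs_sub_closed_ge (x := fun i => proj θ (radial D (u i))) hj hk (by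
      simp only [hu0, hun]
      rw [← zero_add (2 * Real.pi), radial_add_two_pi])
    simp only [proj_sub] at h3 ⊢
    linarith
  have hint : ∫ θ in (-Real.pi)..Real.pi, (2 * (supportFn D θ + supportFn D (θ + Real.pi)) - 8 * η)
      ≤ ∫ θ in (-Real.pi)..Real.pi,
        ∑ i ∈ Finset.range n, |proj θ (radial D (u (i + 1)) - radial D (u i))| := by
    refine intervalIntegral.integral_mono_on (by linarith) ?_ ?_ fun θ _ => hsum θ
    · exact Continuous.intervalIntegrable (by fun_prop) _ _
    · exact (continuous_finsetSum _ fun i _ => (continuous_proj_angle _).abs).intervalIntegrable _ _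
  have hII : IntervalIntegrable (supportFn D) volume (-Real.pi) Real.pi :=
    hcs.intervalIntegrable _ _
  have hII' : IntervalIntegrable (fun θ => supportFn D (θ + Real.pi)) volume (-Real.pi) Real.pi :=
    (hcs.comp (continuous_add_const _)).intervalIntegrable _ _
  rw [intervalIntegral.integral_sub ((hII.add hII').const_mul 2) intervalIntegrable_const,
    intervalIntegral.integral_const_mul, intervalIntegral.integral_add hII hII',
    integral_supportFn_add_pi, intervalIntegral.integral_const, smul_eq_mul] at hint
  have hS : ∑ i ∈ Finset.range n, ‖radial D (u (i + 1)) - radial D (u i)‖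
      ≤ (μH[1] (frontier D)).toReal := by
    rw [← ENNReal.ofReal_le_iff_le_toReal htop]
    refine (sum_norm_sub_le_hausdorffMeasure hum n hrc.continuousOn ?_).trans (measure_mono ?_)
    · rw [hu0, hun]; exact injOn_radial hD0 hDb
    · rintro _ ⟨τ, -, rfl⟩
      exact radial_mem_frontier hDc hD0 hDb τ
  rw [sum_norm_eq_integral] at hS
  have hεη : η * (8 * Real.pi) = ε := by rw [hη]; field_simp
  linarith

end CableNet

/-! ### Cauchy's formula for arbitrary bounded convex sets. -/

namespace CableNet

variable {C : Set ℂ}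

theorem supportFn_nonneg_integral (hCb : Bornology.IsBounded C) (hC : C.Nonempty) :
    0 ≤ ∫ θ in (-Real.pi)..Real.pi, supportFn C θ := by
  obtain ⟨z, hz⟩ := hC
  have hcs := continuous_supportFn ⟨z, hz⟩ hCb
  rw [← integral_proj z]
  exact intervalIntegral.integral_mono_on (by linarith [Real.pi_pos])
    ((continuous_proj_angle z).intervalIntegrable _ _) (hcs.intervalIntegrable _ _)
    fun θ _ => proj_le_supportFn hCb hz θ

theorem supportFn_translate (hC : C.Nonempty) (hCb : Bornology.IsBounded C) (p : ℂ) (θ : ℝ) :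
    supportFn ((fun z => p + z) '' C) θ = proj θ p + supportFn C θ := by
  have hb : Bornology.IsBounded ((fun z => p + z) '' C) :=
    (isometry_add_left p).lipschitz.isBounded_image hCb
  refine le_antisymm (supportFn_le (hC.image _) ?_) ?_
  · rintro _ ⟨z, hz, rfl⟩
    rw [proj_add]
    linarith [proj_le_supportFn hCb hz θ]
  · have : supportFn C θ ≤ supportFn ((fun z => p + z) '' C) θ - proj θ p :=
      supportFn_le hC fun z hz => by
        have := proj_le_supportFn hb (mem_image_of_mem _ hz) θ
        rw [proj_add] at this
        linarith
    linarith

theorem volume_toReal_of_ordConnected {S : Set ℝ} (hS : S.OrdConnected) (hne : S.Nonempty)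
    (hb : BddBelow S) (ha : BddAbove S) : (volume S).toReal = sSup S - sInf S := by
  have hle : sInf S ≤ sSup S := (csInf_le hb hne.some_mem).trans (le_csSup ha hne.some_mem)
  have h1 : Ioo (sInf S) (sSup S) ⊆ S := fun x hx => by
    obtain ⟨y, hy, hyx⟩ := exists_lt_of_csInf_lt hne hx.1
    obtain ⟨z, hz, hxz⟩ := exists_lt_of_lt_csSup hne hx.2
    exact hS.out hy hz ⟨hyx.le, hxz.le⟩
  have h2 : S ⊆ Icc (sInf S) (sSup S) := fun x hx => ⟨csInf_le hb hx, le_csSup ha hx⟩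
  have h3 : volume S = ENNReal.ofReal (sSup S - sInf S) := by
    refine le_antisymm ((measure_mono h2).trans_eq Real.volume_Icc) ?_
    rw [← Real.volume_Ioo]; exact measure_mono h1
  rw [h3, ENNReal.toReal_ofReal (sub_nonneg.2 hle)]

theorem sSup_image_mul {S : Set ℝ} (hne : S.Nonempty) (hb : BddBelow S) (ha : BddAbove S) (k : ℝ) :
    sSup ((fun x => x * k) '' S) = (sSup S + sInf S) / 2 * k + (sSup S - sInf S) / 2 * |k| := by
  rcases le_total 0 k with hk | hk
  · rw [abs_of_nonneg hk]
    have : sSup ((fun x => x * k) '' S) = sSup S * k :=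
      ((monotone_mul_right_of_nonneg hk).map_csSup_of_continuousAt (by fun_prop) hne ha).symm
    rw [this]; ring
  · rw [abs_of_nonpos hk]
    have : sSup ((fun x => x * k) '' S) = sInf S * k :=
      ((antitone_mul_right hk).map_csInf_of_continuousAt (by fun_prop) hne hb).symm
    rw [this]; ring

/-- The set is an isometric copy of a real interval `S`. Its support function is a projection of a
fixed vector, which integrates to `0`, plus half the length of `S` times `|proj θ v|`, which
integrates to twice the length. -/
theorem perimeter_of_interior_eq_empty (hCc : Convex ℝ C) (hCb : Bornology.IsBounded C)
    (hC : C.Nonempty) (hi : ¬ (interior C).Nonempty) :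
    perimeter C = ∫ θ in (-Real.pi)..Real.pi, supportFn C θ := by
  obtain ⟨f, hf0, hf⟩ := exists_const_of_interior_eq_empty hCc hC (not_nonempty_iff_eq_empty.1 hi)
  have hw := re_mul_ne_zero hf0
  set w : ℂ := (f 1 : ℂ) - f Complex.I * Complex.I with hwdef
  obtain ⟨z0, hz0⟩ := hC
  -- A unit vector along the line on which `f` is constant.
  set v : ℂ := Complex.I * (‖w‖ / w) with hv
  have hwn : (‖w‖ : ℂ) ≠ 0 := by simpa using hw
  have hv1 : ‖v‖ = 1 := by
    rw [hv, norm_mul, norm_div, Complex.norm_I, Complex.norm_real, norm_norm, one_mul,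
      div_self (norm_ne_zero_iff.2 hw)]
  set S : Set ℝ := {x | z0 + x * v ∈ C} with hS
  have hCS : C = (fun x : ℝ => z0 + x * v) '' S := by
    ext z
    constructor
    · intro hz
      have h1 := hf z hz z0 (subset_closure hz0)
      have h2 : ((z - z0) * w).re = 0 := by
        rw [hwdef, ← clm_apply_eq_re_mul, map_sub, h1, sub_self]
      have h3 : z0 + ((((z - z0) * w).im / ‖w‖ : ℝ) : ℂ) * v = z := by
        have h4 : (z - z0) * w = (((z - z0) * w).im : ℂ) * Complex.I := by
          apply Complex.ext <;> simp [h2]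
        rw [hv]
        push_cast
        have h5 : (((z - z0) * w).im : ℂ) / ‖w‖ * (Complex.I * (‖w‖ / w))
            = (((z - z0) * w).im : ℂ) * Complex.I / w := by
          field_simp
        rw [h5, ← h4, mul_div_cancel_right₀ _ hw]
        ring
      exact ⟨((z - z0) * w).im / ‖w‖, by rw [hS, mem_ofPred_eq, h3]; exact hz, h3⟩
    · rintro ⟨x, hx, rfl⟩
      exact hx
  have hiso : Isometry fun x : ℝ => z0 + x * v := Isometry.of_dist_eq fun x y => by
    rw [dist_add_left, dist_eq_norm, ← sub_mul, norm_mul, hv1, mul_one, ← Complex.ofReal_sub,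
      Complex.norm_real, dist_eq_norm]
  have hSc : Convex ℝ S := by
    intro x hx y hy p q hp hq hpq
    have := hCc hx hy hp hq hpq
    have hpq' : (p : ℂ) + q = 1 := by exact_mod_cast hpq
    have e : p • (z0 + x * v) + q • (z0 + y * v) = z0 + ((p • x + q • y : ℝ) : ℂ) * v := by
      simp only [Complex.real_smul, smul_eq_mul]
      push_cast
      linear_combination z0 * hpq'
    rw [e] at this
    exact this
  have hSne : S.Nonempty := ⟨0, by simpa [hS] using hz0⟩
  have hSb : Bornology.IsBounded S := by
    obtain ⟨R, hR⟩ := hCb.exists_norm_le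
    refine isBounded_iff_forall_norm_le.2 ⟨R + ‖z0‖, fun x hx => ?_⟩
    have h1 := hR _ hx
    have h2 : ‖((x : ℂ) * v)‖ ≤ ‖z0 + x * v‖ + ‖z0‖ := by
      have := norm_sub_le (z0 + x * v) z0
      rwa [add_sub_cancel_left] at this
    rw [norm_mul, hv1, mul_one, Complex.norm_real] at h2
    linarith
  have hsupp : ∀ θ, supportFn C θ = proj θ z0 +
      ((sSup S + sInf S) / 2 * proj θ v + (sSup S - sInf S) / 2 * |proj θ v|) := by
    intro θ
    rw [← sSup_image_mul hSne hSb.bddBelow hSb.bddAbove, hCS, ← image_image (fun z => z0 + z)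
      (fun x : ℝ => (x : ℂ) * v), supportFn_translate (hSne.image _), supportFn, image_image]
    · simp only [proj_real_mul]
    · have hl : LipschitzWith 1 fun x : ℝ => (x : ℂ) * v := LipschitzWith.of_dist_le_mul fun x y => by
        rw [dist_eq_norm, ← sub_mul, norm_mul, hv1, mul_one, ← Complex.ofReal_sub,
          Complex.norm_real, NNReal.coe_one, one_mul, dist_eq_norm]
      exact hl.isBounded_image hSb
  rw [perimeter, if_neg hi]
  conv_lhs => rw [hCS]
  rw [hiso.hausdorffMeasure_image (Or.inl zero_le_one), hausdorffMeasure_real,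
    volume_toReal_of_ordConnected hSc.ordConnected hSne hSb.bddBelow hSb.bddAbove]
  simp only [hsupp]
  have i1 : IntervalIntegrable (fun θ => proj θ z0) volume (-Real.pi) Real.pi :=
    (continuous_proj_angle z0).intervalIntegrable _ _
  have i2 : IntervalIntegrable (fun θ => (sSup S + sInf S) / 2 * proj θ v) volume (-Real.pi) Real.pi :=
    ((continuous_proj_angle v).intervalIntegrable _ _).const_mul _
  have i3 : IntervalIntegrable (fun θ => (sSup S - sInf S) / 2 * |proj θ v|)
      volume (-Real.pi) Real.pi :=
    ((continuous_proj_angle v).abs.intervalIntegrable _ _).const_mul _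
  rw [intervalIntegral.integral_add i1 (i2.add i3), intervalIntegral.integral_add i2 i3,
    intervalIntegral.integral_const_mul, intervalIntegral.integral_const_mul, integral_proj,
    integral_proj, integral_abs_proj, hv1]
  ring

/-- The perimeter length of a bounded convex set is the integral of its support function. -/
theorem perimeter_eq_integral (hCc : Convex ℝ C) (hCb : Bornology.IsBounded C)
    (hC : C.Nonempty) : perimeter C = ∫ θ in (-Real.pi)..Real.pi, supportFn C θ := by
  by_cases hi : (interior C).Nonempty
  swap
  · exact perimeter_of_interior_eq_empty hCc hCb hC hi
  rw [perimeter, if_pos hi]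
  obtain ⟨p, hp⟩ := hi
  -- The polar description needs the origin inside. Translation changes the support function only by
  -- `proj θ p`, whose integral vanishes.
  set D : Set ℂ := (fun z => -p + z) '' C with hD
  have hCD : C = (fun z => p + z) '' D := by
    rw [hD, image_image]; simp
  have hDc : Convex ℝ D := hCc.translate (-p)
  have hDb : Bornology.IsBounded D := (isometry_add_left (-p)).lipschitz.isBounded_image hCb
  have hDn : D.Nonempty := hC.image _
  have hD0 : D ∈ 𝓝 0 := by
    have h1 : (fun z => -p + z) '' C ∈ 𝓝 (-p + p) :=
      (IsometryEquiv.addLeft (-p)).toHomeomorph.isOpenMap.image_mem_nhds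
        (mem_interior_iff_mem_nhds.1 hp)
    rwa [neg_add_cancel] at h1
  have hfr : (fun z => p + z) '' frontier D = frontier C := by
    conv_rhs => rw [hCD]
    exact (IsometryEquiv.addLeft p).toHomeomorph.image_frontier D
  rw [← hfr, (isometry_add_left p).hausdorffMeasure_image (Or.inl zero_le_one),
    le_antisymm (hausdorffMeasure_frontier_le hDc hD0 hDb)
      (le_hausdorffMeasure_frontier hDc hD0 hDb),
    ENNReal.toReal_ofReal (supportFn_nonneg_integral hDb hDn)]
  have hs : ∀ θ, supportFn C θ = proj θ p + supportFn D θ := fun θ => by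
    rw [← supportFn_translate hDn hDb, ← hCD]
  simp only [hs]
  rw [intervalIntegral.integral_add ((continuous_proj_angle p).intervalIntegrable _ _)
    ((continuous_supportFn hDn hDb).intervalIntegrable _ _), integral_proj, zero_add]

end CableNet

/-! ### The line measure in terms of support functions. -/

namespace CableNet

/-! ### The measure of sets of lines -/

/-- The direction in which the right half-plane of `G` extends. -/
noncomputable def DirLine.dir (G : DirLine) : ℝ := if G.2 = true then G.1.2 else G.1.2 + Real.pi

/-- The signed distance of the right half-plane of `G` from the origin. -/
noncomputable def DirLine.off (G : DirLine) : ℝ := if G.2 = true then G.1.1 else -G.1.1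

theorem mem_rightHalfPlane_iff {G : DirLine} {z : ℂ} :
    z ∈ G.rightHalfPlane ↔ G.off ≤ proj G.dir z := by
  rcases G with ⟨⟨ρ, θ⟩, b⟩
  cases b
  · simp only [DirLine.rightHalfPlane, DirLine.off, DirLine.dir, mem_ofPred_eq, if_neg,
      Bool.false_eq_true, not_false_eq_true, proj_add_pi, neg_le_neg_iff]
    rfl
  · simp only [DirLine.rightHalfPlane, DirLine.off, DirLine.dir, mem_ofPred_eq, if_true]
    rfl

theorem mem_linesMeeting_iff {Ω : Set ℂ} {G : DirLine} :
    G ∈ linesMeeting Ω ↔ ∃ z ∈ Ω, proj G.dir z = G.off := by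
  have key : ∀ z, z ∈ G.points ↔ proj G.dir z = G.off := by
    intro z
    rcases G with ⟨⟨ρ, θ⟩, b⟩
    cases b
    · simp only [DirLine.points, DirLine.off, DirLine.dir, mem_ofPred_eq, if_neg,
        Bool.false_eq_true, not_false_eq_true, proj_add_pi, neg_inj]
      rfl
    · simp only [DirLine.points, DirLine.off, DirLine.dir, mem_ofPred_eq, if_true]
      rfl
  simp only [linesMeeting, mem_ofPred_eq, Set.Nonempty, mem_inter_iff, key, and_comm]

theorem mem_linesMeeting_of_lt {Ω : Set ℂ} (hΩ : Convex ℝ Ω) (hne : Ω.Nonempty) {G : DirLine}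
    (h1 : -supportFn Ω (G.dir + Real.pi) < G.off) (h2 : G.off < supportFn Ω G.dir) :
    G ∈ linesMeeting Ω := by
  obtain ⟨x, hx, hx'⟩ := exists_lt_proj hne h2
  obtain ⟨y, hy, hy'⟩ := exists_lt_proj hne (show -G.off < supportFn Ω (G.dir + Real.pi) by linarith)
  rw [proj_add_pi] at hy'
  obtain ⟨z, hz, hzG⟩ := hΩ.isPreconnected.intermediate_value hy hx
    (continuous_proj G.dir).continuousOn ⟨(neg_lt_neg_iff.1 hy').le, hx'.le⟩
  exact mem_linesMeeting_iff.2 ⟨z, hz, hzG⟩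

/-- The measure of the undirected lines in normal coordinates. -/
noncomputable def normalMeasure : Measure (ℝ × ℝ) :=
  (volume : Measure (ℝ × ℝ)).restrict (Ici (0 : ℝ) ×ˢ Icc (-Real.pi) Real.pi)

/-- No measurability of `X` is required: it is cut along the measurable condition on the direction,
and the measure of a product of sets is multiplicative without measurability. -/
theorem lineMeasure_apply (X : Set DirLine) : lineMeasure X =
    2⁻¹ * (normalMeasure {q | (q, true) ∈ X} + normalMeasure {q | (q, false) ∈ X}) := by
  have hm : MeasurableSet ((univ : Set (ℝ × ℝ)) ×ˢ ({true} : Set Bool)) :=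
    MeasurableSet.univ.prod (measurableSet_singleton _)
  have e1 : X ∩ (univ : Set (ℝ × ℝ)) ×ˢ ({true} : Set Bool) = {q | (q, true) ∈ X} ×ˢ {true} := by
    ext ⟨q, b⟩
    cases b <;> simp
  have e2 : X \ (univ : Set (ℝ × ℝ)) ×ˢ ({true} : Set Bool) = {q | (q, false) ∈ X} ×ˢ {false} := by
    ext ⟨q, b⟩
    cases b <;> simp
  rw [← measure_inter_add_sdiff X hm, e1, e2, lineMeasure, Measure.prod_prod, Measure.prod_prod]
  simp only [Measure.smul_apply, Measure.count_singleton, smul_eq_mul, mul_one]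
  rw [mul_add, mul_comm, mul_comm (2⁻¹ : ℝ≥0∞) (normalMeasure {q | (q, false) ∈ X})]
  rfl

theorem measurableSet_strip {f g : ℝ → ℝ} (hf : Continuous f) (hg : Continuous g) :
    MeasurableSet {q : ℝ × ℝ | f q.2 ≤ q.1 ∧ q.1 ≤ g q.2} :=
  ((isClosed_le (hf.comp continuous_snd) continuous_fst).inter
    (isClosed_le continuous_fst (hg.comp continuous_snd))).measurableSet

theorem measurableSet_open_strip {f g : ℝ → ℝ} (hf : Continuous f) (hg : Continuous g) :
    MeasurableSet {q : ℝ × ℝ | f q.2 < q.1 ∧ q.1 < g q.2} :=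
  ((isOpen_lt (hf.comp continuous_snd) continuous_fst).inter
    (isOpen_lt continuous_fst (hg.comp continuous_snd))).measurableSet

theorem volume_restrict_Ici_Icc {a b : ℝ} (hab : a ≤ b) :
    (volume.restrict (Ici (0 : ℝ))) (Icc a b) = ENNReal.ofReal (max b 0 - max a 0) := by
  rw [Measure.restrict_apply measurableSet_Icc]
  have : Icc a b ∩ Ici 0 = Icc (max a 0) b := by
    ext x; simp only [mem_inter_iff, mem_Icc, mem_Ici, max_le_iff]; tauto
  rw [this, Real.volume_Icc]
  rcases le_total 0 b with hb | hb
  · rw [max_eq_left hb]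
  · rw [max_eq_right hb, max_eq_right (hab.trans hb), sub_self, ENNReal.ofReal_zero]
    exact ENNReal.ofReal_of_nonpos (by linarith)

theorem lintegral_strip {f g : ℝ → ℝ} (hf : Continuous f) (hg : Continuous g) (hfg : ∀ θ, f θ ≤ g θ) :
    ∫⁻ θ in Icc (-Real.pi) Real.pi, ENNReal.ofReal (max (g θ) 0 - max (f θ) 0)
      = ENNReal.ofReal (∫ θ in (-Real.pi)..Real.pi, (max (g θ) 0 - max (f θ) 0)) := by
  have hc : Continuous fun θ => max (g θ) 0 - max (f θ) 0 := by fun_prop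
  rw [intervalIntegral.integral_of_le (by linarith [Real.pi_pos]),
    ← integral_Icc_eq_integral_Ioc, ofReal_integral_eq_lintegral_ofReal]
  · exact hc.integrableOn_Icc
  · exact Eventually.of_forall fun θ => sub_nonneg.2 (max_le_max (hfg θ) le_rfl)

theorem normalMeasure_strip {f g : ℝ → ℝ} (hf : Continuous f) (hg : Continuous g)
    (hfg : ∀ θ, f θ ≤ g θ) : normalMeasure {q | f q.2 ≤ q.1 ∧ q.1 ≤ g q.2}
      = ENNReal.ofReal (∫ θ in (-Real.pi)..Real.pi, (max (g θ) 0 - max (f θ) 0)) := by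
  rw [normalMeasure, Measure.volume_eq_prod, ← Measure.prod_restrict,
    Measure.prod_apply_symm (measurableSet_strip hf hg), ← lintegral_strip hf hg hfg]
  exact lintegral_congr fun θ => volume_restrict_Ici_Icc (hfg θ)

theorem normalMeasure_open_strip {f g : ℝ → ℝ} (hf : Continuous f) (hg : Continuous g)
    (hfg : ∀ θ, f θ ≤ g θ) : normalMeasure {q | f q.2 < q.1 ∧ q.1 < g q.2}
      = ENNReal.ofReal (∫ θ in (-Real.pi)..Real.pi, (max (g θ) 0 - max (f θ) 0)) := by
  rw [normalMeasure, Measure.volume_eq_prod, ← Measure.prod_restrict,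
    Measure.prod_apply_symm (measurableSet_open_strip hf hg), ← lintegral_strip hf hg hfg]
  refine lintegral_congr fun θ => ?_
  rw [← volume_restrict_Ici_Icc (hfg θ)]
  change volume.restrict (Ici (0 : ℝ)) (Ioo (f θ) (g θ)) = _
  exact measure_congr Ioo_ae_eq_Icc

variable {a h : ℝ → ℝ}

theorem max_zero_sub_max_neg_zero (x : ℝ) : max x 0 - max (-x) 0 = x := by
  rcases le_total 0 x with hx | hx
  · rw [max_eq_left hx, max_eq_right (by linarith)]; ring
  · rw [max_eq_right hx, max_eq_left (by linarith)]; ring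

/-- The two directions contribute the parts of the strip `a ≤ off ≤ h` with `off ≥ 0` and with `off
≤ 0`, the latter after a half turn. Together they give the full width, since `max x 0 - max (-x) 0 =
x`. -/
theorem half_strips_eq (ha : Continuous a) (hh : Continuous h)
    (hap : ∀ θ, a (θ + 2 * Real.pi) = a θ) (hhp : ∀ θ, h (θ + 2 * Real.pi) = h θ)
    (hah : ∀ θ, a θ ≤ h θ) :
    2⁻¹ * (ENNReal.ofReal (∫ θ in (-Real.pi)..Real.pi, (max (h θ) 0 - max (a θ) 0)) +
      ENNReal.ofReal (∫ θ in (-Real.pi)..Real.pi,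
        (max (-a (θ + Real.pi)) 0 - max (-h (θ + Real.pi)) 0)))
      = ENNReal.ofReal (2⁻¹ * ∫ θ in (-Real.pi)..Real.pi, (h θ - a θ)) := by
  have hpi := Real.pi_pos
  rw [integral_add_pi_eq (f := fun θ => max (-a θ) 0 - max (-h θ) 0)
    (fun θ => by simp only [hap, hhp]), ← ENNReal.ofReal_add, ← intervalIntegral.integral_add]
  · rw [ENNReal.ofReal_mul (by norm_num), ENNReal.ofReal_inv_of_pos two_pos, ENNReal.ofReal_ofNat]
    congr 3
    ext θ
    have h1 := max_zero_sub_max_neg_zero (h θ)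
    have h2 := max_zero_sub_max_neg_zero (a θ)
    linarith
  · exact Continuous.intervalIntegrable (by fun_prop) _ _
  · exact Continuous.intervalIntegrable (by fun_prop) _ _
  · exact intervalIntegral.integral_nonneg (by linarith) fun θ _ =>
      sub_nonneg.2 (max_le_max (hah θ) le_rfl)
  · exact intervalIntegral.integral_nonneg (by linarith) fun θ _ =>
      sub_nonneg.2 (max_le_max (neg_le_neg (hah θ)) le_rfl)

/-- With `le_lineMeasure`, this sandwiches events, measurable or not, between an open and a closed
strip of equal measure. -/
theorem lineMeasure_le (ha : Continuous a) (hh : Continuous h)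
    (hap : ∀ θ, a (θ + 2 * Real.pi) = a θ) (hhp : ∀ θ, h (θ + 2 * Real.pi) = h θ)
    (hah : ∀ θ, a θ ≤ h θ) {X : Set DirLine}
    (hX : ∀ G ∈ X, a G.dir ≤ G.off ∧ G.off ≤ h G.dir) :
    lineMeasure X ≤ ENNReal.ofReal (2⁻¹ * ∫ θ in (-Real.pi)..Real.pi, (h θ - a θ)) := by
  rw [lineMeasure_apply, ← half_strips_eq ha hh hap hhp hah, ← normalMeasure_strip ha hh hah,
    ← normalMeasure_strip (f := fun θ => -h (θ + Real.pi)) (g := fun θ => -a (θ + Real.pi))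
      (by fun_prop) (by fun_prop) fun θ => neg_le_neg (hah _)]
  gcongr 2⁻¹ * (normalMeasure ?_ + normalMeasure ?_)
  · intro q hq
    simpa [DirLine.dir, DirLine.off] using hX _ hq
  · intro q hq
    have := hX _ hq
    simp only [DirLine.dir, DirLine.off, Bool.false_eq_true, if_false] at this
    exact ⟨by linarith [this.2], by linarith [this.1]⟩

theorem le_lineMeasure (ha : Continuous a) (hh : Continuous h)
    (hap : ∀ θ, a (θ + 2 * Real.pi) = a θ) (hhp : ∀ θ, h (θ + 2 * Real.pi) = h θ)
    (hah : ∀ θ, a θ ≤ h θ) {X : Set DirLine}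
    (hX : ∀ G : DirLine, a G.dir < G.off → G.off < h G.dir → G ∈ X) :
    ENNReal.ofReal (2⁻¹ * ∫ θ in (-Real.pi)..Real.pi, (h θ - a θ)) ≤ lineMeasure X := by
  rw [lineMeasure_apply, ← half_strips_eq ha hh hap hhp hah, ← normalMeasure_open_strip ha hh hah,
    ← normalMeasure_open_strip (f := fun θ => -h (θ + Real.pi)) (g := fun θ => -a (θ + Real.pi))
      (by fun_prop) (by fun_prop) fun θ => neg_le_neg (hah _)]
  gcongr 2⁻¹ * (normalMeasure ?_ + normalMeasure ?_)
  · intro q hq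
    exact hX (q, true) (by simpa [DirLine.dir, DirLine.off] using hq.1)
      (by simpa [DirLine.dir, DirLine.off] using hq.2)
  · intro q hq
    refine hX (q, false) ?_ ?_ <;>
      simp only [DirLine.dir, DirLine.off, Bool.false_eq_true, if_false]
    · linarith [hq.2]
    · linarith [hq.1]

/-- For a given direction, the offsets of the lines meeting `Ω` fill an interval as long as the
width `h(θ) + h(θ + π)`. -/
theorem lineMeasure_linesMeeting {Ω : Set ℂ} (hΩ : Convex ℝ Ω) (hb : Bornology.IsBounded Ω)
    (hne : Ω.Nonempty) :
    lineMeasure (linesMeeting Ω) = ENNReal.ofReal (∫ θ in (-Real.pi)..Real.pi, supportFn Ω θ) := by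
  have hc := continuous_supportFn hne hb
  have hc' : Continuous fun θ => -supportFn Ω (θ + Real.pi) := by fun_prop
  have hp : ∀ θ, -supportFn Ω (θ + 2 * Real.pi + Real.pi) = -supportFn Ω (θ + Real.pi) := fun θ => by
    rw [add_right_comm, supportFn_add_two_pi]
  have hle : ∀ θ, -supportFn Ω (θ + Real.pi) ≤ supportFn Ω θ := fun θ => by
    obtain ⟨z, hz⟩ := hne
    exact (neg_supportFn_add_pi_le hb hz θ).trans (proj_le_supportFn hb hz θ)
  have e : ∫ θ in (-Real.pi)..Real.pi, supportFn Ω θ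
      = 2⁻¹ * ∫ θ in (-Real.pi)..Real.pi, (supportFn Ω θ - -supportFn Ω (θ + Real.pi)) := by
    rw [intervalIntegral.integral_sub (hc.intervalIntegrable _ _) (hc'.intervalIntegrable _ _),
      intervalIntegral.integral_neg, integral_supportFn_add_pi]
    ring
  rw [e]
  refine le_antisymm
    (lineMeasure_le hc' hc hp (supportFn_add_two_pi Ω) hle fun G hG => ?_)
    (le_lineMeasure hc' hc hp (supportFn_add_two_pi Ω) hle fun G h1 h2 =>
      mem_linesMeeting_of_lt hΩ hne h1 h2)
  obtain ⟨z, hz, hzG⟩ := mem_linesMeeting_iff.1 hG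
  rw [← hzG]
  exact ⟨neg_supportFn_add_pi_le hb hz _, proj_le_supportFn hb hz _⟩

end CableNet

/-! ### From routes and inner parts to support functions. -/

namespace CableNet

/-! ### The support functions of the inner parts -/

theorem proj_le_max_of_mem_segment {s t z : ℂ} (hz : z ∈ segment ℝ s t) (θ : ℝ) :
    proj θ z ≤ max (proj θ s) (proj θ t) := by
  have := (convex_re_mul_le (Complex.exp (-(θ : ℂ) * Complex.I))
    (max (proj θ s) (proj θ t))).segment_subset
    (x := s) (y := t) (by rw [mem_ofPred_eq, ← proj_eq_re_mul]; exact le_max_left _ _)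
    (by rw [mem_ofPred_eq, ← proj_eq_re_mul]; exact le_max_right _ _) hz
  rwa [mem_ofPred_eq, ← proj_eq_re_mul] at this

theorem isBounded_segment (s t : ℂ) : Bornology.IsBounded (segment ℝ s t) := by
  rw [segment_eq_image_lineMap]
  exact (isCompact_Icc.image AffineMap.lineMap_continuous).isBounded

theorem supportFn_segment (s t : ℂ) (θ : ℝ) :
    supportFn (segment ℝ s t) θ = max (proj θ s) (proj θ t) :=
  le_antisymm (supportFn_le ⟨s, left_mem_segment ℝ s t⟩ fun _ hz => proj_le_max_of_mem_segment hz θ)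
    (max_le (proj_le_supportFn (isBounded_segment s t) (left_mem_segment ℝ s t) θ)
      (proj_le_supportFn (isBounded_segment s t) (right_mem_segment ℝ s t) θ))

variable {s t : ℂ}

theorem Path.isBounded_range (α : Path s t) : Bornology.IsBounded (range α) :=
  (isCompact_range α.continuous).isBounded

theorem max_proj_le_supportFn_range (α : Path s t) (θ : ℝ) :
    max (proj θ s) (proj θ t) ≤ supportFn (range α) θ :=
  max_le (proj_le_supportFn (Path.isBounded_range α) ⟨0, α.source⟩ θ)
    (proj_le_supportFn (Path.isBounded_range α) ⟨1, α.target⟩ θ)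

theorem isBounded_innerPart_union (α β : Path s t) :
    Bornology.IsBounded (innerPart α β ∪ segment ℝ s t) :=
  ((Path.isBounded_range α).subset fun _ hx => hx.1).union (isBounded_segment s t)

theorem max_proj_le_supportFn_innerPart (α β : Path s t) (θ : ℝ) :
    max (proj θ s) (proj θ t) ≤ supportFn (innerPart α β ∪ segment ℝ s t) θ :=
  max_le (proj_le_supportFn (isBounded_innerPart_union α β) (Or.inr (left_mem_segment ℝ s t)) θ)
    (proj_le_supportFn (isBounded_innerPart_union α β) (Or.inr (right_mem_segment ℝ s t)) θ)

theorem innerPart_union_nonempty (α β : Path s t) : (innerPart α β ∪ segment ℝ s t).Nonempty :=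
  ⟨s, Or.inr (left_mem_segment ℝ s t)⟩

/-- Here `I_α` adds nothing to the chord in the direction `θ`, and `I_β` reaches as far as `β`.
Inner points of `β` are never beyond all of `α`, so `β` realizes the minimum. -/
theorem supportFn_innerPart_add {α β : Path s t} {θ : ℝ}
    (h1 : ∀ x ∈ innerPart α β, proj θ x ≤ max (proj θ s) (proj θ t))
    (h2 : ∀ y ∈ range β, max (proj θ s) (proj θ t) < proj θ y → y ∈ innerPart β α) :
    supportFn (innerPart α β ∪ segment ℝ s t) θ + supportFn (innerPart β α ∪ segment ℝ s t) θ
      - supportFn (segment ℝ s t) θ = min (supportFn (range α) θ) (supportFn (range β) θ) := by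
  have e1 : supportFn (innerPart α β ∪ segment ℝ s t) θ = max (proj θ s) (proj θ t) :=
    le_antisymm (supportFn_le (innerPart_union_nonempty α β) fun z hz =>
      hz.elim (h1 z) fun hz => proj_le_max_of_mem_segment hz θ) (max_proj_le_supportFn_innerPart α β θ)
  have e2 : supportFn (innerPart β α ∪ segment ℝ s t) θ = supportFn (range β) θ := by
    refine le_antisymm (supportFn_le (innerPart_union_nonempty β α) fun z hz => ?_)
      (supportFn_le (range_nonempty β) fun y hy => ?_)
    · rcases hz with hz | hz
      · exact proj_le_supportFn (Path.isBounded_range β) hz.1 θ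
      · exact (proj_le_max_of_mem_segment hz θ).trans (max_proj_le_supportFn_range β θ)
    · rcases le_or_gt (proj θ y) (max (proj θ s) (proj θ t)) with h | h
      · exact h.trans (max_proj_le_supportFn_innerPart β α θ)
      · exact proj_le_supportFn (isBounded_innerPart_union β α) (Or.inl (h2 y hy h)) θ
  have e3 : supportFn (range β) θ ≤ supportFn (range α) θ := by
    refine supportFn_le (range_nonempty β) fun y hy => ?_
    rcases le_or_gt (proj θ y) (max (proj θ s) (proj θ t)) with h | h
    · exact h.trans (max_proj_le_supportFn_range α θ)
    · obtain ⟨v, hv⟩ := exists_le_of_mem_innerPart (h2 y hy h) (Complex.exp (-(θ : ℂ) * Complex.I))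
      rw [← proj_eq_re_mul, ← proj_eq_re_mul] at hv
      exact hv.trans (proj_le_supportFn (Path.isBounded_range α) (mem_range_self v) θ)
  rw [e1, e2, supportFn_segment, min_eq_right e3]
  ring

theorem supportFn_innerParts {a b : ℝ} (hst : s ≠ t) (ha : |a| ≤ Real.pi / 2)
    (hb : |b| ≤ Real.pi / 2) {α β : Path s t} (hα : range α ⊆ supportSet s t a b)
    (hβ : range β ⊆ supportSet s t a b) (hαβ : MeetOnlyAtEnds α β) (θ : ℝ) :
    supportFn (innerPart α β ∪ segment ℝ s t) θ + supportFn (innerPart β α ∪ segment ℝ s t) θ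
      - supportFn (segment ℝ s t) θ = min (supportFn (range α) θ) (supportFn (range β) θ) := by
  have h := innerPart_dichotomy hst ha hb hα hβ hαβ (Complex.exp (-(θ : ℂ) * Complex.I))
  simp only [← proj_eq_re_mul] at h
  rcases h with h | h
  · exact supportFn_innerPart_add h.1 h.2
  · rw [add_comm (supportFn (innerPart α β ∪ segment ℝ s t) θ), min_comm]
    exact supportFn_innerPart_add h.1 h.2

/-! ### Routes as paths -/

/-- A path from `s` to `t` has a part that is at `s` and `t` only at its ends. -/
theorem exists_path_of_ne (hst : s ≠ t) (ρ : Path s t) :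
    ∃ τ : Path s t, range τ ⊆ range ρ ∧ ∀ u : I, (τ u = s → (u : ℝ) = 0) ∧
      (τ u = t → (u : ℝ) = 1) := by
  have hc := ρ.continuous_extend
  have hA : IsCompact {x : ℝ | x ∈ Icc (0 : ℝ) 1 ∧ ρ.extend x = s} :=
    isCompact_Icc.inter_right (isClosed_eq hc continuous_const)
  -- The last visit to `s`; below, `q` is the first visit to `t` after it. Links may pass through
  -- these points repeatedly, which `MeetOnlyAtEnds` does not allow.
  obtain ⟨p, ⟨hp, hps⟩, hpmax⟩ := hA.exists_isMaxOn ⟨0, by simp⟩ continuous_id.continuousOn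
  have hB : IsCompact {x : ℝ | x ∈ Icc p 1 ∧ ρ.extend x = t} :=
    isCompact_Icc.inter_right (isClosed_eq hc continuous_const)
  obtain ⟨q, ⟨hq, hqt⟩, hqmin⟩ := hB.exists_isMinOn ⟨1, by simp [hp.2]⟩ continuous_id.continuousOn
  have hpq : p < q := lt_of_le_of_ne hq.1 fun h => hst (by rw [← hps, h, hqt])
  have hmem : ∀ u : I, p + u * (q - p) ∈ Icc p q := fun u =>
    ⟨by nlinarith [u.2.1], by nlinarith [u.2.2]⟩
  refine ⟨⟨⟨fun u => ρ.extend (p + u * (q - p)), by fun_prop⟩, by simp [hps], by simp [hqt]⟩,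
    ?_, fun u => ⟨fun h => ?_, fun h => ?_⟩⟩
  · rintro _ ⟨u, rfl⟩
    change ρ.extend (p + u * (q - p)) ∈ range ρ
    rw [← Path.extend_range]
    exact mem_range_self _
  · have h1 : p + u * (q - p) ≤ p := hpmax
      ⟨⟨hp.1.trans (hmem u).1, (hmem u).2.trans hq.2⟩, h⟩
    have h2 := u.2.1
    nlinarith
  · have h1 : q ≤ p + u * (q - p) := hqmin ⟨⟨(hmem u).1, (hmem u).2.trans hq.2⟩, h⟩
    have h2 := u.2.2
    nlinarith

variable {V E : Type*} {N : Network V E} {v w : V}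

theorem Network.joinedIn_linkSet {e : E} (h : N.Joins e v w) :
    JoinedIn (N.linkSet e) (N.pos v) (N.pos w) := by
  have hc : ContinuousOn (N.curve e) (Icc 0 (N.len e)) :=
    (hasUnitSpeedOn_lipschitzOnWith (N.unitSpeed e)).continuousOn
  have hl := (N.len_pos e).le
  have hp : IsPathConnected (N.linkSet e) :=
    ((convex_Icc 0 (N.len e)).isPathConnected (nonempty_Icc.2 hl)).image' hc
  have h0 : N.pos (N.src e) ∈ N.linkSet e := ⟨0, left_mem_Icc.2 hl, N.curve_zero e⟩
  have h1 : N.pos (N.tgt e) ∈ N.linkSet e := ⟨N.len e, right_mem_Icc.2 hl, N.curve_len e⟩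
  rcases h with ⟨rfl, rfl⟩ | ⟨rfl, rfl⟩
  · exact hp.joinedIn _ h0 _ h1
  · exact hp.joinedIn _ h1 _ h0

theorem Network.Route.size_pos (R : N.Route v w) (hvw : N.pos v ≠ N.pos w) : 0 < R.size := by
  rcases R with ⟨size, node, link, h0, hl, -, -⟩
  rcases Nat.eq_zero_or_pos size with rfl | h
  · exact absurd (by rw [← h0, ← hl]; rfl) hvw
  · exact h

theorem Network.Route.linkSet_subset (R : N.Route v w) (k : Fin R.size) :
    N.linkSet (R.link k) ⊆ R.trace := subset_iUnion (fun k => N.linkSet (R.link k)) k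

theorem Network.Route.joinedIn_trace (R : N.Route v w) (hvw : N.pos v ≠ N.pos w) :
    JoinedIn R.trace (N.pos v) (N.pos w) := by
  have h0 : N.pos (R.node 0) ∈ R.trace := by
    have h := R.joins ⟨0, R.size_pos hvw⟩
    exact R.linkSet_subset _ (Network.joinedIn_linkSet h).source_mem
  have key : ∀ k, JoinedIn R.trace (N.pos (R.node 0)) (N.pos (R.node k)) := by
    intro k
    induction k using Fin.induction with
    | zero => exact JoinedIn.refl h0
    | succ k ih =>
      exact ih.trans ((Network.joinedIn_linkSet (R.joins k)).mono (R.linkSet_subset k))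
  have := key (Fin.last _)
  rwa [R.node_zero, R.node_last] at this

theorem Network.IsOuterPair.meetOnlyAtEnds {O : Fin 2 → N.Route v w}
    (hO : N.IsOuterPair O) {R : N.Route v w} {i : Fin 2} (hR : R ≠ O i)
    {ρ γ : Path (N.pos v) (N.pos w)} (hρ : range ρ ⊆ R.trace)
    (hρe : ∀ u : I, (ρ u = N.pos v → (u : ℝ) = 0) ∧ (ρ u = N.pos w → (u : ℝ) = 1))
    (hγ : (O i).IsArc γ) : MeetOnlyAtEnds ρ γ := by
  intro x y hxy
  have hx : ρ x ∈ R.trace ∩ (O i).trace := ⟨hρ (mem_range_self x), by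
    rw [hxy, ← hγ.2]; exact mem_range_self y⟩
  rcases hO.2.1 i R hR hx with h | h
  · refine Or.inl ⟨(hρe x).1 h, ?_⟩
    rw [hγ.1 ((hxy.symm.trans h).trans γ.source.symm)]; rfl
  · refine Or.inr ⟨(hρe x).2 h, ?_⟩
    rw [hγ.1 ((hxy.symm.trans h).trans γ.target.symm)]; rfl

theorem pos_ne_of_injective {a b : ℂ} {γ : Path a b} (h : Function.Injective γ) : a ≠ b := by
  intro hab
  have : γ 0 = γ 1 := by rw [γ.source, γ.target, hab]
  exact zero_ne_one (h this)

theorem Network.Route.IsArc.ends {R : N.Route v w} {γ : Path (N.pos v) (N.pos w)}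
    (h : R.IsArc γ) (u : I) :
    (γ u = N.pos v → (u : ℝ) = 0) ∧ (γ u = N.pos w → (u : ℝ) = 1) := by
  refine ⟨fun e => ?_, fun e => ?_⟩
  · rw [h.1 (e.trans γ.source.symm)]; rfl
  · rw [h.1 (e.trans γ.target.symm)]; rfl

theorem Network.IsOuterPair.meetOnlyAtEnds_self {O : Fin 2 → N.Route v w}
    (hO : N.IsOuterPair O) {γ : Fin 2 → Path (N.pos v) (N.pos w)}
    (hγ : ∀ i, (O i).IsArc (γ i)) : MeetOnlyAtEnds (γ 0) (γ 1) :=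
  hO.meetOnlyAtEnds hO.1 (hγ 0).2.subset (hγ 0).ends (hγ 1)

/-- If some route avoids a half-plane, then one of the outer routes does. -/
theorem Network.IsOuterPair.exists_outer_avoids {a b : ℝ} (ha : |a| ≤ Real.pi / 2)
    (hb : |b| ≤ Real.pi / 2) {O : Fin 2 → N.Route v w} (hO : N.IsOuterPair O)
    {γ : Fin 2 → Path (N.pos v) (N.pos w)} (hγ : ∀ i, (O i).IsArc (γ i))
    (hK : ∀ i, range (γ i) ⊆ supportSet (N.pos v) (N.pos w) a b) (R : N.Route v w) {θ c : ℝ}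
    (hR : ∀ z ∈ R.trace, proj θ z < c) : ∃ i, ∀ z ∈ (O i).trace, proj θ z < c := by
  have hst := pos_ne_of_injective (hγ 0).1
  by_cases h0 : R = O 0
  · exact ⟨0, h0 ▸ hR⟩
  by_cases h1 : R = O 1
  · exact ⟨1, h1 ▸ hR⟩
  by_contra hcon
  push Not at hcon
  have hj := R.joinedIn_trace hst
  obtain ⟨ρ, hρ, hρe⟩ := exists_path_of_ne hst hj.somePath
  have hρR : range ρ ⊆ R.trace := hρ.trans (by
    rintro _ ⟨u, rfl⟩; exact hj.somePath_mem u)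
  have hit : ∀ i, ∃ u, c ≤ (γ i u * Complex.exp (-(θ : ℂ) * Complex.I)).re := by
    intro i
    obtain ⟨z, hz, hzc⟩ := hcon i
    rw [← (hγ i).2] at hz
    obtain ⟨u, rfl⟩ := hz
    exact ⟨u, by rwa [← proj_eq_re_mul]⟩
  obtain ⟨u, hu⟩ := exists_mem_halfPlane_of_enclosed hst ha hb (hγ 0).1 (hγ 1).1 (hK 0) (hK 1)
    (hO.meetOnlyAtEnds_self hγ) (hO.meetOnlyAtEnds h0 hρR hρe (hγ 0))
    (hO.meetOnlyAtEnds h1 hρR hρe (hγ 1))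
    (by rw [(hγ 0).2, (hγ 1).2]; exact hρR.trans (hO.2.2 R)) (hit 0) (hit 1)
  rw [← proj_eq_re_mul] at hu
  exact (hR _ (hρR (mem_range_self u))).not_ge hu

end CableNet

/-! ### Fine arrangements, and the two bounds for the probability. -/

namespace CableNet

/-! ### Arrangements -/

/-- Every interval of length `ε` of every link has an unprotected point. -/
def Network.UnprotectedEvery {V E : Type*} (N : Network V E) (W : Arrangement E) (ε : ℝ) : Prop :=
  ∀ e x, 0 ≤ x → x + ε ≤ N.len e → ∃ u ∈ Icc x (x + ε), u ∈ W e

theorem exists_le_fract {r δ : ℝ} (hr0 : 0 < r) (hr1 : r < 1) (hδ : 0 < δ) (x : ℝ) :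
    ∃ u ∈ Icc x (x + δ), r ≤ Int.fract (u / δ) := by
  rcases le_or_gt r (Int.fract (x / δ)) with h | h
  · exact ⟨x, ⟨le_rfl, by linarith⟩, h⟩
  · have hx : (⌊x / δ⌋ + Int.fract (x / δ)) * δ = x := by
      rw [Int.floor_add_fract, div_mul_cancel₀ _ hδ.ne']
    refine ⟨(⌊x / δ⌋ + r) * δ, ⟨?_, ?_⟩, ?_⟩
    · nlinarith
    · nlinarith [Int.fract_nonneg (x / δ)]
    · rw [mul_div_cancel_right₀ _ hδ.ne', Int.fract_intCast_add,
        Int.fract_eq_self.2 ⟨hr0.le, hr1⟩]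

theorem volume_Ico_sdiff_le_fract {r δ : ℝ} (hr0 : 0 < r) (hr1 : r < 1) (hδ : 0 < δ) (n : ℕ) :
    volume (Ico 0 (n * δ) \ {u | r ≤ Int.fract (u / δ)}) = ENNReal.ofReal (r * (n * δ)) := by
  induction n with
  | zero => simp
  | succ n ih =>
    have e : Ico 0 (((n + 1 : ℕ) : ℝ) * δ) \ {u | r ≤ Int.fract (u / δ)}
        = (Ico 0 (n * δ) \ {u | r ≤ Int.fract (u / δ)}) ∪ Ico (n * δ) ((n + r) * δ) := by
      have key : ∀ u, n * δ ≤ u → u < (n + 1) * δ → Int.fract (u / δ) = u / δ - n := by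
        intro u h1 h2
        have : ⌊u / δ⌋ = (n : ℤ) := by
          rw [Int.floor_eq_iff]
          exact ⟨by rw [le_div_iff₀ hδ]; exact_mod_cast h1,
            by rw [div_lt_iff₀ hδ]; exact_mod_cast h2⟩
        rw [Int.fract, this, Int.cast_natCast]
      have hn : 0 ≤ n * δ := by positivity
      have hr : (n + r) * δ < (n + 1) * δ := by nlinarith
      ext u
      simp only [Set.mem_sdiff, mem_Ico, mem_ofPred_eq, mem_union, not_le]
      push_cast
      constructor
      · rintro ⟨⟨h1, h2⟩, h3⟩
        rcases lt_or_ge u (n * δ) with h | h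
        · exact Or.inl ⟨⟨h1, h⟩, h3⟩
        · rw [key u h h2, sub_lt_iff_lt_add', div_lt_iff₀ hδ] at h3
          exact Or.inr ⟨h, h3⟩
      · rintro (⟨⟨h1, h2⟩, h3⟩ | ⟨h1, h2⟩)
        · exact ⟨⟨h1, by linarith⟩, h3⟩
        · refine ⟨⟨hn.trans h1, h2.trans hr⟩, ?_⟩
          rw [key u h1 (h2.trans hr), sub_lt_iff_lt_add', div_lt_iff₀ hδ]
          exact h2
    rw [e, measure_union _ measurableSet_Ico, ih, Real.volume_Ico,
      ← ENNReal.ofReal_add (by positivity) (by nlinarith)]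
    · congr 1
      push_cast
      ring
    · exact disjoint_left.2 fun u h1 h2 => absurd h1.1.2 h2.1.not_gt

theorem measurableSet_le_fract (r δ : ℝ) : MeasurableSet {u : ℝ | r ≤ Int.fract (u / δ)} :=
  measurableSet_le measurable_const (measurable_fract.comp (measurable_id.div_const δ))

section

variable {V E : Type*} {N : Network V E} {r ε : ℝ}

theorem unprotectedEvery_of_fract (hr0 : 0 < r) (hr1 : r < 1) {δ : E → ℝ} (hδ : ∀ e, 0 < δ e)
    (hε : ∀ e, δ e ≤ ε) : N.UnprotectedEvery (fun e => {u | r ≤ Int.fract (u / δ e)}) ε := by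
  intro e x _ _
  obtain ⟨u, hu, h⟩ := exists_le_fract hr0 hr1 (hδ e) x
  exact ⟨u, ⟨hu.1, hu.2.trans (by linarith [hε e])⟩, h⟩

/-- There are arbitrarily fine arrangements that protect exactly the fraction `r`. -/
theorem Network.exists_protects [Fintype E] (N : Network V E) (hr0 : 0 < r) (hr1 : r < 1)
    (hε : 0 < ε) : ∃ W, N.Protects W r ∧ N.UnprotectedEvery W ε := by
  -- The period `len e / ⌈len e / ε⌉₊` is at most `ε` and divides the length of the link, so exactly
  -- the fraction `r` of each link is protected.
  have hn : ∀ e, 0 < ⌈N.len e / ε⌉₊ := fun e => Nat.ceil_pos.2 (div_pos (N.len_pos e) hε)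
  have hn' : ∀ e, (0 : ℝ) < ⌈N.len e / ε⌉₊ := fun e => Nat.cast_pos.2 (hn e)
  have hδ : ∀ e, 0 < N.len e / ⌈N.len e / ε⌉₊ := fun e => div_pos (N.len_pos e) (hn' e)
  refine ⟨_, ⟨fun e => measurableSet_le_fract r (N.len e / ⌈N.len e / ε⌉₊), ?_⟩,
    unprotectedEvery_of_fract hr0 hr1 hδ fun e => ?_⟩
  · rw [Finset.mul_sum]
    refine Finset.sum_congr rfl fun e _ => ?_
    have h := volume_Ico_sdiff_le_fract hr0 hr1 (hδ e) ⌈N.len e / ε⌉₊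
    rw [mul_div_cancel₀ _ (hn' e).ne'] at h
    have h' : (Icc 0 (N.len e) \ {u | r ≤ Int.fract (u / (N.len e / ⌈N.len e / ε⌉₊))} : Set ℝ)
        =ᵐ[volume] (Ico 0 (N.len e) \ {u | r ≤ Int.fract (u / (N.len e / ⌈N.len e / ε⌉₊))} : Set ℝ) :=
      Ico_ae_eq_Icc.symm.diff (ae_eq_refl _)
    rw [measure_congr h', h, ENNReal.toReal_ofReal (mul_pos hr0 (N.len_pos e)).le]
  · rw [div_le_iff₀ (hn' e), ← div_le_iff₀' hε]
    exact Nat.le_ceil _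

/-- A route without disconnected links almost avoids the half-plane. -/
theorem Network.Route.proj_lt_of_survives {v w : V} (R : N.Route v w) {W : Arrangement E}
    (hW : N.UnprotectedEvery W ε) (hε : ∀ e, 2 * ε ≤ N.len e) {G : DirLine}
    (hR : ∀ k, N.LinkSurvives W G (R.link k)) : ∀ z ∈ R.trace, proj G.dir z < G.off + ε := by
  intro z hz
  obtain ⟨k, x, hx, rfl⟩ := mem_iUnion.1 hz
  obtain ⟨u, hu, hxu, huW⟩ : ∃ u ∈ Icc 0 (N.len (R.link k)), |x - u| ≤ ε ∧ u ∈ W (R.link k) := by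
    have h2 := hε (R.link k)
    -- The window of length `ε` is taken ahead of `x`, or behind it near the end of the link, where
    -- `2 ε ≤ len` leaves room.
    rcases le_total (x + ε) (N.len (R.link k)) with h | h
    · obtain ⟨u, hu, huW⟩ := hW _ x hx.1 h
      exact ⟨u, ⟨hx.1.trans hu.1, hu.2.trans h⟩,
        abs_le.2 ⟨by linarith [hu.2], by linarith [hu.1, hu.2]⟩, huW⟩
    · obtain ⟨u, hu, huW⟩ := hW (R.link k) (x - ε) (by linarith) (by linarith [hx.2])
      rw [sub_add_cancel] at hu
      exact ⟨u, ⟨by linarith [hu.1], hu.2.trans hx.2⟩,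
        abs_le.2 ⟨by linarith [hu.1, hu.2], by linarith [hu.1]⟩, huW⟩
  have h1 := hR k u ⟨hu, huW⟩
  rw [mem_rightHalfPlane_iff, not_le] at h1
  have h3 := (hasUnitSpeedOn_lipschitzOnWith (N.unitSpeed (R.link k))).dist_le_mul x hx u hu
  rw [NNReal.coe_one, one_mul, Real.dist_eq, Complex.dist_eq] at h3
  have h4 := (le_abs_self _).trans (abs_proj_le G.dir (N.curve (R.link k) x - N.curve (R.link k) u))
  rw [proj_sub] at h4
  linarith

end

/-! ### Bounds for the probability of connection -/

section

variable {V E : Type*} {N : Network V E} {s t : V} {Ω : Set ℂ} {O : Fin 2 → N.Route s t}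
  {γ : Fin 2 → Path (N.pos s) (N.pos t)}

theorem linePr_eq (hΩb : Bornology.IsBounded Ω) (hΩc : Convex ℝ Ω) (hne : Ω.Nonempty)
    (X : Set DirLine) : linePr Ω X =
      (lineMeasure (X ∩ linesMeeting Ω)).toReal / ∫ θ in (-Real.pi)..Real.pi, supportFn Ω θ := by
  rw [linePr, lineMeasure_linesMeeting hΩc hΩb hne,
    ENNReal.toReal_ofReal (supportFn_nonneg_integral hΩb hne)]

/-- The smaller one of the support functions of two paths. -/
noncomputable def minSupportFn {a b : ℂ} (γ : Fin 2 → Path a b) (θ : ℝ) : ℝ :=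
  min (supportFn (range (γ 0)) θ) (supportFn (range (γ 1)) θ)

theorem continuous_minSupportFn {a b : ℂ} (γ : Fin 2 → Path a b) : Continuous (minSupportFn γ) :=
  (continuous_supportFn (range_nonempty _) (Path.isBounded_range _)).min
    (continuous_supportFn (range_nonempty _) (Path.isBounded_range _))

theorem minSupportFn_add_two_pi {a b : ℂ} (γ : Fin 2 → Path a b) (θ : ℝ) :
    minSupportFn γ (θ + 2 * Real.pi) = minSupportFn γ θ := by
  simp only [minSupportFn, supportFn_add_two_pi]

theorem minSupportFn_le {a b : ℂ} (γ : Fin 2 → Path a b) (i : Fin 2) (θ : ℝ) :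
    minSupportFn γ θ ≤ supportFn (range (γ i)) θ := by
  fin_cases i
  · exact min_le_left _ _
  · exact min_le_right _ _

theorem range_subset_of_isArc (hN : N.carrier ⊆ Ω) (hγ : ∀ i, (O i).IsArc (γ i)) (i : Fin 2) :
    range (γ i) ⊆ Ω := by
  rw [(hγ i).2]
  exact (iUnion_subset fun k => subset_iUnion N.linkSet ((O i).link k)).trans hN

theorem minSupportFn_le_of_range_subset {a b : ℂ} {γ : Fin 2 → Path a b}
    (hΩb : Bornology.IsBounded Ω) (h : ∀ i, range (γ i) ⊆ Ω) (θ : ℝ) :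
    minSupportFn γ θ ≤ supportFn Ω θ :=
  (minSupportFn_le γ 0 θ).trans (supportFn_mono (range_nonempty _) hΩb (h 0) θ)

/-- A half-plane whose offset exceeds the smaller outer support function misses that outer route
entirely, so protection plays no role. -/
theorem le_connectionPr (hΩb : Bornology.IsBounded Ω) (hΩc : Convex ℝ Ω) (hN : N.carrier ⊆ Ω)
    (hγ : ∀ i, (O i).IsArc (γ i)) (W : Arrangement E) :
    (2⁻¹ * ∫ θ in (-Real.pi)..Real.pi, (supportFn Ω θ - minSupportFn γ θ)) /
      (∫ θ in (-Real.pi)..Real.pi, supportFn Ω θ) ≤ N.connectionPr Ω s t W := by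
  have hsub := range_subset_of_isArc hN hγ
  have hs : N.pos s ∈ Ω := hsub 0 ⟨0, (γ 0).source⟩
  have hne : Ω.Nonempty := ⟨_, hs⟩
  rw [Network.connectionPr, linePr_eq hΩb hΩc hne]
  refine div_le_div_of_nonneg_right ?_ (supportFn_nonneg_integral hΩb hne)
  refine (ENNReal.ofReal_le_iff_le_toReal ?_).1 (le_lineMeasure (continuous_minSupportFn γ)
    (continuous_supportFn hne hΩb) (minSupportFn_add_two_pi γ) (supportFn_add_two_pi Ω)
    (minSupportFn_le_of_range_subset hΩb hsub) fun G h1 h2 => ⟨?_, ?_⟩)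
  · refine ne_top_of_le_ne_top ?_ (measure_mono inter_subset_right)
    rw [lineMeasure_linesMeeting hΩc hΩb hne]
    exact ENNReal.ofReal_ne_top
  · have surv : ∀ i, supportFn (range (γ i)) G.dir < G.off → G ∈ N.connectedEvent s t W := by
      refine fun i hi => ⟨O i, fun k u hu hmem => ?_⟩
      rw [mem_rightHalfPlane_iff] at hmem
      have hz : N.curve ((O i).link k) u ∈ range (γ i) := by
        rw [(hγ i).2]
        exact (O i).linkSet_subset k (mem_image_of_mem _ hu.1)
      linarith [proj_le_supportFn (Path.isBounded_range (γ i)) hz G.dir]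
    exact (min_lt_iff.1 h1).elim (surv 0) (surv 1)
  · refine mem_linesMeeting_of_lt hΩc hne (lt_of_le_of_lt ?_ h1) h2
    refine (neg_supportFn_add_pi_le hΩb hs _).trans (le_min ?_ ?_) <;>
      exact (le_max_left _ _).trans (max_proj_le_supportFn_range _ _)

/-- A surviving route avoids the half-plane shifted by `ε`, hence so does an outer route. Widening
the strip by `ε` costs `½ · 2π · ε = π ε`. -/
theorem connectionPr_le (hΩb : Bornology.IsBounded Ω) (hΩc : Convex ℝ Ω) (hN : N.carrier ⊆ Ω)
    (hγ : ∀ i, (O i).IsArc (γ i)) (hO : N.IsOuterPair O) {a b : ℝ} (ha : |a| ≤ Real.pi / 2)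
    (hb : |b| ≤ Real.pi / 2) (hK : ∀ i, range (γ i) ⊆ supportSet (N.pos s) (N.pos t) a b)
    {W : Arrangement E} {ε : ℝ} (hε0 : 0 ≤ ε) (hW : N.UnprotectedEvery W ε)
    (hε : ∀ e, 2 * ε ≤ N.len e) :
    N.connectionPr Ω s t W ≤
      (2⁻¹ * (∫ θ in (-Real.pi)..Real.pi, (supportFn Ω θ - minSupportFn γ θ)) + Real.pi * ε) /
        (∫ θ in (-Real.pi)..Real.pi, supportFn Ω θ) := by
  have hsub := range_subset_of_isArc hN hγ
  have hne : Ω.Nonempty := ⟨_, hsub 0 ⟨0, (γ 0).source⟩⟩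
  have hcΩ := continuous_supportFn hne hΩb
  have hcm := continuous_minSupportFn γ
  have hle := minSupportFn_le_of_range_subset hΩb hsub
  rw [Network.connectionPr, linePr_eq hΩb hΩc hne]
  refine div_le_div_of_nonneg_right ?_ (supportFn_nonneg_integral hΩb hne)
  have hint : 2⁻¹ * ∫ θ in (-Real.pi)..Real.pi, (supportFn Ω θ - (minSupportFn γ θ - ε))
      = 2⁻¹ * (∫ θ in (-Real.pi)..Real.pi, (supportFn Ω θ - minSupportFn γ θ)) + Real.pi * ε := by
    simp only [← sub_add]
    rw [intervalIntegral.integral_add (Continuous.intervalIntegrable (by fun_prop) _ _)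
      intervalIntegrable_const, intervalIntegral.integral_const, smul_eq_mul]
    ring
  rw [← hint]
  refine ENNReal.toReal_le_of_le_ofReal ?_ (lineMeasure_le (a := fun θ => minSupportFn γ θ - ε)
    (by fun_prop) hcΩ
    (fun θ => by rw [minSupportFn_add_two_pi]) (supportFn_add_two_pi Ω)
    (fun θ => by linarith [hle θ]) ?_)
  · rw [hint]
    have : 0 ≤ ∫ θ in (-Real.pi)..Real.pi, (supportFn Ω θ - minSupportFn γ θ) :=
      intervalIntegral.integral_nonneg (by linarith [Real.pi_pos]) fun θ _ => sub_nonneg.2 (hle θ)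
    positivity
  · rintro G ⟨⟨R, hR⟩, hG⟩
    obtain ⟨z, hz, hzG⟩ := mem_linesMeeting_iff.1 hG
    refine ⟨?_, hzG ▸ proj_le_supportFn hΩb hz _⟩
    obtain ⟨i, hi⟩ := hO.exists_outer_avoids ha hb hγ hK R (R.proj_lt_of_survives hW hε hR)
    have : supportFn (range (γ i)) G.dir ≤ G.off + ε :=
      supportFn_le (range_nonempty _) fun z hz => (hi z ((hγ i).2 ▸ hz)).le
    linarith [minSupportFn_le γ i G.dir]

theorem Network.AlmostConvex.exists_subset_supportSet (hac : N.AlmostConvex O)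
    (hγ : ∀ i, (O i).IsArc (γ i)) : ∃ a b : ℝ, |a| ≤ Real.pi / 2 ∧ |b| ≤ Real.pi / 2 ∧
      ∀ i, range (γ i) ⊆ supportSet (N.pos s) (N.pos t) a b := by
  have hsub : ∀ i, range (γ i) ⊆ convexHull ℝ ((O 0).trace ∪ (O 1).trace) := by
    refine fun i => Subset.trans ?_ (subset_convexHull ℝ _)
    rw [(hγ i).2]
    fin_cases i
    · exact subset_union_left
    · exact subset_union_right
  obtain ⟨a, b, ha, hb, hK⟩ := CableNet.exists_subset_supportSet (convex_convexHull ℝ _)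
    (pos_ne_of_injective (hγ 0).1) (hsub 0 ⟨0, (γ 0).source⟩) (hsub 0 ⟨1, (γ 0).target⟩)
    hac.1 hac.2
  exact ⟨a, b, ha, hb, fun i => (hsub i).trans hK⟩

theorem perimeter_segment (x y : ℂ) : perimeter (segment ℝ x y)
    = ∫ θ in (-Real.pi)..Real.pi, supportFn (segment ℝ x y) θ :=
  perimeter_eq_integral (convex_segment x y) (isBounded_segment x y) ⟨x, left_mem_segment ℝ x y⟩

theorem perimeter_convexHull_innerPart {x y : ℂ} (α β : Path x y) :
    perimeter (convexHull ℝ (innerPart α β ∪ segment ℝ x y))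
      = ∫ θ in (-Real.pi)..Real.pi, supportFn (innerPart α β ∪ segment ℝ x y) θ := by
  rw [perimeter_eq_integral (convex_convexHull ℝ _)
    (isBounded_convexHull.2 (isBounded_innerPart_union α β))
    (innerPart_union_nonempty α β).convexHull]
  simp only [supportFn_convexHull (innerPart_union_nonempty α β) (isBounded_innerPart_union α β)]

theorem perimeter_sub_eq_integral {a b : ℝ} (hΩb : Bornology.IsBounded Ω) (hΩc : Convex ℝ Ω)
    (hne : Ω.Nonempty) {x y : ℂ} (hxy : x ≠ y) (ha : |a| ≤ Real.pi / 2) (hb : |b| ≤ Real.pi / 2)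
    {γ : Fin 2 → Path x y} (hK : ∀ i, range (γ i) ⊆ supportSet x y a b)
    (hγ : MeetOnlyAtEnds (γ 0) (γ 1)) :
    perimeter Ω + perimeter (segment ℝ x y) - ∑ i : Fin 2, perimeter (convexHull ℝ
      (innerPart (γ i) (γ (1 - i)) ∪ segment ℝ x y))
      = ∫ θ in (-Real.pi)..Real.pi, (supportFn Ω θ - minSupportFn γ θ) := by
  have hc : ∀ {C : Set ℂ}, C.Nonempty → Bornology.IsBounded C →
      IntervalIntegrable (supportFn C) volume (-Real.pi) Real.pi := fun h1 h2 =>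
    (continuous_supportFn h1 h2).intervalIntegrable _ _
  have i0 := hc hne hΩb
  have i1 := hc ⟨x, left_mem_segment ℝ x y⟩ (isBounded_segment x y)
  have i2 := hc (innerPart_union_nonempty (γ 0) (γ 1)) (isBounded_innerPart_union (γ 0) (γ 1))
  have i3 := hc (innerPart_union_nonempty (γ 1) (γ 0)) (isBounded_innerPart_union (γ 1) (γ 0))
  have e1 : (1 : Fin 2) - 0 = 1 := rfl
  have e2 : (1 : Fin 2) - 1 = 0 := rfl
  simp only [minSupportFn, ← supportFn_innerParts hxy ha hb (hK 0) (hK 1) hγ]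
  rw [intervalIntegral.integral_sub i0 ((i2.add i3).sub i1), intervalIntegral.integral_sub
    (i2.add i3) i1, intervalIntegral.integral_add i2 i3, Fin.sum_univ_two, e1, e2,
    perimeter_eq_integral hΩc hΩb hne, perimeter_segment, perimeter_convexHull_innerPart,
    perimeter_convexHull_innerPart]
  ring

end

end CableNet

/-! ### The squeeze between the two bounds. -/

theorem theorem3 {V E : Type*} [Fintype E] (N : CableNet.Network V E) (s t : V)
    (Ω : Set ℂ) (hΩb : Bornology.IsBounded Ω) (hΩc : Convex ℝ Ω) (hN : N.carrier ⊆ Ω)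
    (O : Fin 2 → N.Route s t) (γ : Fin 2 → Path (N.pos s) (N.pos t))
    (hγ : ∀ i, (O i).IsArc (γ i)) (hO : N.IsOuterPair O) (hac : N.AlmostConvex O)
    (r : ℝ) (hr0 : 0 < r) (hr1 : r < 1)
    (p : ℝ)
    (hp : p = (CableNet.perimeter Ω + CableNet.perimeter (segment ℝ (N.pos s) (N.pos t))
      - ∑ i : Fin 2, CableNet.perimeter (convexHull ℝ
          (CableNet.innerPart (γ i) (γ (1 - i)) ∪ segment ℝ (N.pos s) (N.pos t))))
      / (2 * CableNet.perimeter Ω)) :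
    Tendsto (fun ε : ℝ => N.connectionPr Ω s t (CableNet.alternating E r ε)) (𝓝[>] 0) (𝓝 p) ∧
    (∀ W : CableNet.Arrangement E, p ≤ N.connectionPr Ω s t W) ∧
    IsGLB {q : ℝ | ∃ W : CableNet.Arrangement E, N.Protects W r ∧
      q = N.connectionPr Ω s t W} p := by
  open CableNet in
  obtain ⟨a, b, ha, hb, hK⟩ := hac.exists_subset_supportSet hγ
  have hne : Ω.Nonempty := ⟨_, range_subset_of_isArc hN hγ 0 ⟨0, (γ 0).source⟩⟩
  rw [perimeter_sub_eq_integral hΩb hΩc hne (pos_ne_of_injective (hγ 0).1) ha hb hK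
    (hO.meetOnlyAtEnds_self hγ), perimeter_eq_integral hΩc hΩb hne] at hp
  set T := ∫ θ in (-Real.pi)..Real.pi, supportFn Ω θ with hT
  set M := ∫ θ in (-Real.pi)..Real.pi, (supportFn Ω θ - minSupportFn γ θ) with hM
  have hp' : p = (2⁻¹ * M) / T := by
    rw [hp]
    field_simp
  have lower : ∀ W : Arrangement E, p ≤ N.connectionPr Ω s t W := fun W => by
    rw [hp']
    exact le_connectionPr hΩb hΩc hN hγ W
  have upper : ∀ᶠ ε in 𝓝[>] (0 : ℝ), ∀ W : Arrangement E, N.UnprotectedEvery W ε →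
      N.connectionPr Ω s t W ≤ (2⁻¹ * M + Real.pi * ε) / T := by
    have h : ∀ᶠ ε in 𝓝[>] (0 : ℝ), ∀ e, 2 * ε ≤ N.len e := by
      refine eventually_all.2 fun e => ?_
      filter_upwards [Ioo_mem_nhdsGT (half_pos (N.len_pos e))] with ε hε
      linarith [hε.2]
    filter_upwards [h, self_mem_nhdsWithin] with ε h1 h2 W hW
    exact connectionPr_le hΩb hΩc hN hγ hO ha hb hK (le_of_lt h2) hW h1
  have lim : Tendsto (fun ε : ℝ => (2⁻¹ * M + Real.pi * ε) / T) (𝓝[>] 0) (𝓝 p) := by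
    have : Continuous fun ε : ℝ => (2⁻¹ * M + Real.pi * ε) / T := by fun_prop
    have h := (this.tendsto 0).mono_left (nhdsWithin_le_nhds (s := Ioi 0))
    rwa [mul_zero, add_zero, ← hp'] at h
  refine ⟨?_, lower, ?_, fun b hb => ?_⟩
  · refine tendsto_of_tendsto_of_tendsto_of_le_of_le' tendsto_const_nhds lim
      (Eventually.of_forall fun _ => lower _) ?_
    filter_upwards [upper, self_mem_nhdsWithin] with ε h1 h2
    exact h1 _ (unprotectedEvery_of_fract hr0 hr1 (fun _ => h2) fun _ => le_rfl)
  · rintro _ ⟨W, -, rfl⟩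
    exact lower W
  -- Arrangements protecting exactly the fraction `r` can be arbitrarily fine, so every lower bound
  -- lies below upper bounds that tend to `p`.
  · refine ge_of_tendsto lim ?_
    filter_upwards [upper, self_mem_nhdsWithin] with ε h1 h2
    obtain ⟨W, hW, hWε⟩ := N.exists_protects hr0 hr1 h2
    exact (hb ⟨W, hW, rfl⟩).trans (h1 W hWε)
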